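/- Let $\zeta$ be the Riemann zeta function and $\Lambda$ the von Mangoldt function. For $t>0$ not the ordinate of a zero of $\zeta$, let $S(t)=\frac1\pi\arg\zeta(\frac12+it)$, where the argument is obtained by continuous variation along the straight line segments joining $2$, $2+it$ and $\frac12+it$, starting from $\arg\zeta(2)=0$; if $t>0$ is the ordinate of a zero, let $S(t)=\frac12\lim_{\varepsilon\to0}\{S(t+\varepsilon)+S(t-\varepsilon)\}$. Put $S_0=S$ and, for $n\ge1$ and $t>0$, $S_n(t)=\int_0^tS_{n-1}(\tau)\,d\tau+\delta_n$, where for $k\ge 1$ $$\delta_{2k-1}=\frac{(-1)^{k-1}}{\pi}\int_{1/2}^\infty\int_{\sigma_{2k-2}}^\infty\cdots\int_{\sigma_1}^\infty\log|\zeta(\sigma_0)|\,d\sigma_0\,d\sigma_1\cdots d\sigma_{2k-2},$$ $$\delta_{2k}=(-1)^{k-1}\int_{1/2}^1\int_{\sigma_{2k-1}}^1\cdots\int_{\sigma_1}^1d\sigma_0\,d\sigma_1\cdots d\sigma_{2k-1}=\frac{(-1)^{k-1}}{(2k)!\,2^{2k}}.$$ For an integer $n\ge1$ and $0<u\le1$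 define $$f_n(u)=\frac{u^{n+1}}{n!}\int_0^\infty y^n\,\frac{2\sinh(y(1-u))}{e^y+(-1)^{n+1}e^{-y}}\,dy,\qquad g_n(u)=\frac{1-f_n(u)}{u^{n+1}},$$ $$A_n=\int_0^1\alpha\,g_n(\alpha)^2\,d\alpha,\qquad C_n=\sum_{m=2}^\infty\frac{\Lambda(m)^2}{m(\log m)^{2n+2}},$$ and, for $x\ge4$, $t\geq 1$ and $T\ge3$, $$I_{3,n}(x,t)=\frac1\pi\sum_{2\le m\le x}\operatorname{Im}\{i^nm^{-it}\}\,\frac{\Lambda(m)}{\sqrt m(\log m)^{n+1}}\,f_n\Big(\frac{\log m}{\log x}\Big),$$ $$H_n(x,T)=2\int_1^TS_n(t)\,I_{3,n}(x,t)\,dt,\qquad G_n(x,T)=\int_1^T|I_{3,n}(x,t)|^2\,dt.$$ Assume the Riemann Hypothesis, and let $n\ge1$ be a fixed integer and $0<\beta<\frac12$ a fixed real number. Then, as $T\to\infty$, $$H_n(T^\beta,T)-G_n(T^\beta,T)=\frac{T}{2\pi^2}\,C_n-\frac{T}{2\pi^2\beta^{2n}(\log T)^{2n}}\Big[A_n+\frac1{2n}\Big]+O\Big(\frac{T}{(\log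 T)^{2n+1}}\Big),$$ where the implied constant may depend on $n$ and $\beta$. -/

import Mathlib

noncomputable section

namespace ZetaSn

open MeasureTheory Filter Topology

/-- `a` is the argument of `ζ(1/2 + it)` obtained by continuous variation along the straight line
segments joining `2`, `2 + it` and `1/2 + it`, starting from `arg ζ(2) = 0` (for `t > 0`). The
function `θ` is the argument on the vertical segment, `φ` the one on the horizontal segment. -/
def IsArgAlongPath (t a : ℝ) : Prop :=
  ∃ θ φ : ℝ → ℝ,
    ContinuousOn θ (Set.Icc 0 t) ∧
    ContinuousOn φ (Set.Icc (1 / 2) 2) ∧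
    θ 0 = 0 ∧
    (∀ u ∈ Set.Icc (0 : ℝ) t,
      riemannZeta (2 + u * Complex.I) =
        ‖riemannZeta (2 + u * Complex.I)‖ * Complex.exp (θ u * Complex.I)) ∧
    φ 2 = θ t ∧
    (∀ σ ∈ Set.Icc (1 / 2 : ℝ) 2,
      riemannZeta (σ + t * Complex.I) =
        ‖riemannZeta (σ + t * Complex.I)‖ * Complex.exp (φ σ * Complex.I)) ∧
    φ (1 / 2) = a

/-- The value `arg ζ(1/2 + it)`. It exists and is unique when `t > 0` is not the ordinate of a
zero of `ζ`. -/
def argZeta (t : ℝ) : ℝ := Classical.epsilon (IsArgAlongPath t)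

/-- `t` is the ordinate of a zero of `ζ`. -/
def IsOrdinate (t : ℝ) : Prop := ∃ σ : ℝ, riemannZeta (σ + t * Complex.I) = 0

open Classical in
/-- The argument function `S(t)`, for `t > 0`. At the ordinate of a zero it is the mean of the
one-sided limits; points close to an ordinate are not ordinates themselves, so there `S` is
`arg ζ / π`. -/
def S (t : ℝ) : ℝ :=
  if IsOrdinate t then
    1 / 2 * limUnder (𝓝[≠] (0 : ℝ))
      (fun ε : ℝ => 1 / Real.pi * argZeta (t + ε) + 1 / Real.pi * argZeta (t - ε))
  else 1 / Real.pi * argZeta t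

/-- `j`-fold iterated integral
`∫_{σ}^∞ ∫_{σ_{j-1}}^∞ ⋯ ∫_{σ_1}^∞ log |ζ(σ_0)| dσ_0 ⋯ dσ_{j-1}`. -/
def iterLogZeta : ℕ → ℝ → ℝ
  | 0, σ => Real.log ‖riemannZeta σ‖
  | j + 1, σ => ∫ u in Set.Ioi σ, iterLogZeta j u

/-- `j`-fold iterated integral `∫_{σ}^1 ∫_{σ_{j-1}}^1 ⋯ ∫_{σ_1}^1 dσ_0 ⋯ dσ_{j-1}`. -/
def iterOne : ℕ → ℝ → ℝ
  | 0, _ => 1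
  | j + 1, σ => ∫ u in σ..1, iterOne j u

/-- The constants `δ_n`, `n ≥ 1`. The exponent `(n - 1) / 2` (rounded down) is `k - 1` both for
`n = 2k - 1` and for `n = 2k`. -/
def δ (n : ℕ) : ℝ :=
  if Odd n then (-1) ^ ((n - 1) / 2) / Real.pi * iterLogZeta n (1 / 2)
  else (-1) ^ ((n - 1) / 2) * iterOne n (1 / 2)

/-- The iterated antiderivatives `S_n` of `S`. -/
def Sn : ℕ → ℝ → ℝ
  | 0, t => S t
  | n + 1, t => (∫ τ in (0 : ℝ)..t, Sn n τ) + δ (n + 1)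

/-- The weight `f_n`. -/
def f (n : ℕ) (x : ℝ) : ℝ :=
  x ^ (n + 1) / (n.factorial : ℝ) *
    ∫ y in Set.Ioi (0 : ℝ),
      y ^ n * (2 * Real.sinh (y * (1 - x)) / (Real.exp y + (-1) ^ (n + 1) * Real.exp (-y)))

/-- `g_n(x) = (1 - f_n(x)) / x^{n+1}`, for `x > 0`. -/
def g (n : ℕ) (x : ℝ) : ℝ := (1 - f n x) / x ^ (n + 1)

/-- `A_n = ∫_0^1 α g_n(α)² dα`. -/
def A (n : ℕ) : ℝ := ∫ α in (0 : ℝ)..1, α * g n α ^ 2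

/-- `C_n = ∑_{m ≥ 2} Λ(m)² / (m (log m)^{2n+2})`, with the index shifted by `2`. -/
def C (n : ℕ) : ℝ :=
  ∑' k : ℕ, ArithmeticFunction.vonMangoldt (k + 2) ^ 2 /
    (((k + 2 : ℕ) : ℝ) * Real.log ((k + 2 : ℕ) : ℝ) ^ (2 * n + 2))

/-- The Dirichlet polynomial `I_{3,n}(x,t)` over the prime powers up to `x`. -/
def I₃ (n : ℕ) (x t : ℝ) : ℝ :=
  1 / Real.pi * ∑ m ∈ Finset.Icc 2 ⌊x⌋₊,
    (Complex.I ^ n * (m : ℂ) ^ (-(Complex.I * t))).im *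
      (ArithmeticFunction.vonMangoldt m / (Real.sqrt m * Real.log m ^ (n + 1))) *
      f n (Real.log m / Real.log x)

/-- `H_n(x,T) = 2 ∫_1^T S_n(t) I_{3,n}(x,t) dt`. -/
def H (n : ℕ) (x T : ℝ) : ℝ := 2 * ∫ t in (1 : ℝ)..T, Sn n t * I₃ n x t

/-- `G_n(x,T) = ∫_1^T |I_{3,n}(x,t)|² dt`. -/
def G (n : ℕ) (x T : ℝ) : ℝ := ∫ t in (1 : ℝ)..T, |I₃ n x t| ^ 2

end ZetaSn

end

noncomputable section

namespace ZetaSn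

open MeasureTheory Filter Topology
open ArithmeticFunction (vonMangoldt)

/-! Under RH, (s - 1)ζ(s) has a holomorphic logarithm on Re s > 1/2, which gives log ζ there. Let
L_n be the n-fold integral of log ζ along horizontal half-lines to the right. Differentiating
upwards and letting σ → 1/2 shows S_n(t) = π⁻¹ Im(i^n L_n(1/2 + it)) for n ≥ 1; the constants δ_n
are exactly the values at t = 0 (`Sn_eq`). For Re s > 1, L_n(s) = Σ Λ(k)(log k)^{-n-1} k^{-s}
(`iterInt_eq_mangoldtSeries`).

To correlate S_n with Im(i^n m^{-it}), multiply L_n by m^{±s} and move the line of integration to Re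
s = c > 1. There every term but k = m oscillates, so the correlation is (T/2π) a_m + O(m^{c+1/2} log
T) with a_m = Λ(m)/(√m (log m)^{n+1}). The log T comes from the horizontal sides, where
Borel–Carathéodory bounds log ζ by log T/(σ - 1/2), and one integration makes this integrable up to
the critical line (`exists_abs_integral_Sn_mul_osc_sub_le`). Hence H = (T/2π²) Σ 2 a_m² f +
O(x^{c+1} log T), while orthogonality of the m^{-it} gives G = (T/2π²) Σ a_m² f² + O(x²). For x =
T^β with β < 1/2, the choice c = 1/(2β) makes both errors a power of T smaller than T.

What remains is the diagonal sum with weight 2f - f² = 1 - (1 - f)² = 1 - u^{2n+2} g², where u = log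
m/log x (`exists_abs_sum_weighted_sub_le`). The power of u cancels the logarithms in a_m², so the
sum is Σ_{m ≤ x} a_m² - (log x)^{-2n-2} Σ_{m ≤ x} Λ(m)² g²/m. The tail of the first series is about
1/(2n (log x)^{2n}), and the second sum is about A_n (log x)². Both follow from Mertens' first
theorem by partial summation, because g is bounded and increasing; the prime number theorem is not
needed. -/

/-! ### The weights f_n and g_n -/

/-- The ratio `(e^{yu} + ε e^{-yu}) / (e^y + ε e^{-y})`, `ε = (-1)^{n+1}`: a quotient of two
hyperbolic sines or of two hyperbolic cosines. -/
def hypRatio (n : ℕ) (u y : ℝ) : ℝ :=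
  (Real.exp (y * u) + (-1) ^ (n + 1) * Real.exp (-(y * u))) /
    (Real.exp y + (-1) ^ (n + 1) * Real.exp (-y))

lemma hypRatio_denom_pos (n : ℕ) {y : ℝ} (hy : 0 < y) :
    0 < Real.exp y + (-1) ^ (n + 1) * Real.exp (-y) := by
  have h1 : Real.exp (-y) < Real.exp y := Real.exp_lt_exp.mpr (by linarith)
  have h2 := Real.exp_pos (-y)
  rcases neg_one_pow_eq_or ℝ (n + 1) with h | h <;> rw [h] <;> linarith

lemma hypRatio_num_mono (n : ℕ) {a b : ℝ} (ha : 0 ≤ a) (hab : a ≤ b) :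
    Real.exp a + (-1) ^ (n + 1) * Real.exp (-a) ≤ Real.exp b + (-1) ^ (n + 1) * Real.exp (-b) := by
  rcases neg_one_pow_eq_or ℝ (n + 1) with h | h <;> rw [h]
  · have h1 := Real.cosh_le_cosh.mpr (by rwa [abs_of_nonneg ha, abs_of_nonneg (ha.trans hab)] :
      |a| ≤ |b|)
    rw [Real.cosh_eq, Real.cosh_eq] at h1
    linarith
  · have h1 : Real.exp a ≤ Real.exp b := Real.exp_le_exp.mpr hab
    have h2 : Real.exp (-b) ≤ Real.exp (-a) := Real.exp_le_exp.mpr (by linarith)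
    linarith

lemma hypRatio_num_nonneg (n : ℕ) {a : ℝ} (ha : 0 ≤ a) :
    0 ≤ Real.exp a + (-1) ^ (n + 1) * Real.exp (-a) := by
  rcases neg_one_pow_eq_or ℝ (n + 1) with h | h <;> rw [h]
  · positivity
  · have h1 : Real.exp (-a) ≤ Real.exp a := Real.exp_le_exp.mpr (by linarith)
    linarith

lemma hypRatio_mono (n : ℕ) {u v y : ℝ} (hy : 0 < y) (hu : 0 ≤ u) (huv : u ≤ v) :
    hypRatio n u y ≤ hypRatio n v y := by
  unfold hypRatio
  have := hypRatio_denom_pos n hy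
  gcongr ?_ / _
  exact hypRatio_num_mono n (by positivity) (by gcongr)

lemma hypRatio_nonneg (n : ℕ) {u y : ℝ} (hy : 0 < y) (hu : 0 ≤ u) : 0 ≤ hypRatio n u y :=
  div_nonneg (hypRatio_num_nonneg n (by positivity)) (hypRatio_denom_pos n hy).le

lemma hypRatio_le_one (n : ℕ) {u y : ℝ} (hy : 0 < y) (hu : 0 ≤ u) (hu1 : u ≤ 1) :
    hypRatio n u y ≤ 1 := by
  refine (hypRatio_mono n hy hu hu1).trans ?_
  unfold hypRatio
  rw [mul_one]
  exact div_self_le_one _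

lemma integrableOn_pow_mul_exp_neg (n : ℕ) {u : ℝ} (hu : 0 < u) :
    IntegrableOn (fun y : ℝ => y ^ n * Real.exp (-(u * y))) (Set.Ioi 0) := by
  have h := integrableOn_rpow_mul_exp_neg_mul_rpow (p := 1) (s := n)
    (by have : (0 : ℝ) ≤ n := n.cast_nonneg
        linarith) one_pos hu
  simpa using h

lemma integral_pow_mul_exp_neg (n : ℕ) {u : ℝ} (hu : 0 < u) :
    ∫ y in Set.Ioi (0 : ℝ), y ^ n * Real.exp (-(u * y)) = n.factorial / u ^ (n + 1) := by
  have h := Real.integral_rpow_mul_exp_neg_mul_Ioi (a := n + 1) (r := u) (by positivity) hu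
  rw [Real.Gamma_nat_eq_factorial] at h
  simp only [add_sub_cancel_right, Real.rpow_natCast] at h
  rw [h, show ((n : ℝ) + 1) = ((n + 1 : ℕ) : ℝ) by push_cast; rfl, Real.rpow_natCast,
    one_div, inv_pow, div_eq_inv_mul]

lemma integrableOn_hypRatio (n : ℕ) {u : ℝ} (hu : 0 ≤ u) (hu1 : u ≤ 1) :
    IntegrableOn (fun y : ℝ => y ^ n * Real.exp (-y) * hypRatio n u y) (Set.Ioi 0) := by
  have h := integrableOn_pow_mul_exp_neg n one_pos
  simp only [one_mul] at h
  refine Integrable.mono' h ?_ ?_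
  · refine Measurable.aestronglyMeasurable ?_
    unfold hypRatio
    fun_prop
  · filter_upwards [ae_restrict_mem measurableSet_Ioi] with y hy
    have hy : 0 < y := hy
    rw [Real.norm_of_nonneg (mul_nonneg (by positivity) (hypRatio_nonneg n hy hu))]
    exact mul_le_of_le_one_right (by positivity) (hypRatio_le_one n hy hu hu1)

/-- With D = e^y + εe^{-y}, one has 2 sinh(y(1-u)) = e^{-uy} D - e^{-y}(e^{yu} + εe^{-yu}). The
first part integrates to n!/u^{n+1} and produces the 1. So g_n is an integral whose integrand
increases in u and stays below y^n e^{-y}; the bounds and the monotonicity of g_n are read off from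
this. -/
lemma f_eq_one_sub (n : ℕ) {u : ℝ} (hu : 0 < u) (hu1 : u ≤ 1) :
    f n u = 1 - u ^ (n + 1) / n.factorial *
      ∫ y in Set.Ioi (0 : ℝ), y ^ n * Real.exp (-y) * hypRatio n u y := by
  have h1 : ∫ y in Set.Ioi (0 : ℝ),
      y ^ n * (2 * Real.sinh (y * (1 - u)) / (Real.exp y + (-1) ^ (n + 1) * Real.exp (-y))) =
      ∫ y in Set.Ioi (0 : ℝ), (y ^ n * Real.exp (-(u * y)) -
        y ^ n * Real.exp (-y) * hypRatio n u y) := by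
    refine setIntegral_congr_fun measurableSet_Ioi fun y hy => ?_
    have hd := (hypRatio_denom_pos n hy).ne'
    simp only [hypRatio]
    rw [Real.sinh_eq]
    have e1 : Real.exp (y * (1 - u)) = Real.exp y * Real.exp (-(u * y)) := by
      rw [← Real.exp_add]; ring_nf
    have e2 : Real.exp (-(y * (1 - u))) = Real.exp (-y) * Real.exp (y * u) := by
      rw [← Real.exp_add]; ring_nf
    rw [e1, e2, mul_comm u y]
    generalize (-1 : ℝ) ^ (n + 1) = ε at hd ⊢
    generalize Real.exp y = a at hd ⊢
    generalize Real.exp (-y) = b at hd ⊢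
    -- The denominator becomes a single variable d, so that it can be cleared.
    obtain ⟨d, rfl⟩ : ∃ d, a = d - ε * b := ⟨a + ε * b, by ring⟩
    rw [sub_add_cancel] at hd ⊢
    field_simp
    ring
  unfold f
  rw [h1, integral_sub (integrableOn_pow_mul_exp_neg n hu) (integrableOn_hypRatio n hu.le hu1),
    integral_pow_mul_exp_neg n hu]
  have : (n.factorial : ℝ) ≠ 0 := by positivity
  field_simp

lemma g_eq_integral (n : ℕ) {u : ℝ} (hu : 0 < u) (hu1 : u ≤ 1) :
    g n u = (∫ y in Set.Ioi (0 : ℝ), y ^ n * Real.exp (-y) * hypRatio n u y) / n.factorial := by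
  unfold g
  rw [f_eq_one_sub n hu hu1]
  field_simp
  ring

lemma g_nonneg (n : ℕ) {u : ℝ} (hu : 0 < u) (hu1 : u ≤ 1) : 0 ≤ g n u := by
  rw [g_eq_integral n hu hu1]
  refine div_nonneg (setIntegral_nonneg measurableSet_Ioi fun y hy => ?_) (by positivity)
  have hy : 0 < y := hy
  exact mul_nonneg (by positivity) (hypRatio_nonneg n hy hu.le)

lemma g_mono (n : ℕ) {u v : ℝ} (hu : 0 < u) (huv : u ≤ v) (hv1 : v ≤ 1) : g n u ≤ g n v := by
  rw [g_eq_integral n hu (huv.trans hv1), g_eq_integral n (hu.trans_le huv) hv1]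
  gcongr ?_ / _
  refine setIntegral_mono_on (integrableOn_hypRatio n hu.le (huv.trans hv1))
    (integrableOn_hypRatio n (hu.le.trans huv) hv1) measurableSet_Ioi fun y hy => ?_
  have hy : 0 < y := hy
  exact mul_le_mul_of_nonneg_left (hypRatio_mono n hy hu.le huv) (by positivity)

lemma g_le_one (n : ℕ) {u : ℝ} (hu : 0 < u) (hu1 : u ≤ 1) : g n u ≤ 1 := by
  rw [g_eq_integral n hu hu1, div_le_one (by positivity)]
  have h := integral_pow_mul_exp_neg n one_pos
  have h' := integrableOn_pow_mul_exp_neg n one_pos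
  simp only [one_mul, one_pow, div_one] at h h'
  rw [← h]
  refine setIntegral_mono_on (integrableOn_hypRatio n hu.le hu1) h' measurableSet_Ioi
    fun y hy => ?_
  have hy : 0 < y := hy
  exact mul_le_of_le_one_right (by positivity) (hypRatio_le_one n hy hu.le hu1)

lemma one_sub_f_eq (n : ℕ) {u : ℝ} (hu : 0 < u) : 1 - f n u = u ^ (n + 1) * g n u := by
  unfold g
  field_simp

lemma f_le_one (n : ℕ) {u : ℝ} (hu : 0 < u) (hu1 : u ≤ 1) : f n u ≤ 1 := by
  have := one_sub_f_eq n hu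
  have := mul_nonneg (pow_nonneg hu.le (n + 1)) (g_nonneg n hu hu1)
  linarith

lemma f_nonneg (n : ℕ) {u : ℝ} (hu : 0 < u) (hu1 : u ≤ 1) : 0 ≤ f n u := by
  have := one_sub_f_eq n hu
  have := mul_le_one₀ (pow_le_one₀ hu.le hu1 (n := n + 1)) (g_nonneg n hu hu1) (g_le_one n hu hu1)
  linarith

/-! ### Mertens' first theorem and proper prime powers -/

/-- The convolution Λ * 1 = log, summed up to N. -/
lemma sum_vonMangoldt_mul_div (N : ℕ) :
    ∑ m ∈ Finset.Ioc 0 N, vonMangoldt m * ((N / m : ℕ) : ℝ) = Real.log N.factorial := by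
  rw [← ArithmeticFunction.sum_Ioc_mul_zeta_eq_sum, ArithmeticFunction.vonMangoldt_mul_zeta]
  simp only [ArithmeticFunction.log_apply]
  induction N with
  | zero => simp
  | succ k ih =>
    rw [Finset.sum_Ioc_succ_top (by omega), ih, Nat.factorial_succ, Nat.cast_mul,
      Real.log_mul (by positivity) (by positivity), add_comm]

lemma log_factorial_le (N : ℕ) : Real.log N.factorial ≤ N * Real.log N := by
  rw [← Real.log_pow]
  exact Real.log_le_log (by positivity) (mod_cast Nat.factorial_le_pow N)

lemma le_log_factorial {N : ℕ} (hN : N ≠ 0) : N * Real.log N - N ≤ Real.log N.factorial := by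
  have h := Stirling.le_log_factorial_stirling hN
  have h1 : 0 ≤ Real.log N := Real.log_natCast_nonneg N
  have h2 : 0 ≤ Real.log (2 * Real.pi) := Real.log_nonneg (by linarith [Real.pi_gt_three])
  linarith

/-- The first theorem of Mertens for the von Mangoldt function. -/
lemma exists_abs_sum_vonMangoldt_div_sub_log_le :
    ∃ C : ℝ, 0 ≤ C ∧ ∀ N : ℕ, 1 ≤ N →
      |∑ m ∈ Finset.Ioc 0 N, vonMangoldt m / m - Real.log N| ≤ C := by
  -- This is the constant in Chebyshev's bound for ψ(N), which controls the loss from replacing N/m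
  -- by its integer part. On the lower side only the 1 from Stirling is lost.
  refine ⟨Real.log 4 + 4, by positivity, fun N hN => ?_⟩
  have hN0 : (0 : ℝ) < N := by exact_mod_cast hN
  have hlo : Real.log N.factorial ≤ N * ∑ m ∈ Finset.Ioc 0 N, vonMangoldt m / m := by
    rw [← sum_vonMangoldt_mul_div, Finset.mul_sum]
    refine Finset.sum_le_sum fun m hm => ?_
    have h1 : ((N / m : ℕ) : ℝ) ≤ (N : ℝ) / m := Nat.cast_div_le
    calc vonMangoldt m * ((N / m : ℕ) : ℝ) ≤ vonMangoldt m * ((N : ℝ) / m) := by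
          gcongr
      _ = _ := by ring
  have hhi : N * ∑ m ∈ Finset.Ioc 0 N, vonMangoldt m / m ≤
      Real.log N.factorial + (Real.log 4 + 4) * N := by
    have hpsi := Chebyshev.psi_le_const_mul_self (x := N) hN0.le
    rw [Chebyshev.psi, Nat.floor_natCast] at hpsi
    refine le_trans ?_ (add_le_add_right hpsi _)
    rw [← sum_vonMangoldt_mul_div, Finset.mul_sum, ← Finset.sum_add_distrib]
    refine Finset.sum_le_sum fun m hm => ?_
    have h1 : (N : ℝ) / m ≤ ((N / m : ℕ) : ℝ) + 1 := by
      rw [← Nat.floor_div_eq_div (K := ℝ)]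
      exact (Nat.lt_floor_add_one _).le
    calc (N : ℝ) * (vonMangoldt m / m) = vonMangoldt m * ((N : ℝ) / m) := by ring
      _ ≤ vonMangoldt m * (((N / m : ℕ) : ℝ) + 1) := by
          gcongr
      _ = _ := by ring
  have h3 := log_factorial_le N
  have h4 := le_log_factorial (N := N) (by omega)
  have hl4 : 0 ≤ Real.log 4 := Real.log_nonneg (by norm_num)
  rw [abs_le]
  constructor
  · have : (N : ℝ) * (Real.log N - 1) ≤ N * ∑ m ∈ Finset.Ioc 0 N, vonMangoldt m / m := by linarith
    have := le_of_mul_le_mul_left this hN0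
    linarith
  · have : (N : ℝ) * ∑ m ∈ Finset.Ioc 0 N, vonMangoldt m / m ≤
      N * (Real.log N + (Real.log 4 + 4)) := by linarith
    have := le_of_mul_le_mul_left this hN0
    linarith

/-- The difference between `Λ(m) log m / m` and `Λ(m)² / m`; it is supported on proper prime
powers. -/
def powerDefect (m : ℕ) : ℝ := vonMangoldt m * (Real.log m - vonMangoldt m) / m

lemma powerDefect_nonneg (m : ℕ) : 0 ≤ powerDefect m :=
  div_nonneg (mul_nonneg ArithmeticFunction.vonMangoldt_nonneg
    (sub_nonneg.mpr ArithmeticFunction.vonMangoldt_le_log)) (by positivity)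

lemma powerDefect_prime_pow (p : Nat.Primes) (k : ℕ) :
    powerDefect ((p : ℕ) ^ (k + 1)) = k * Real.log p ^ 2 / (p : ℝ) ^ (k + 1) := by
  unfold powerDefect
  rw [ArithmeticFunction.vonMangoldt_apply_pow (by omega),
    ArithmeticFunction.vonMangoldt_apply_prime p.prop]
  push_cast
  rw [Real.log_pow]
  push_cast
  ring

/-- The bound separates p from k, which makes the double series a product. For k ≥ 1, p² and log² p
≤ 16 p^{1/2} leave 16 p^{-3/2}, and the remaining p^{-(k-1)} is at most 2 · 2^{-k}. -/
lemma powerDefect_prime_pow_le (p : Nat.Primes) (k : ℕ) :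
    powerDefect ((p : ℕ) ^ (k + 1)) ≤ (32 * (p : ℝ) ^ (-(3 / 2) : ℝ)) * (k * (1 / 2 : ℝ) ^ k) := by
  rw [powerDefect_prime_pow]
  rcases k with - | k
  · simp
  have hp2 : (2 : ℝ) ≤ p := by exact_mod_cast p.prop.two_le
  have hp0 : (0 : ℝ) < p := by linarith
  have hlog : Real.log p ≤ 4 * (p : ℝ) ^ (1 / 4 : ℝ) := by
    have := Real.log_le_rpow_div hp0.le (show (0 : ℝ) < 1 / 4 by norm_num)
    linarith
  have hlog0 : 0 ≤ Real.log p := Real.log_nonneg (by linarith)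
  have hsq : Real.log p ^ 2 ≤ 16 * (p : ℝ) ^ (1 / 2 : ℝ) := by
    calc Real.log p ^ 2 ≤ (4 * (p : ℝ) ^ (1 / 4 : ℝ)) ^ 2 := by gcongr
      _ = 16 * (p : ℝ) ^ (1 / 2 : ℝ) := by
        rw [mul_pow, ← Real.rpow_mul_natCast hp0.le]
        norm_num
  have hpk : (1 : ℝ) / (p : ℝ) ^ k ≤ (1 / 2) ^ k := by
    rw [one_div_pow]
    gcongr
  have hdec : (p : ℝ) ^ (-(3 / 2) : ℝ) = (p : ℝ) ^ (1 / 2 : ℝ) / (p : ℝ) ^ 2 := by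
    rw [← Real.rpow_natCast, ← Real.rpow_sub hp0]
    norm_num
  calc ((k + 1 : ℕ) : ℝ) * Real.log p ^ 2 / (p : ℝ) ^ (k + 1 + 1)
      = ((k + 1 : ℕ) : ℝ) * (Real.log p ^ 2 / (p : ℝ) ^ 2) * (1 / (p : ℝ) ^ k) := by
        field_simp
        ring
    _ ≤ ((k + 1 : ℕ) : ℝ) * ((16 * (p : ℝ) ^ (1 / 2 : ℝ)) / (p : ℝ) ^ 2) * (1 / 2) ^ k := by
        gcongr
    _ = _ := by
        rw [hdec]
        ring

/-- Prime powers correspond bijectively to pairs (p, k), where the defect is dominated by a product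
of two convergent series. Hence Λ² may be replaced by Λ log in weighted sums at bounded cost. -/
lemma summable_powerDefect : Summable powerDefect := by
  have h0 : ∀ m, ¬ IsPrimePow m → powerDefect m = 0 := fun m hm => by
    simp [powerDefect, ArithmeticFunction.vonMangoldt_eq_zero_iff.mpr hm]
  have hpairs : Summable fun pk : Nat.Primes × ℕ => powerDefect ((pk.1 : ℕ) ^ (pk.2 + 1)) := by
    have h1 : Summable fun p : Nat.Primes => 32 * (p : ℝ) ^ (-(3 / 2) : ℝ) :=
      (Nat.Primes.summable_rpow.mpr (by norm_num)).mul_left 32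
    have h2 : Summable fun k : ℕ => (k : ℝ) * (1 / 2 : ℝ) ^ k := by
      simpa using summable_pow_mul_geometric_of_norm_lt_one (R := ℝ) 1 (r := 1 / 2) (by norm_num)
    exact (h1.mul_of_nonneg h2 (fun p => by positivity) (fun k => by positivity)).of_nonneg_of_le
      (fun _ => powerDefect_nonneg _) (fun pk => powerDefect_prime_pow_le pk.1 pk.2)
  refine (summable_subtype_iff_indicator (s := {n | IsPrimePow n}).mp ?_).congr
      fun n => Set.indicator_apply_eq_self.mpr fun hn => h0 n hn
  refine (Nat.Primes.prodNatEquiv.summable_iff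
    (f := powerDefect ∘ Subtype.val (p := fun n => n ∈ {n | IsPrimePow n}))).mp ?_
  refine hpairs.congr fun pk => ?_
  rfl

/-! ### Partial summation against monotone weights -/

lemma intervalIntegrable_mul_inv_of_monotoneOn {φ : ℝ → ℝ} {a b : ℝ} (ha : 0 < a) (hab : a ≤ b)
    (hφ : MonotoneOn φ (Set.Icc a b)) :
    IntervalIntegrable (fun y => φ y * y⁻¹) volume a b := by
  rw [← Set.uIcc_of_le hab] at hφ
  refine hφ.intervalIntegrable.mul_continuousOn (continuousOn_id.inv₀ fun y hy => ?_)
  rw [Set.uIcc_of_le hab] at hy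
  exact (ha.trans_le hy.1).ne'

/-- On the unit interval φ lies between its end values, and the total mass log(b+1) - log b of dy/y
is at most 1. -/
lemma abs_log_mul_sub_integral_le {φ : ℝ → ℝ} {b : ℝ} (hb : 1 ≤ b)
    (hφ : MonotoneOn φ (Set.Icc b (b + 1))) :
    |(Real.log (b + 1) - Real.log b) * φ (b + 1) - ∫ y in b..(b + 1), φ y * y⁻¹| ≤
      φ (b + 1) - φ b := by
  have hb0 : 0 < b := by linarith
  have hI : ∫ y in b..(b + 1), y⁻¹ = Real.log (b + 1) - Real.log b := by
    rw [integral_inv_of_pos hb0 (by linarith), Real.log_div (by linarith) hb0.ne']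
  have hint : IntervalIntegrable (fun y : ℝ => y⁻¹) volume b (b + 1) := by
    simpa using intervalIntegrable_mul_inv_of_monotoneOn (φ := fun _ => 1) hb0
      (by linarith : b ≤ b + 1) monotoneOn_const
  have h1 : ∫ y in b..(b + 1), φ y * y⁻¹ ≤ ∫ y in b..(b + 1), φ (b + 1) * y⁻¹ := by
    refine intervalIntegral.integral_mono_on (by linarith)
      (intervalIntegrable_mul_inv_of_monotoneOn hb0 (by linarith) hφ) (hint.const_mul _)
      fun y hy => ?_
    have hy0 : 0 < y := hb0.trans_le hy.1
    gcongr
    exact hφ hy (Set.right_mem_Icc.mpr (by linarith)) hy.2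
  have h2 : ∫ y in b..(b + 1), φ b * y⁻¹ ≤ ∫ y in b..(b + 1), φ y * y⁻¹ := by
    refine intervalIntegral.integral_mono_on (by linarith) (hint.const_mul _)
      (intervalIntegrable_mul_inv_of_monotoneOn hb0 (by linarith) hφ) fun y hy => ?_
    have hy0 : 0 < y := hb0.trans_le hy.1
    gcongr
    exact hφ (Set.left_mem_Icc.mpr (by linarith)) hy hy.1
  rw [intervalIntegral.integral_const_mul, hI] at h1 h2
  have hl0 : 0 ≤ Real.log (b + 1) - Real.log b :=
    sub_nonneg.mpr (Real.log_le_log hb0 (by linarith))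
  have hl1 : Real.log (b + 1) - Real.log b ≤ 1 := by
    rw [← Real.log_div (by linarith) hb0.ne']
    refine (Real.log_le_sub_one_of_pos (by positivity)).trans ?_
    rw [add_div, div_self hb0.ne', add_sub_cancel_left, div_le_one hb0]
    exact hb
  have hφb : φ b ≤ φ (b + 1) :=
    hφ (Set.left_mem_Icc.mpr (by linarith)) (Set.right_mem_Icc.mpr (by linarith)) (by linarith)
  rw [abs_le]
  constructor <;> nlinarith

/-- Partial summation of `Λ(m)/m` against a monotone weight. -/
lemma abs_sum_mul_sub_integral_sub_le {C : ℝ}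
    (hC : ∀ N : ℕ, 1 ≤ N → |∑ m ∈ Finset.Ioc 0 N, vonMangoldt m / m - Real.log N| ≤ C)
    {φ : ℝ → ℝ} {a b : ℕ} (ha : 1 ≤ a) (hab : a ≤ b) (hφ : MonotoneOn φ (Set.Icc a b)) :
    |∑ m ∈ Finset.Ioc a b, vonMangoldt m / m * φ m - (∫ y in (a : ℝ)..b, φ y * y⁻¹) -
      (∑ m ∈ Finset.Ioc 0 b, vonMangoldt m / m - Real.log b) * φ b +
      (∑ m ∈ Finset.Ioc 0 a, vonMangoldt m / m - Real.log a) * φ a| ≤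
      (C + 1) * (φ b - φ a) := by
  -- With R the Mertens remainder, passing from b to b + 1 adds R(b)(φ(b) - φ(b+1)) and the
  -- comparison error on one unit interval. They cost C and 1 times the increment of φ, and the
  -- increments telescope.
  induction b, hab using Nat.le_induction with
  | base => simp
  | succ b hab ih =>
    have hb1 : (1 : ℝ) ≤ b := by exact_mod_cast ha.trans hab
    have ha0 : (0 : ℝ) < a := by exact_mod_cast ha
    have habR : (a : ℝ) ≤ b := by exact_mod_cast hab
    push_cast at hφ
    have hφ1 : MonotoneOn φ (Set.Icc (a : ℝ) b) :=
      hφ.mono (Set.Icc_subset_Icc le_rfl (by linarith))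
    have hφ2 : MonotoneOn φ (Set.Icc (b : ℝ) (b + 1)) :=
      hφ.mono (Set.Icc_subset_Icc habR le_rfl)
    have h1 := ih hφ1
    have h2 := abs_log_mul_sub_integral_le hb1 hφ2
    have h3 := hC b (ha.trans hab)
    have hmono : φ b ≤ φ (b + 1) :=
      hφ2 (Set.left_mem_Icc.mpr (by linarith)) (Set.right_mem_Icc.mpr (by linarith)) (by linarith)
    have hsplit := intervalIntegral.integral_add_adjacent_intervals
      (intervalIntegrable_mul_inv_of_monotoneOn ha0 habR hφ1)
      (intervalIntegrable_mul_inv_of_monotoneOn (by linarith) (by linarith) hφ2)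
    rw [Finset.sum_Ioc_succ_top hab, Finset.sum_Ioc_succ_top (Nat.zero_le b)]
    push_cast
    rw [← hsplit]
    set R := ∑ m ∈ Finset.Ioc 0 b, vonMangoldt m / m
    have h4 : |(R - Real.log b) * (φ b - φ (b + 1))| ≤ C * (φ (b + 1) - φ b) := by
      rw [abs_mul, abs_sub_comm (φ b), abs_of_nonneg (sub_nonneg.mpr hmono)]
      exact mul_le_mul_of_nonneg_right h3 (sub_nonneg.mpr hmono)
    rw [abs_le] at h1 h2 h4 ⊢
    constructor <;> nlinarith

lemma abs_sum_mul_sub_integral_le_of_monotoneOn {C : ℝ} (hC0 : 0 ≤ C)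
    (hC : ∀ N : ℕ, 1 ≤ N → |∑ m ∈ Finset.Ioc 0 N, vonMangoldt m / m - Real.log N| ≤ C)
    {φ : ℝ → ℝ} {a b : ℕ} (ha : 1 ≤ a) (hab : a ≤ b) (hφ : MonotoneOn φ (Set.Icc a b))
    (hφ0 : 0 ≤ φ a) :
    |∑ m ∈ Finset.Ioc a b, vonMangoldt m / m * φ m - ∫ y in (a : ℝ)..b, φ y * y⁻¹| ≤
      (3 * C + 1) * φ b := by
  have h := abs_sum_mul_sub_integral_sub_le hC ha hab hφ
  have habR : (a : ℝ) ≤ b := by exact_mod_cast hab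
  have hmono : φ a ≤ φ b :=
    hφ (Set.left_mem_Icc.mpr habR) (Set.right_mem_Icc.mpr habR) habR
  have h1 : |(∑ m ∈ Finset.Ioc 0 b, vonMangoldt m / m - Real.log b) * φ b| ≤ C * φ b := by
    rw [abs_mul, abs_of_nonneg (hφ0.trans hmono)]
    exact mul_le_mul_of_nonneg_right (hC b (ha.trans hab)) (hφ0.trans hmono)
  have h2 : |(∑ m ∈ Finset.Ioc 0 a, vonMangoldt m / m - Real.log a) * φ a| ≤ C * φ a := by
    rw [abs_mul, abs_of_nonneg hφ0]
    exact mul_le_mul_of_nonneg_right (hC a ha) hφ0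
  rw [abs_le] at h h1 h2 ⊢
  constructor <;> nlinarith

lemma abs_sum_mul_sub_integral_le_of_antitoneOn {C : ℝ} (hC0 : 0 ≤ C)
    (hC : ∀ N : ℕ, 1 ≤ N → |∑ m ∈ Finset.Ioc 0 N, vonMangoldt m / m - Real.log N| ≤ C)
    {φ : ℝ → ℝ} {a b : ℕ} (ha : 1 ≤ a) (hab : a ≤ b) (hφ : AntitoneOn φ (Set.Icc a b))
    (hφ0 : 0 ≤ φ b) :
    |∑ m ∈ Finset.Ioc a b, vonMangoldt m / m * φ m - ∫ y in (a : ℝ)..b, φ y * y⁻¹| ≤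
      (3 * C + 1) * φ a := by
  have h := abs_sum_mul_sub_integral_sub_le hC ha hab hφ.neg
  simp only [mul_neg, neg_mul, Finset.sum_neg_distrib,
    intervalIntegral.integral_neg] at h
  have habR : (a : ℝ) ≤ b := by exact_mod_cast hab
  have hmono : φ b ≤ φ a :=
    hφ (Set.left_mem_Icc.mpr habR) (Set.right_mem_Icc.mpr habR) habR
  have h1 : |(∑ m ∈ Finset.Ioc 0 b, vonMangoldt m / m - Real.log b) * φ b| ≤ C * φ b := by
    rw [abs_mul, abs_of_nonneg hφ0]
    exact mul_le_mul_of_nonneg_right (hC b (ha.trans hab)) hφ0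
  have h2 : |(∑ m ∈ Finset.Ioc 0 a, vonMangoldt m / m - Real.log a) * φ a| ≤ C * φ a := by
    rw [abs_mul, abs_of_nonneg (hφ0.trans hmono)]
    exact mul_le_mul_of_nonneg_right (hC a ha) (hφ0.trans hmono)
  rw [abs_le] at h h1 h2 ⊢
  constructor <;> nlinarith

/-! ### Asymptotics of the diagonal sum -/

/-- The terms of the series `C_n`. -/
def coeffSq (n m : ℕ) : ℝ := vonMangoldt m ^ 2 / (m * Real.log m ^ (2 * n + 2))

lemma coeffSq_nonneg (n m : ℕ) : 0 ≤ coeffSq n m := by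
  unfold coeffSq
  have := Real.log_natCast_nonneg m
  positivity

lemma log_floor_bounds {x : ℝ} (hx : 4 ≤ x) :
    2 ≤ ⌊x⌋₊ ∧ Real.log x / 2 ≤ Real.log ⌊x⌋₊ ∧ Real.log ⌊x⌋₊ ≤ Real.log x ∧
      Real.log x - Real.log ⌊x⌋₊ ≤ 1 := by
  have h0 : (⌊x⌋₊ : ℝ) ≤ x := Nat.floor_le (by linarith)
  have h1 : x < ⌊x⌋₊ + 1 := Nat.lt_floor_add_one x
  have h2 : x / 2 ≤ ⌊x⌋₊ := by linarith
  have h3 : (0 : ℝ) < ⌊x⌋₊ := by linarith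
  have h4 : Real.log x - Real.log 2 ≤ Real.log ⌊x⌋₊ := by
    rw [← Real.log_div (by linarith) (by norm_num)]
    exact Real.log_le_log (by linarith) h2
  have h5 : 2 * Real.log 2 ≤ Real.log x := by
    have : Real.log (2 ^ 2) ≤ Real.log x := Real.log_le_log (by norm_num) (by linarith)
    rwa [Real.log_pow] at this
  refine ⟨?_, by linarith, Real.log_le_log h3 h0, by linarith [Real.log_two_lt_d9]⟩
  exact Nat.le_floor (by norm_num; linarith)

/-- Substitution α = log y / log x. The change of variables along an injective map needs no
regularity of ψ. -/
lemma integral_comp_log_div_mul_inv (ψ : ℝ → ℝ) {x : ℝ} (hx : 1 < x) :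
    ∫ y in (1 : ℝ)..x, ψ (Real.log y / Real.log x) * y⁻¹ =
      Real.log x * ∫ α in (0 : ℝ)..1, ψ α := by
  have hl : 0 < Real.log x := Real.log_pos hx
  have himg : (fun y : ℝ => Real.log y / Real.log x) '' Set.Ioc 1 x = Set.Ioc 0 1 := by
    ext u
    constructor
    · rintro ⟨y, hy, rfl⟩
      have := Real.log_le_log (by linarith [hy.1]) hy.2
      exact ⟨div_pos (Real.log_pos hy.1) hl, (div_le_one hl).mpr this⟩
    · intro hu
      refine ⟨Real.exp (u * Real.log x), ⟨?_, ?_⟩, ?_⟩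
      · rw [Real.one_lt_exp_iff]
        exact mul_pos hu.1 hl
      · calc Real.exp (u * Real.log x) ≤ Real.exp (Real.log x) := by
              rw [Real.exp_le_exp]
              nlinarith [hu.2]
          _ = x := Real.exp_log (by linarith)
      · simp only [Real.log_exp]
        field_simp
  rw [intervalIntegral.integral_of_le hx.le, intervalIntegral.integral_of_le zero_le_one, ← himg,
    integral_image_eq_integral_abs_deriv_smul (f' := fun y => y⁻¹ / Real.log x) measurableSet_Ioc
      (fun y hy => ((Real.hasDerivAt_log (by linarith [hy.1])).div_const _).hasDerivWithinAt)
      (fun y hy z hz h => ?_), ← integral_const_mul]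
  · refine setIntegral_congr_fun measurableSet_Ioc fun y hy => ?_
    have hy0 : 0 < y := by linarith [hy.1]
    simp only [smul_eq_mul]
    rw [abs_of_pos (by positivity)]
    field_simp
  · rw [div_left_inj' hl.ne'] at h
    exact Real.log_injOn_pos (by simp; linarith [hy.1]) (by simp; linarith [hz.1]) h

/-- Both factors are nonnegative and increase. At u = 0, where `g` is a division by zero, the factor
u makes the value harmless, so the closed interval is allowed. -/
lemma monotoneOn_mul_g_sq (n : ℕ) : MonotoneOn (fun u => u * g n u ^ 2) (Set.Icc 0 1) := by
  intro u hu v hv huv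
  simp only
  rcases hu.1.eq_or_lt with h0 | h0
  · rw [← h0, zero_mul]
    exact mul_nonneg hv.1 (sq_nonneg _)
  · have h1 := g_nonneg n h0 hu.2
    have h2 := g_mono n h0 huv hv.2
    have h3 := hv.1
    gcongr

lemma mul_g_sq_le_one (n : ℕ) {u : ℝ} (hu : u ∈ Set.Icc (0 : ℝ) 1) : u * g n u ^ 2 ≤ 1 := by
  refine (monotoneOn_mul_g_sq n hu (Set.right_mem_Icc.mpr zero_le_one) hu.2).trans ?_
  simp only [one_mul]
  exact pow_le_one₀ (g_nonneg n one_pos le_rfl) (g_le_one n one_pos le_rfl)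

/-- The contribution of the smoothing weight to the main term. -/
lemma exists_abs_sum_g_sq_sub_le (n : ℕ) :
    ∃ K : ℝ, 0 ≤ K ∧ ∀ x : ℝ, 4 ≤ x →
      |∑ m ∈ Finset.Ioc 1 ⌊x⌋₊, vonMangoldt m ^ 2 / m * g n (Real.log m / Real.log x) ^ 2 -
        Real.log x ^ 2 * A n| ≤ K * Real.log x := by
  obtain ⟨C, hC0, hC⟩ := exists_abs_sum_vonMangoldt_div_sub_log_le
  -- Partial summation costs 3C + 1, the stretch from ⌊x⌋ to x costs at most 1, and the rest pays
  -- for proper prime powers, using log x ≥ 1.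
  refine ⟨3 * C + 2 + ∑' m, powerDefect m, by
    have : 0 ≤ ∑' m, powerDefect m := tsum_nonneg powerDefect_nonneg
    positivity, fun x hx => ?_⟩
  obtain ⟨hN2, -, hNle, hNx⟩ := log_floor_bounds hx
  set N := ⌊x⌋₊
  have hN1 : 1 ≤ N := by omega
  have hN1R : (1 : ℝ) ≤ N := by exact_mod_cast hN1
  have hNxR : (N : ℝ) ≤ x := Nat.floor_le (by linarith)
  have hl1 : 1 ≤ Real.log x := by
    have := Real.log_le_log (by norm_num) hx
    have h4 : Real.log 4 = 2 * Real.log 2 := by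
      rw [← Real.log_rpow (by norm_num)]; norm_num
    linarith [Real.log_two_gt_d9]
  have hl : 0 < Real.log x := by linarith
  set φ : ℝ → ℝ := fun y => (fun u => u * g n u ^ 2) (Real.log y / Real.log x) with hφdef
  have hmem : ∀ y ∈ Set.Icc 1 x, Real.log y / Real.log x ∈ Set.Icc (0 : ℝ) 1 := fun y hy =>
    ⟨div_nonneg (Real.log_nonneg hy.1) hl.le,
      (div_le_one hl).mpr (Real.log_le_log (by linarith [hy.1]) hy.2)⟩
  have hφ : MonotoneOn φ (Set.Icc 1 x) := fun y hy z hz hyz =>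
    monotoneOn_mul_g_sq n (hmem y hy) (hmem z hz)
      (by gcongr; linarith [hy.1])
  have hφ1 : ∀ y ∈ Set.Icc 1 x, φ y ≤ 1 := fun y hy => mul_g_sq_le_one n (hmem y hy)
  have hφ0 : ∀ y ∈ Set.Icc 1 x, 0 ≤ φ y := fun y hy =>
    mul_nonneg (hmem y hy).1 (sq_nonneg _)
  have hsum := abs_sum_mul_sub_integral_le_of_monotoneOn (a := 1) (b := N) hC0 hC le_rfl hN1
    (φ := φ) (hφ.mono (by
      push_cast
      exact Set.Icc_subset_Icc le_rfl hNxR)) (hφ0 _ (by simp; linarith))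
  rw [Nat.cast_one] at hsum
  have hsum' := hsum.trans (mul_le_of_le_one_right (by positivity) (hφ1 N ⟨hN1R, hNxR⟩))
  have hint := intervalIntegral.integral_add_adjacent_intervals
    (intervalIntegrable_mul_inv_of_monotoneOn (φ := φ) one_pos hN1R
      (hφ.mono (Set.Icc_subset_Icc le_rfl hNxR)))
    (intervalIntegrable_mul_inv_of_monotoneOn (φ := φ) (by linarith) hNxR
      (hφ.mono (Set.Icc_subset_Icc hN1R le_rfl)))
  have hwhole : ∫ y in (1 : ℝ)..x, φ y * y⁻¹ = Real.log x * A n :=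
    integral_comp_log_div_mul_inv (fun u => u * g n u ^ 2) (by linarith)
  have htail0 : 0 ≤ ∫ y in (N : ℝ)..x, φ y * y⁻¹ :=
    intervalIntegral.integral_nonneg hNxR fun y hy =>
      mul_nonneg (hφ0 y ⟨hN1R.trans hy.1, hy.2⟩) (by
        have : 0 < y := by linarith [hy.1]
        positivity)
  have htail1 : ∫ y in (N : ℝ)..x, φ y * y⁻¹ ≤ 1 := by
    refine le_trans ?_ hNx
    rw [← Real.log_div (by linarith) (by linarith), ← integral_inv_of_pos (by linarith)
      (by linarith)]
    refine intervalIntegral.integral_mono_on hNxR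
      (intervalIntegrable_mul_inv_of_monotoneOn (φ := φ) (by linarith) hNxR
        (hφ.mono (Set.Icc_subset_Icc hN1R le_rfl))) ?_ fun y hy => ?_
    · simpa using intervalIntegrable_mul_inv_of_monotoneOn (φ := fun _ => 1) (by linarith)
        hNxR monotoneOn_const
    · have : 0 < y := by linarith [hy.1]
      exact mul_le_of_le_one_left (by positivity) (hφ1 y ⟨hN1R.trans hy.1, hy.2⟩)
  -- One logarithm is taken out: Λ² = Λ log m - Λ(log m - Λ) with log m = u log x. This creates the
  -- weight u g(u)² whose integral is A_n.
  have hdecomp : ∑ m ∈ Finset.Ioc 1 N, vonMangoldt m ^ 2 / m *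
        g n (Real.log m / Real.log x) ^ 2 =
      Real.log x * ∑ m ∈ Finset.Ioc 1 N, vonMangoldt m / m * φ m -
        ∑ m ∈ Finset.Ioc 1 N, powerDefect m * g n (Real.log m / Real.log x) ^ 2 := by
    rw [Finset.mul_sum, ← Finset.sum_sub_distrib]
    refine Finset.sum_congr rfl fun m hm => ?_
    simp only [hφdef, powerDefect]
    field_simp
    ring
  have hdef0 : 0 ≤ ∑ m ∈ Finset.Ioc 1 N, powerDefect m * g n (Real.log m / Real.log x) ^ 2 :=
    Finset.sum_nonneg fun m _ => mul_nonneg (powerDefect_nonneg m) (sq_nonneg _)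
  have hdef1 : ∑ m ∈ Finset.Ioc 1 N, powerDefect m * g n (Real.log m / Real.log x) ^ 2 ≤
      ∑' m, powerDefect m := by
    refine le_trans (Finset.sum_le_sum fun m hm => ?_)
      (summable_powerDefect.sum_le_tsum (Finset.Ioc 1 N) fun m _ => powerDefect_nonneg m)
    rw [Finset.mem_Ioc] at hm
    have hm1 : (1 : ℝ) < m := by exact_mod_cast hm.1
    have hmx : (m : ℝ) ≤ x := le_trans (by exact_mod_cast hm.2) hNxR
    have hu := hmem m ⟨hm1.le, hmx⟩
    have hu0 : 0 < Real.log m / Real.log x := div_pos (Real.log_pos hm1) hl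
    exact mul_le_of_le_one_right (powerDefect_nonneg m)
      (pow_le_one₀ (g_nonneg n hu0 hu.2) (g_le_one n hu0 hu.2))
  rw [hdecomp]
  set E := ∑ m ∈ Finset.Ioc 1 N, vonMangoldt m / m * φ m
  have hE : |E - Real.log x * A n| ≤ 3 * C + 2 := by
    rw [← hwhole, ← hint]
    rw [abs_le] at hsum' ⊢
    constructor <;> linarith
  have hD : 0 ≤ ∑' m, powerDefect m := tsum_nonneg powerDefect_nonneg
  rw [abs_le] at hE ⊢
  constructor <;> nlinarith

lemma integral_inv_mul_log_pow {n : ℕ} (hn : 1 ≤ n) {a b : ℝ} (ha : 1 < a) (hab : a ≤ b) :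
    ∫ y in a..b, (Real.log y ^ (2 * n + 1))⁻¹ * y⁻¹ =
      1 / (2 * n * Real.log a ^ (2 * n)) - 1 / (2 * n * Real.log b ^ (2 * n)) := by
  have hpos : ∀ y ∈ Set.uIcc a b, 1 < y := fun y hy => by
    rw [Set.uIcc_of_le hab] at hy
    exact ha.trans_le hy.1
  have hderiv : ∀ y ∈ Set.uIcc a b, HasDerivAt (fun y => -(1 / (2 * n * Real.log y ^ (2 * n))))
      ((Real.log y ^ (2 * n + 1))⁻¹ * y⁻¹) y := fun y hy => by
    have hy1 := hpos y hy
    have hl := Real.log_pos hy1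
    have hn0 : (n : ℝ) ≠ 0 := by positivity
    have h := ((((Real.hasDerivAt_log (by linarith : y ≠ 0)).fun_pow (2 * n)).const_mul
      (2 * n : ℝ)).fun_inv (by positivity)).fun_neg
    simp only [one_div]
    refine h.congr_deriv ?_
    have h2 : Real.log y ^ (2 * n + 1) = Real.log y ^ (2 * n) * Real.log y := pow_succ _ _
    have h3 : Real.log y ^ (2 * n) = Real.log y ^ (2 * n - 1) * Real.log y := by
      rw [← pow_succ]; congr 1; omega
    rw [h2, h3]
    push_cast
    field_simp
  rw [intervalIntegral.integral_eq_sub_of_hasDerivAt hderiv]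
  · ring
  · refine ContinuousOn.intervalIntegrable fun y hy => ?_
    have hy1 := hpos y hy
    have hl := Real.log_pos hy1
    have h0 : y ≠ 0 := by linarith
    refine ContinuousAt.continuousWithinAt ?_
    fun_prop (disch := first | assumption | positivity)

lemma coeffSq_eq (n : ℕ) {m : ℕ} (hm : 2 ≤ m) :
    coeffSq n m = vonMangoldt m / m * (Real.log m ^ (2 * n + 1))⁻¹ -
      powerDefect m / Real.log m ^ (2 * n + 2) := by
  have hl : 0 < Real.log m := Real.log_pos (by exact_mod_cast hm)
  unfold coeffSq powerDefect
  have h2 : Real.log m ^ (2 * n + 2) = Real.log m ^ (2 * n + 1) * Real.log m := pow_succ _ _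
  rw [h2]
  field_simp
  ring

/-- Up to the prime power defect the terms are Λ(m)/m times the decreasing weight (log m)^{-2n-1},
so the sum is compared with ∫ dy/(y (log y)^{2n+1}). The defect is summable and divided by at least
log 2 · (log N)^{2n+1}. -/
lemma exists_abs_sum_coeffSq_sub_le {n : ℕ} (hn : 1 ≤ n) :
    ∃ K : ℝ, 0 ≤ K ∧ ∀ N b : ℕ, 2 ≤ N → N ≤ b →
      |∑ m ∈ Finset.Ioc N b, coeffSq n m -
        (1 / (2 * n * Real.log N ^ (2 * n)) - 1 / (2 * n * Real.log b ^ (2 * n)))| ≤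
        K / Real.log N ^ (2 * n + 1) := by
  obtain ⟨C, hC0, hC⟩ := exists_abs_sum_vonMangoldt_div_sub_log_le
  have hD : 0 ≤ ∑' m, powerDefect m := tsum_nonneg powerDefect_nonneg
  have hl2 : 0 < Real.log 2 := Real.log_pos (by norm_num)
  refine ⟨3 * C + 1 + (∑' m, powerDefect m) / Real.log 2, by positivity, fun N b hN hNb => ?_⟩
  have hNR : (2 : ℝ) ≤ N := by exact_mod_cast hN
  have hNbR : (N : ℝ) ≤ b := by exact_mod_cast hNb
  have hlN : Real.log 2 ≤ Real.log N := Real.log_le_log (by norm_num) hNR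
  have hlN0 : 0 < Real.log N := by linarith
  set φ : ℝ → ℝ := fun y => (Real.log y ^ (2 * n + 1))⁻¹ with hφdef
  have hφ : AntitoneOn φ (Set.Icc N b) := fun y hy z hz hyz => by
    have h1 : 0 < Real.log y := Real.log_pos (by linarith [hy.1])
    have h2 : Real.log y ≤ Real.log z := Real.log_le_log (by linarith [hy.1]) hyz
    simp only [hφdef]
    gcongr
  have hsum := abs_sum_mul_sub_integral_le_of_antitoneOn hC0 hC (by omega) hNb hφ (by
    have : 0 ≤ Real.log b := Real.log_nonneg (by linarith)
    simp only [hφdef]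
    positivity)
  simp only [hφdef] at hsum
  rw [integral_inv_mul_log_pow hn (by linarith) hNbR] at hsum
  have hdecomp : ∑ m ∈ Finset.Ioc N b, coeffSq n m =
      ∑ m ∈ Finset.Ioc N b, vonMangoldt m / m * (Real.log m ^ (2 * n + 1))⁻¹ -
        ∑ m ∈ Finset.Ioc N b, powerDefect m / Real.log m ^ (2 * n + 2) := by
    rw [← Finset.sum_sub_distrib]
    refine Finset.sum_congr rfl fun m hm => coeffSq_eq n ?_
    rw [Finset.mem_Ioc] at hm
    omega
  have hdef0 : 0 ≤ ∑ m ∈ Finset.Ioc N b, powerDefect m / Real.log m ^ (2 * n + 2) :=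
    Finset.sum_nonneg fun m _ => div_nonneg (powerDefect_nonneg m)
      (pow_nonneg (Real.log_natCast_nonneg m) _)
  have hdef1 : ∑ m ∈ Finset.Ioc N b, powerDefect m / Real.log m ^ (2 * n + 2) ≤
      (∑' m, powerDefect m) / Real.log 2 / Real.log N ^ (2 * n + 1) := by
    calc ∑ m ∈ Finset.Ioc N b, powerDefect m / Real.log m ^ (2 * n + 2)
        ≤ ∑ m ∈ Finset.Ioc N b, powerDefect m / (Real.log 2 * Real.log N ^ (2 * n + 1)) := by
          refine Finset.sum_le_sum fun m hm => ?_
          rw [Finset.mem_Ioc] at hm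
          have hmN : (N : ℝ) ≤ m := by exact_mod_cast hm.1.le
          have h1 : Real.log N ≤ Real.log m := Real.log_le_log (by linarith) hmN
          have h0 := powerDefect_nonneg m
          have h3 : Real.log 2 * Real.log N ^ (2 * n + 1) ≤ Real.log m ^ (2 * n + 2) := by
            rw [pow_succ (Real.log m) (2 * n + 1), mul_comm]
            gcongr
            linarith
          gcongr
      _ = (∑ m ∈ Finset.Ioc N b, powerDefect m) / (Real.log 2 * Real.log N ^ (2 * n + 1)) := by
          rw [Finset.sum_div]
      _ ≤ (∑' m, powerDefect m) / (Real.log 2 * Real.log N ^ (2 * n + 1)) := by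
          gcongr
          exact summable_powerDefect.sum_le_tsum _ fun m _ => powerDefect_nonneg m
      _ = _ := by rw [div_div]
  rw [hdecomp, add_div, div_eq_mul_inv (3 * C + 1)]
  rw [abs_le] at hsum ⊢
  constructor <;> linarith

lemma summable_coeffSq {n : ℕ} (hn : 1 ≤ n) : Summable (fun k => coeffSq n (k + 2)) := by
  obtain ⟨K, hK0, hK⟩ := exists_abs_sum_coeffSq_sub_le hn
  have h := fun b => hK 2 (b + 2) le_rfl (by omega)
  have hl2 : 0 < Real.log 2 := Real.log_pos (by norm_num)
  refine summable_of_sum_range_le (c := coeffSq n 2 + (K / Real.log 2 ^ (2 * n + 1) +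
    1 / (2 * n * Real.log 2 ^ (2 * n)))) (fun k => coeffSq_nonneg n _) fun b => ?_
  have h1 : ∑ k ∈ Finset.range b, coeffSq n (k + 2) ≤
      ∑ k ∈ Finset.range (b + 1), coeffSq n (k + 2) :=
    Finset.sum_le_sum_of_subset_of_nonneg (by simp) fun k _ _ => coeffSq_nonneg n _
  have h2 : ∑ k ∈ Finset.range (b + 1), coeffSq n (k + 2) =
      coeffSq n 2 + ∑ m ∈ Finset.Ioc 2 (b + 2), coeffSq n m := by
    rw [Finset.sum_range_succ', add_comm, zero_add]
    congr 1
    rw [← Finset.Ico_add_one_add_one_eq_Ioc, Finset.sum_Ico_eq_sum_range]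
    refine Finset.sum_congr (by congr 1) fun k _ => ?_
    congr 1
    omega
  have h3 := (abs_le.mp (h b)).2
  have h4 : (0 : ℝ) ≤ 1 / (2 * n * Real.log ((b + 2 : ℕ) : ℝ) ^ (2 * n)) := by
    have := Real.log_natCast_nonneg (b + 2)
    positivity
  push_cast at h3 h4
  linarith

lemma tendsto_sum_coeffSq {n : ℕ} (hn : 1 ≤ n) :
    Tendsto (fun b : ℕ => ∑ m ∈ Finset.Ioc 1 b, coeffSq n m) atTop (𝓝 (C n)) := by
  have h := (summable_coeffSq hn).hasSum.tendsto_sum_nat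
  have hC : C n = ∑' k, coeffSq n (k + 2) := by
    unfold C coeffSq
    rfl
  rw [hC, ← tendsto_add_atTop_iff_nat 1]
  refine h.congr fun b => ?_
  rw [← Finset.Ico_add_one_add_one_eq_Ioc, Finset.sum_Ico_eq_sum_range]
  refine Finset.sum_congr (by congr 1) fun k _ => ?_
  congr 1
  omega

/-- The limit b → ∞ of the preceding estimate; it evaluates the tail of C_n and is the source of the
term 1/(2n). -/
lemma exists_abs_C_sub_sum_sub_le {n : ℕ} (hn : 1 ≤ n) :
    ∃ K : ℝ, 0 ≤ K ∧ ∀ N : ℕ, 2 ≤ N →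
      |C n - ∑ m ∈ Finset.Ioc 1 N, coeffSq n m - 1 / (2 * n * Real.log N ^ (2 * n))| ≤
        K / Real.log N ^ (2 * n + 1) := by
  obtain ⟨K, hK0, hK⟩ := exists_abs_sum_coeffSq_sub_le hn
  refine ⟨K, hK0, fun N hN => ?_⟩
  have hlim0 : Tendsto (fun b : ℕ => 1 / (2 * n * Real.log b ^ (2 * n))) atTop (𝓝 0) := by
    have h1 : Tendsto (fun b : ℕ => Real.log b ^ (2 * n)) atTop atTop :=
      (tendsto_pow_atTop (by omega)).comp (Real.tendsto_log_atTop.comp tendsto_natCast_atTop_atTop)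
    exact tendsto_const_nhds.div_atTop (h1.const_mul_atTop (by positivity))
  have hlim := (((tendsto_sum_coeffSq hn).sub_const (∑ m ∈ Finset.Ioc 1 N, coeffSq n m)).sub
    ((tendsto_const_nhds (x := 1 / (2 * n * Real.log N ^ (2 * n)))).sub hlim0)).abs
  rw [sub_zero] at hlim
  refine le_of_tendsto hlim ?_
  filter_upwards [eventually_ge_atTop N] with b hb
  have h := hK N b hN hb
  rwa [← Finset.sum_Ioc_consecutive _ (by omega : 1 ≤ N) hb, add_sub_cancel_left]

/-- Bernoulli's inequality for (a/b)^k. It serves to replace log ⌊x⌋ by log x. -/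
lemma inv_pow_sub_inv_pow_le {a b : ℝ} (ha : 0 < a) (hab : a ≤ b) (k : ℕ) :
    1 / a ^ k - 1 / b ^ k ≤ k * (b - a) / a ^ (k + 1) := by
  have hb : 0 < b := ha.trans_le hab
  have h1 : 1 + (k : ℝ) * (a / b - 1) ≤ (1 + (a / b - 1)) ^ k :=
    one_add_mul_le_pow (by have := div_pos ha hb; linarith) k
  rw [add_sub_cancel, div_pow] at h1
  have h2 : 1 / a ^ k - 1 / b ^ k = (1 / a ^ k) * (1 - a ^ k / b ^ k) := by field_simp
  rw [h2]
  have h3 : 1 - a ^ k / b ^ k ≤ k * ((b - a) / a) := by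
    have h4 : (b - a) / b ≤ (b - a) / a := by
      have := sub_nonneg.mpr hab
      gcongr
    have h5 : a / b - 1 = -((b - a) / b) := by field_simp; ring
    have h6 : (0 : ℝ) ≤ k := by positivity
    rw [h5] at h1
    nlinarith
  calc (1 / a ^ k) * (1 - a ^ k / b ^ k) ≤ (1 / a ^ k) * (k * ((b - a) / a)) := by gcongr
    _ = _ := by rw [pow_succ]; field_simp

/-- The asymptotics of the diagonal contribution. -/
theorem exists_abs_sum_weighted_sub_le {n : ℕ} (hn : 1 ≤ n) :
    ∃ K : ℝ, 0 ≤ K ∧ ∀ x : ℝ, 4 ≤ x →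
      |∑ m ∈ Finset.Icc 2 ⌊x⌋₊, coeffSq n m *
          (2 * f n (Real.log m / Real.log x) - f n (Real.log m / Real.log x) ^ 2) -
        (C n - (A n + 1 / (2 * n)) / Real.log x ^ (2 * n))| ≤ K / Real.log x ^ (2 * n + 1) := by
  obtain ⟨K₁, hK₁0, hK₁⟩ := exists_abs_sum_g_sq_sub_le n
  obtain ⟨K₂, hK₂0, hK₂⟩ := exists_abs_C_sub_sum_sub_le hn
  -- K₁ comes from the sum with g², K₂ from the tail of C_n, and 1 from replacing log ⌊x⌋ by log x.
  -- The power of 2 reflects log ⌊x⌋ ≥ (log x)/2.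
  refine ⟨K₁ + (K₂ + 1) * 2 ^ (2 * n + 1), by positivity, fun x hx => ?_⟩
  obtain ⟨hN2, hNhalf, hNle, hNx⟩ := log_floor_bounds hx
  have h1 := hK₁ x hx
  have h2 := hK₂ ⌊x⌋₊ hN2
  have hNxR : (⌊x⌋₊ : ℝ) ≤ x := Nat.floor_le (by linarith)
  set N := ⌊x⌋₊
  have hl : 0 < Real.log x := Real.log_pos (by linarith)
  set ℓ := Real.log x
  have hset : Finset.Icc 2 N = Finset.Ioc 1 N := by
    ext; simp [Finset.mem_Icc, Finset.mem_Ioc]; omega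
  -- Here 2f - f² = 1 - (1 - f)² = 1 - u^{2n+2} g², and u^{2n+2} cancels the power of log m in
  -- `coeffSq`.
  have hdecomp : ∑ m ∈ Finset.Icc 2 N, coeffSq n m *
      (2 * f n (Real.log m / ℓ) - f n (Real.log m / ℓ) ^ 2) =
      ∑ m ∈ Finset.Ioc 1 N, coeffSq n m -
        (∑ m ∈ Finset.Ioc 1 N, vonMangoldt m ^ 2 / m * g n (Real.log m / ℓ) ^ 2) /
          ℓ ^ (2 * n + 2) := by
    rw [hset, Finset.sum_div, ← Finset.sum_sub_distrib]
    refine Finset.sum_congr rfl fun m hm => ?_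
    rw [Finset.mem_Ioc] at hm
    have hlm : 0 < Real.log m := Real.log_pos (by exact_mod_cast hm.1)
    have hu := one_sub_f_eq n (div_pos hlm hl)
    have hm0 : (m : ℝ) ≠ 0 := by
      have : 0 < m := by omega
      positivity
    have : 2 * f n (Real.log m / ℓ) - f n (Real.log m / ℓ) ^ 2 =
        1 - (1 - f n (Real.log m / ℓ)) ^ 2 := by ring
    rw [this, hu, coeffSq, mul_pow, div_pow, div_pow, ← pow_mul, ← pow_mul,
      show (n + 1) * 2 = 2 * n + 2 by ring]
    field_simp
  rw [hdecomp]
  have hkey := inv_pow_sub_inv_pow_le (by linarith : 0 < Real.log N) hNle (2 * n)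
  have hlN : 0 < Real.log N := by linarith
  have hn0 : (0 : ℝ) < n := by exact_mod_cast hn
  have hinv : 1 / Real.log N ^ (2 * n + 1) ≤ 2 ^ (2 * n + 1) / ℓ ^ (2 * n + 1) := by
    rw [← div_pow, ← one_div_pow]
    have : 1 / Real.log N ≤ 2 / ℓ := by
      rw [div_le_div_iff₀ hlN hl]
      linarith
    exact pow_le_pow_left₀ (by positivity) this _
  have hmono : 1 / ℓ ^ (2 * n) ≤ 1 / Real.log N ^ (2 * n) := by gcongr
  have h3 : |1 / (2 * n * Real.log N ^ (2 * n)) - 1 / (2 * n) / ℓ ^ (2 * n)| ≤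
      1 / Real.log N ^ (2 * n + 1) := by
    have e1 : 1 / (2 * n * Real.log N ^ (2 * n)) - 1 / (2 * n) / ℓ ^ (2 * n) =
        1 / (2 * n) * (1 / Real.log N ^ (2 * n) - 1 / ℓ ^ (2 * n)) := by field_simp
    rw [e1, abs_of_nonneg (mul_nonneg (by positivity) (by linarith))]
    calc 1 / (2 * (n : ℝ)) * (1 / Real.log N ^ (2 * n) - 1 / ℓ ^ (2 * n))
        ≤ 1 / (2 * n) * (((2 * n : ℕ) : ℝ) * (ℓ - Real.log N) / Real.log N ^ (2 * n + 1)) := by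
          gcongr
      _ = (ℓ - Real.log N) / Real.log N ^ (2 * n + 1) := by
          push_cast
          field_simp
      _ ≤ _ := by gcongr
  have h4 : |(∑ m ∈ Finset.Ioc 1 N, vonMangoldt m ^ 2 / m * g n (Real.log m / ℓ) ^ 2) /
      ℓ ^ (2 * n + 2) - A n / ℓ ^ (2 * n)| ≤ K₁ / ℓ ^ (2 * n + 1) := by
    have e1 : (∑ m ∈ Finset.Ioc 1 N, vonMangoldt m ^ 2 / m * g n (Real.log m / ℓ) ^ 2) /
        ℓ ^ (2 * n + 2) - A n / ℓ ^ (2 * n) =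
        (∑ m ∈ Finset.Ioc 1 N, vonMangoldt m ^ 2 / m * g n (Real.log m / ℓ) ^ 2 - ℓ ^ 2 * A n) /
          ℓ ^ (2 * n + 2) := by
      rw [pow_add]
      field_simp
    rw [e1, abs_div, abs_of_pos (pow_pos hl _), div_le_div_iff₀ (by positivity) (by positivity)]
    calc _ ≤ K₁ * ℓ * ℓ ^ (2 * n + 1) := by gcongr
      _ = _ := by ring
  rw [div_eq_mul_one_div K₂] at h2
  have h2' : K₂ * (1 / Real.log N ^ (2 * n + 1)) ≤
      K₂ * (2 ^ (2 * n + 1) / ℓ ^ (2 * n + 1)) := by gcongr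
  have e5 : (K₁ + (K₂ + 1) * 2 ^ (2 * n + 1)) / ℓ ^ (2 * n + 1) =
      K₁ / ℓ ^ (2 * n + 1) + K₂ * (2 ^ (2 * n + 1) / ℓ ^ (2 * n + 1)) +
        2 ^ (2 * n + 1) / ℓ ^ (2 * n + 1) := by ring
  rw [e5, add_div]
  rw [abs_le] at h2 h3 h4 ⊢
  constructor <;> linarith

/-! ### Oscillatory integrals and the reduction of G and H to the diagonal -/

lemma norm_integral_exp_mul_I_le {ℓ : ℝ} (hℓ : ℓ ≠ 0) (a b : ℝ) :
    ‖∫ t in a..b, Complex.exp (ℓ * t * Complex.I)‖ ≤ 2 / |ℓ| := by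
  have hc : (ℓ * Complex.I : ℂ) ≠ 0 := by simp [hℓ]
  have h := integral_exp_mul_complex (a := a) (b := b) hc
  have e : ∀ t : ℝ, Complex.exp (ℓ * t * Complex.I) = Complex.exp (ℓ * Complex.I * t) :=
    fun t => by ring_nf
  simp only [e]
  rw [h, norm_div]
  have h1 : ∀ t : ℝ, ‖Complex.exp (ℓ * Complex.I * t)‖ = 1 := fun t => by
    rw [← e, ← Complex.ofReal_mul, Complex.norm_exp_ofReal_mul_I]
  have h2 : ‖(ℓ * Complex.I : ℂ)‖ = |ℓ| := by simp
  rw [h2]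
  gcongr
  refine (norm_sub_le _ _).trans ?_
  rw [h1, h1]
  norm_num

lemma natCast_cpow_neg_I_mul {m : ℕ} (hm : 1 ≤ m) (t : ℝ) :
    (m : ℂ) ^ (-(Complex.I * t)) = Complex.exp ((-Real.log m : ℝ) * t * Complex.I) := by
  rw [Complex.cpow_def_of_ne_zero (by exact_mod_cast (by omega : m ≠ 0)), ← Complex.natCast_log]
  congr 1
  push_cast
  ring

lemma I_pow_mul_conj (n : ℕ) (a b : ℂ) :
    Complex.I ^ n * a * (starRingEnd ℂ) (Complex.I ^ n * b) = a * (starRingEnd ℂ) b := by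
  have h : Complex.I ^ n * (starRingEnd ℂ) (Complex.I ^ n) = 1 := by
    rw [Complex.mul_conj, Complex.normSq_eq_norm_sq]
    simp
  rw [map_mul]
  linear_combination (a * (starRingEnd ℂ) b) * h

lemma I_pow_mul_I_pow (n : ℕ) (a b : ℂ) :
    Complex.I ^ n * a * (Complex.I ^ n * b) = (-1) ^ n * (a * b) := by
  rw [← Complex.I_sq, ← pow_mul]
  ring

/-- From Im w · Im z = ½ Re(w z̄ - w z): the unit i^n disappears in the first product and becomes
(-1)^n in the second. The first product carries the difference of frequencies, the second their sum.
-/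
lemma im_I_pow_mul_mul_im (n : ℕ) (a b : ℂ) :
    (Complex.I ^ n * a).im * (Complex.I ^ n * b).im =
      1 / 2 * (a * (starRingEnd ℂ) b - (-1) ^ n * (a * b)).re := by
  rw [← I_pow_mul_conj n a b, ← I_pow_mul_I_pow n a b]
  simp only [Complex.sub_re, Complex.mul_re, Complex.conj_re, Complex.conj_im]
  ring

/-- The oscillating factor of the Dirichlet polynomial. -/
def osc (n m : ℕ) (t : ℝ) : ℝ := (Complex.I ^ n * (m : ℂ) ^ (-(Complex.I * t))).im

lemma osc_eq (n : ℕ) {m : ℕ} (hm : 1 ≤ m) (t : ℝ) :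
    osc n m t = (Complex.I ^ n * Complex.exp ((-Real.log m : ℝ) * t * Complex.I)).im := by
  rw [osc, natCast_cpow_neg_I_mul hm]

lemma continuous_osc (n : ℕ) {m : ℕ} (hm : 1 ≤ m) : Continuous (osc n m) := by
  have : osc n m = fun t : ℝ =>
      (Complex.I ^ n * Complex.exp ((-Real.log m : ℝ) * t * Complex.I)).im :=
    funext fun t => osc_eq n hm t
  rw [this]
  fun_prop

lemma conj_exp_ofReal_mul_I (ℓ t : ℝ) : (starRingEnd ℂ) (Complex.exp (ℓ * t * Complex.I)) =
    Complex.exp ((-ℓ : ℝ) * t * Complex.I) := by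
  rw [← Complex.exp_conj]
  congr 1
  simp

lemma osc_mul_osc (n : ℕ) {m k : ℕ} (hm : 1 ≤ m) (hk : 1 ≤ k) (t : ℝ) :
    osc n m t * osc n k t =
      1 / 2 * (Complex.exp ((Real.log k - Real.log m : ℝ) * t * Complex.I) -
        (-1) ^ n * Complex.exp ((-(Real.log k + Real.log m) : ℝ) * t * Complex.I)).re := by
  rw [osc_eq n hm, osc_eq n hk, im_I_pow_mul_mul_im, conj_exp_ofReal_mul_I, ← Complex.exp_add,
    ← Complex.exp_add]
  congr 4
  · push_cast; ring_nf
  · congr 1; push_cast; ring_nf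

lemma integral_osc_mul_osc (n : ℕ) {m k : ℕ} (hm : 1 ≤ m) (hk : 1 ≤ k) (T : ℝ) :
    ∫ t in (1 : ℝ)..T, osc n m t * osc n k t =
      1 / 2 * ((∫ t in (1 : ℝ)..T, Complex.exp ((Real.log k - Real.log m : ℝ) * t * Complex.I)) -
        (-1) ^ n * ∫ t in (1 : ℝ)..T,
          Complex.exp ((-(Real.log k + Real.log m) : ℝ) * t * Complex.I)).re := by
  simp only [osc_mul_osc n hm hk]
  rw [intervalIntegral.integral_const_mul]
  congr 1
  have hc : ∀ ℓ : ℝ, IntervalIntegrable (fun t : ℝ => Complex.exp (ℓ * t * Complex.I)) volume 1 T :=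
    fun ℓ => Continuous.intervalIntegrable (by fun_prop) _ _
  rw [← intervalIntegral.integral_const_mul, ← intervalIntegral.integral_sub (hc _)
    ((hc _).const_mul _)]
  exact (Complex.reCLM.intervalIntegral_comp_comm ((hc _).sub ((hc _).const_mul _)))

/-- For m < k, log(k/m) ≥ 1 - m/k ≥ 1/k. -/
lemma one_div_le_abs_log_sub_log {N m k : ℕ} (hm : 1 ≤ m) (hk : 1 ≤ k) (hmN : m ≤ N) (hkN : k ≤ N)
    (hmk : m ≠ k) : 1 / (N : ℝ) ≤ |Real.log k - Real.log m| := by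
  wlog h : m < k generalizing m k
  · rw [abs_sub_comm]
    exact this hk hm hkN hmN hmk.symm (by omega)
  have hm0 : (0 : ℝ) < m := by exact_mod_cast hm
  have hk0 : (0 : ℝ) < k := by exact_mod_cast hk
  have hmk' : (m : ℝ) + 1 ≤ k := by exact_mod_cast h
  have hkN' : (k : ℝ) ≤ N := by exact_mod_cast hkN
  refine le_trans ?_ (le_abs_self _)
  have h1 : Real.log (m / k) ≤ m / k - 1 := Real.log_le_sub_one_of_pos (by positivity)
  rw [Real.log_div hm0.ne' hk0.ne'] at h1
  have h2 : 1 / (N : ℝ) ≤ 1 / k := by gcongr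
  have h3 : 1 / (k : ℝ) ≤ 1 - m / k := by
    rw [le_sub_iff_add_le, ← add_div, div_le_one hk0]
    linarith
  linarith

lemma abs_half_re_sub_le (n : ℕ) (a b : ℂ) : |1 / 2 * (a - (-1) ^ n * b).re| ≤
    1 / 2 * (‖a‖ + ‖b‖) := by
  rw [abs_mul, abs_of_pos (by norm_num : (0 : ℝ) < 1 / 2)]
  gcongr
  refine (Complex.abs_re_le_norm _).trans ((norm_sub_le _ _).trans ?_)
  rw [norm_mul, norm_pow, norm_neg, norm_one, one_pow, one_mul]

lemma two_div_abs_log_add_log_le {m k : ℕ} (hm : 2 ≤ m) (hk : 2 ≤ k) :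
    2 / |-(Real.log k + Real.log m)| ≤ 2 := by
  have h1 : Real.log 2 ≤ Real.log m := Real.log_le_log (by norm_num) (by exact_mod_cast hm)
  have h2 : Real.log 2 ≤ Real.log k := Real.log_le_log (by norm_num) (by exact_mod_cast hk)
  have h3 := Real.log_two_gt_d9
  rw [abs_neg, abs_of_pos (by linarith), div_le_iff₀ (by linarith)]
  linarith

/-- The sum frequency is at least 2 log 2 > 1 and contributes O(1). The difference frequency is zero
on the diagonal, giving T - 1, and at least 1/N off it, giving at most 2N. -/
lemma abs_integral_osc_mul_osc_sub_le (n : ℕ) {m k N : ℕ} (hm : 2 ≤ m) (hk : 2 ≤ k) (hmN : m ≤ N)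
    (hkN : k ≤ N) (T : ℝ) :
    |(∫ t in (1 : ℝ)..T, osc n m t * osc n k t) - if m = k then T / 2 else 0| ≤ 2 * N := by
  have hN : (2 : ℝ) ≤ N := by exact_mod_cast hm.trans hmN
  have hneg : -(Real.log k + Real.log m) ≠ 0 := by
    have h1 : 0 < Real.log m := Real.log_pos (by exact_mod_cast hm)
    have h2 : 0 < Real.log k := Real.log_pos (by exact_mod_cast hk)
    linarith
  have hb := (norm_integral_exp_mul_I_le hneg 1 T).trans (two_div_abs_log_add_log_le hm hk)
  rw [integral_osc_mul_osc n (by omega) (by omega)]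
  split_ifs with h
  · subst h
    have h0 : ∫ t in (1 : ℝ)..T, Complex.exp ((Real.log m - Real.log m : ℝ) * t * Complex.I) =
        ((T - 1 : ℝ) : ℂ) := by
      simp
    rw [h0]
    set B := ∫ t in (1 : ℝ)..T, Complex.exp ((-(Real.log m + Real.log m) : ℝ) * t * Complex.I)
    have e : 1 / 2 * (((T - 1 : ℝ) : ℂ) - (-1) ^ n * B).re - T / 2 =
        1 / 2 * ((-1 : ℂ) - (-1) ^ n * B).re := by
      simp only [Complex.sub_re, Complex.ofReal_re, Complex.neg_re, Complex.one_re]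
      ring
    rw [e]
    refine (abs_half_re_sub_le n _ _).trans ?_
    rw [norm_neg, norm_one]
    linarith
  · rw [sub_zero]
    refine (abs_half_re_sub_le n _ _).trans ?_
    have h1 := one_div_le_abs_log_sub_log (by omega) (by omega) hmN hkN h
    have hpos : 0 < |Real.log k - Real.log m| := lt_of_lt_of_le (by positivity) h1
    have ha := norm_integral_exp_mul_I_le (abs_pos.mp hpos) 1 T
    have h2 : 2 / |Real.log k - Real.log m| ≤ 2 * N := by
      rw [div_le_iff₀ hpos]
      rw [div_le_iff₀ (by linarith)] at h1
      linarith
    linarith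

/-- The coefficients `Λ(m) / (√m (log m)^{n+1})`. -/
def coeff (n m : ℕ) : ℝ := vonMangoldt m / (Real.sqrt m * Real.log m ^ (n + 1))

/-- The smoothed coefficients of the Dirichlet polynomial. -/
def smoothCoeff (n : ℕ) (x : ℝ) (m : ℕ) : ℝ := coeff n m * f n (Real.log m / Real.log x)

lemma coeff_sq (n m : ℕ) : coeff n m ^ 2 = coeffSq n m := by
  unfold coeff coeffSq
  rw [div_pow, mul_pow, Real.sq_sqrt (by positivity), ← pow_mul, show (n + 1) * 2 = 2 * n + 2 by ring]

lemma I₃_eq (n : ℕ) (x t : ℝ) :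
    I₃ n x t = 1 / Real.pi * ∑ m ∈ Finset.Icc 2 ⌊x⌋₊, smoothCoeff n x m * osc n m t := by
  unfold I₃ smoothCoeff coeff osc
  congr 1
  refine Finset.sum_congr rfl fun m _ => ?_
  ring

lemma log_div_log_mem {x : ℝ} (hx : 4 ≤ x) {m : ℕ} (hm : m ∈ Finset.Icc 2 ⌊x⌋₊) :
    0 < Real.log m / Real.log x ∧ Real.log m / Real.log x ≤ 1 := by
  rw [Finset.mem_Icc] at hm
  have hm2 : (2 : ℝ) ≤ m := by exact_mod_cast hm.1
  have hmx : (m : ℝ) ≤ x := le_trans (by exact_mod_cast hm.2) (Nat.floor_le (by linarith))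
  have hl : 0 < Real.log x := Real.log_pos (by linarith)
  exact ⟨div_pos (Real.log_pos (by linarith)) hl,
    (div_le_one hl).mpr (Real.log_le_log (by linarith) hmx)⟩

lemma sum_coeffSq_le {n : ℕ} (hn : 1 ≤ n) (N : ℕ) :
    ∑ m ∈ Finset.Icc 2 N, coeffSq n m ≤ C n := by
  have hmono : Monotone fun b : ℕ => ∑ m ∈ Finset.Ioc 1 b, coeffSq n m := fun a b hab =>
    Finset.sum_le_sum_of_subset_of_nonneg (Finset.Ioc_subset_Ioc le_rfl hab)
      fun m _ _ => coeffSq_nonneg n m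
  exact hmono.ge_of_tendsto (tendsto_sum_coeffSq hn) N

lemma C_nonneg {n : ℕ} (hn : 1 ≤ n) : 0 ≤ C n :=
  (Finset.sum_nonneg fun m _ => coeffSq_nonneg n m).trans (sum_coeffSq_le hn 2)

/-- Cauchy–Schwarz with at most x terms, 0 ≤ f ≤ 1 and the convergence of C_n. It turns an error
uniform in m into one for the whole Dirichlet polynomial. -/
lemma sq_sum_abs_smoothCoeff_le {n : ℕ} (hn : 1 ≤ n) {x : ℝ} (hx : 4 ≤ x) :
    (∑ m ∈ Finset.Icc 2 ⌊x⌋₊, |smoothCoeff n x m|) ^ 2 ≤ x * C n := by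
  refine sq_sum_le_card_mul_sum_sq.trans ?_
  have h1 : ((Finset.Icc 2 ⌊x⌋₊).card : ℝ) ≤ x := by
    rw [Nat.card_Icc]
    have h2 : ((⌊x⌋₊ + 1 - 2 : ℕ) : ℝ) ≤ ⌊x⌋₊ := by
      exact_mod_cast (by omega : ⌊x⌋₊ + 1 - 2 ≤ ⌊x⌋₊)
    exact h2.trans (Nat.floor_le (by linarith))
  have h2 : ∑ m ∈ Finset.Icc 2 ⌊x⌋₊, |smoothCoeff n x m| ^ 2 ≤ C n := by
    refine le_trans (Finset.sum_le_sum fun m hm => ?_) (sum_coeffSq_le hn ⌊x⌋₊)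
    obtain ⟨hu0, hu1⟩ := log_div_log_mem hx hm
    rw [sq_abs, smoothCoeff, mul_pow, coeff_sq]
    exact mul_le_of_le_one_right (coeffSq_nonneg n m)
      (pow_le_one₀ (f_nonneg n hu0 hu1) (f_le_one n hu0 hu1))
  have h3 : 0 ≤ C n := C_nonneg hn
  calc _ ≤ x * ∑ m ∈ Finset.Icc 2 ⌊x⌋₊, |smoothCoeff n x m| ^ 2 := by
        gcongr
    _ ≤ _ := by gcongr

/-- The mean square of the Dirichlet polynomial. -/
theorem abs_G_sub_le {n : ℕ} (hn : 1 ≤ n) {x : ℝ} (hx : 4 ≤ x) (T : ℝ) :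
    |G n x T - T / (2 * Real.pi ^ 2) * ∑ m ∈ Finset.Icc 2 ⌊x⌋₊, smoothCoeff n x m ^ 2| ≤
      2 * C n * x ^ 2 := by
  set s := Finset.Icc 2 ⌊x⌋₊ with hs
  set a := smoothCoeff n x with ha
  have hmem : ∀ m ∈ s, 2 ≤ m ∧ m ≤ ⌊x⌋₊ := fun m hm => Finset.mem_Icc.mp hm
  have hG : G n x T = 1 / Real.pi ^ 2 * ∑ m ∈ s, ∑ k ∈ s,
      a m * a k * ∫ t in (1 : ℝ)..T, osc n m t * osc n k t := by
    have h1 : ∀ t : ℝ, |I₃ n x t| ^ 2 = 1 / Real.pi ^ 2 * ∑ m ∈ s, ∑ k ∈ s,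
        a m * a k * (osc n m t * osc n k t) := fun t => by
      rw [sq_abs, I₃_eq, mul_pow, sq (∑ m ∈ _, _), Finset.sum_mul_sum, one_div_pow]
      congr 1
      refine Finset.sum_congr rfl fun m _ => Finset.sum_congr rfl fun k _ => ?_
      ring
    have hcont : ∀ m ∈ s, ∀ k ∈ s, Continuous fun t => a m * a k * (osc n m t * osc n k t) :=
      fun m hm k hk => by
        have h2 := continuous_osc n (m := m) (by have := hmem m hm; omega)
        have h3 := continuous_osc n (m := k) (by have := hmem k hk; omega)
        fun_prop
    unfold G
    simp only [h1]
    rw [intervalIntegral.integral_const_mul, intervalIntegral.integral_finsetSum fun m hm =>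
      (continuous_finsetSum s fun k hk => hcont m hm k hk).intervalIntegrable _ _]
    congr 1
    refine Finset.sum_congr rfl fun m hm => ?_
    rw [intervalIntegral.integral_finsetSum fun k hk => (hcont m hm k hk).intervalIntegrable _ _]
    exact Finset.sum_congr rfl fun k hk => intervalIntegral.integral_const_mul _ _
  have hdiag : T / (2 * Real.pi ^ 2) * ∑ m ∈ s, a m ^ 2 = 1 / Real.pi ^ 2 * ∑ m ∈ s, ∑ k ∈ s,
      a m * a k * if m = k then T / 2 else 0 := by
    rw [Finset.mul_sum, Finset.mul_sum]
    refine Finset.sum_congr rfl fun m hm => ?_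
    simp only [mul_ite, mul_zero]
    rw [Finset.sum_ite_eq s m, if_pos hm]
    field_simp
  have hx0 : (0 : ℝ) ≤ x := by linarith
  have hfl : (⌊x⌋₊ : ℝ) ≤ x := Nat.floor_le hx0
  rw [hG, hdiag, ← mul_sub, ← Finset.sum_sub_distrib]
  simp only [← Finset.sum_sub_distrib, ← mul_sub]
  rw [abs_mul, abs_of_pos (by positivity)]
  have hpi : 1 / Real.pi ^ 2 ≤ 1 := by
    rw [div_le_one (by positivity)]
    nlinarith [Real.pi_gt_three]
  -- Each pair (m, k) has error at most 2⌊x⌋ ≤ 2x, so the double sum factors into the square of the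
  -- ℓ¹ norm.
  have hsum : |∑ m ∈ s, ∑ k ∈ s, a m * a k * ((∫ t in (1 : ℝ)..T, osc n m t * osc n k t) -
      if m = k then T / 2 else 0)| ≤ (∑ m ∈ s, |a m|) ^ 2 * (2 * x) := by
    rw [sq, Finset.sum_mul_sum, Finset.sum_mul]
    refine (Finset.abs_sum_le_sum_abs _ _).trans (Finset.sum_le_sum fun m hm => ?_)
    rw [Finset.sum_mul]
    refine (Finset.abs_sum_le_sum_abs _ _).trans (Finset.sum_le_sum fun k hk => ?_)
    rw [abs_mul, abs_mul]
    have := abs_integral_osc_mul_osc_sub_le n (hmem m hm).1 (hmem k hk).1 (hmem m hm).2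
      (hmem k hk).2 T
    gcongr
    linarith
  calc _ ≤ 1 * ((∑ m ∈ s, |a m|) ^ 2 * (2 * x)) := by gcongr
    _ ≤ 1 * (x * C n * (2 * x)) := by
        gcongr
        exact sq_sum_abs_smoothCoeff_le hn hx
    _ = _ := by ring

/-- The mixed moment, from the correlations of `S_n` with the oscillating factors. -/
theorem abs_H_sub_le {n : ℕ} (hn : 1 ≤ n) {x : ℝ} (hx : 4 ≤ x) {T E : ℝ}
    (hS : IntervalIntegrable (Sn n) volume 1 T)
    (hE : ∀ m ∈ Finset.Icc 2 ⌊x⌋₊,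
      |(∫ t in (1 : ℝ)..T, Sn n t * osc n m t) - T / (2 * Real.pi) * coeff n m| ≤ E) :
    |H n x T - T / (2 * Real.pi ^ 2) *
      ∑ m ∈ Finset.Icc 2 ⌊x⌋₊, 2 * (coeffSq n m * f n (Real.log m / Real.log x))| ≤
      E * Real.sqrt (x * C n) := by
  set s := Finset.Icc 2 ⌊x⌋₊ with hs
  set a := smoothCoeff n x with ha
  have hmem : ∀ m ∈ s, 1 ≤ m := fun m hm => by
    have := (Finset.mem_Icc.mp hm).1
    omega
  have hH : H n x T = 2 / Real.pi * ∑ m ∈ s, a m * ∫ t in (1 : ℝ)..T, Sn n t * osc n m t := by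
    have h1 : ∀ t : ℝ, Sn n t * I₃ n x t = 1 / Real.pi * ∑ m ∈ s, a m * (Sn n t * osc n m t) :=
      fun t => by
        rw [I₃_eq, mul_left_comm, Finset.mul_sum]
        congr 1
        refine Finset.sum_congr rfl fun m _ => ?_
        ring
    unfold H
    simp only [h1]
    rw [intervalIntegral.integral_const_mul, intervalIntegral.integral_finsetSum fun m hm =>
      (hS.mul_continuousOn (continuous_osc n (hmem m hm)).continuousOn).const_mul _]
    rw [← mul_assoc, mul_one_div]
    congr 1
    exact Finset.sum_congr rfl fun m hm => intervalIntegral.integral_const_mul _ _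
  have hmain : T / (2 * Real.pi ^ 2) * ∑ m ∈ s, 2 * (coeffSq n m * f n (Real.log m / Real.log x)) =
      2 / Real.pi * ∑ m ∈ s, a m * (T / (2 * Real.pi) * coeff n m) := by
    rw [Finset.mul_sum, Finset.mul_sum]
    refine Finset.sum_congr rfl fun m hm => ?_
    rw [ha, smoothCoeff, ← coeff_sq]
    field_simp
  have hpi : 2 / Real.pi ≤ 1 := by
    rw [div_le_one Real.pi_pos]
    linarith [Real.pi_gt_three]
  -- The range is nonempty: x ≥ 4 puts m = 2 in it.
  have hE0 : 0 ≤ E := (abs_nonneg _).trans (hE 2 (by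
    rw [hs, Finset.mem_Icc]
    exact ⟨le_rfl, (log_floor_bounds hx).1⟩))
  rw [hH, hmain, ← mul_sub, ← Finset.sum_sub_distrib]
  simp only [← mul_sub]
  rw [abs_mul, abs_of_pos (by positivity)]
  have hsum : |∑ m ∈ s, a m * ((∫ t in (1 : ℝ)..T, Sn n t * osc n m t) -
      T / (2 * Real.pi) * coeff n m)| ≤ (∑ m ∈ s, |a m|) * E := by
    rw [Finset.sum_mul]
    refine (Finset.abs_sum_le_sum_abs _ _).trans (Finset.sum_le_sum fun m hm => ?_)
    rw [abs_mul]
    gcongr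
    exact hE m hm
  have hsq : ∑ m ∈ s, |a m| ≤ Real.sqrt (x * C n) :=
    Real.le_sqrt_of_sq_le (sq_sum_abs_smoothCoeff_le hn hx)
  calc _ ≤ 1 * ((∑ m ∈ s, |a m|) * E) := by gcongr
    _ ≤ 1 * (Real.sqrt (x * C n) * E) := by gcongr
    _ = _ := by ring

/-! ### Uniqueness of continuous logarithms -/

/-- A continuous function with values in `c ℤ` on a preconnected set is constant. -/
lemma eq_of_continuousOn_of_int_mul {X : Type*} [TopologicalSpace X] {S : Set X}
    (hS : IsPreconnected S) {φ : X → ℝ} (hφ : ContinuousOn φ S) {c : ℝ} (hc : 0 < c)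
    (hint : ∀ x ∈ S, ∃ k : ℤ, φ x = k * c) {x y : X} (hx : x ∈ S) (hy : y ∈ S) : φ x = φ y := by
  by_contra hne
  wlog hlt : φ x < φ y generalizing x y
  · exact this hy hx (Ne.symm hne) (lt_of_le_of_ne (not_lt.mp hlt) (Ne.symm hne))
  obtain ⟨k, hk⟩ := hint x hx
  obtain ⟨l, hl⟩ := hint y hy
  have hkl : k + 1 ≤ l := by
    rw [hk, hl] at hlt
    have : (k : ℝ) < l := lt_of_mul_lt_mul_right hlt hc.le
    exact_mod_cast this
  have hklR : (k : ℝ) + 1 ≤ l := by exact_mod_cast hkl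
  -- By the intermediate value property φ would attain (k + 1/2)c, which is not an integer multiple
  -- of c.
  have hmem : ((k : ℝ) + 1 / 2) * c ∈ φ '' S := by
    refine (hS.image φ hφ).ordConnected.out ⟨x, hx, rfl⟩ ⟨y, hy, rfl⟩ ⟨?_, ?_⟩
    · rw [hk]
      nlinarith
    · rw [hl]
      nlinarith
  obtain ⟨z, hz, hzeq⟩ := hmem
  obtain ⟨j, hj⟩ := hint z hz
  rw [hj] at hzeq
  have h1 : (j : ℝ) = k + 1 / 2 := mul_right_cancel₀ hc.ne' hzeq
  have h2 : (2 * j : ℤ) = 2 * k + 1 := by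
    have : (2 * j : ℝ) = 2 * k + 1 := by linarith
    exact_mod_cast this
  omega

/-- Two continuous logarithms of the same function on a preconnected set differ by a constant. -/
lemma sub_eq_sub_of_exp_eq_exp {X : Type*} [TopologicalSpace X] {S : Set X}
    (hS : IsPreconnected S) {p q : X → ℂ} (hp : ContinuousOn p S) (hq : ContinuousOn q S)
    (hexp : ∀ x ∈ S, Complex.exp (p x) = Complex.exp (q x)) {x y : X} (hx : x ∈ S) (hy : y ∈ S) :
    p x - q x = p y - q y := by
  have key : ∀ x ∈ S, ∃ k : ℤ, p x = q x + k * (2 * Real.pi * Complex.I) := fun x hx =>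
    Complex.exp_eq_exp_iff_exists_int.mp (hexp x hx)
  have him : (p x - q x).im = (p y - q y).im := by
    refine eq_of_continuousOn_of_int_mul hS (φ := fun x => (p x - q x).im)
      (Complex.continuous_im.comp_continuousOn (hp.sub hq)) (c := 2 * Real.pi) (by positivity)
      (fun x hx => ?_) hx hy
    obtain ⟨k, hk⟩ := key x hx
    refine ⟨k, ?_⟩
    simp [hk]
  have hre : ∀ x ∈ S, (p x - q x).re = 0 := fun x hx => by
    obtain ⟨k, hk⟩ := key x hx
    simp [hk]
  exact Complex.ext (by rw [hre x hx, hre y hy]) him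

/-! ### The function (s - 1)ζ(s) and its growth -/

/-- The entire function `(s - 1) ζ(s)`. -/
def Z : ℂ → ℂ := Function.update (fun s => (s - 1) * riemannZeta s) 1 1

lemma Z_apply {s : ℂ} (hs : s ≠ 1) : Z s = (s - 1) * riemannZeta s := Function.update_of_ne hs _ _

lemma Z_one : Z 1 = 1 := Function.update_self _ _ _

/-- The residue of ζ at 1 is 1, so the chosen value makes Z continuous there and the singularity is
removable. -/
lemma differentiable_Z : Differentiable ℂ Z := by
  rw [← differentiableOn_univ,
    ← Complex.differentiableOn_compl_singleton_and_continuousAt_iff (c := 1) Filter.univ_mem]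
  refine ⟨DifferentiableOn.congr (f := fun s => (s - 1) * riemannZeta s) (fun s hs => ?_)
    fun s hs => Z_apply hs.2, continuousWithinAt_compl_self.mp ?_⟩
  · have := differentiableAt_riemannZeta hs.2
    exact DifferentiableAt.differentiableWithinAt (by fun_prop)
  · have h := riemannZeta_residue_one
    unfold ContinuousWithinAt
    rw [Z_one]
    refine h.congr' ?_
    filter_upwards [self_mem_nhdsWithin] with s hs
    exact (Z_apply hs).symm

lemma Z_ofReal_im (v : ℝ) : (Z v).im = 0 := by
  by_cases hv : (v : ℂ) = 1
  · rw [hv, Z_one, Complex.one_im]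
  · rw [Z_apply hv, ← Complex.conj_eq_iff_im, map_mul, ← riemannZeta_conj]
    simp

/-- The fractional part, cut off to `(1, ∞)`. -/
def fractTail (t : ℝ) : ℂ := Set.indicator (Set.Ioi 1) (fun t : ℝ => ((Int.fract t : ℝ) : ℂ)) t

lemma norm_fractTail_le (t : ℝ) : ‖fractTail t‖ ≤ 1 := by
  unfold fractTail
  refine (norm_indicator_le_norm_self _ _).trans ?_
  rw [Complex.norm_real, Real.norm_of_nonneg (Int.fract_nonneg t)]
  exact (Int.fract_lt_one t).le

lemma measurable_fractTail : Measurable fractTail :=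
  (Complex.measurable_ofReal.comp measurable_fract).indicator measurableSet_Ioi

/-- Writing the integral as a Mellin transform provides its holomorphy in Re s > 0. -/
lemma mellin_fractTail (s : ℂ) :
    mellin fractTail (-s) = ∫ t in Set.Ioi (1 : ℝ), ((Int.fract t : ℝ) : ℂ) * (t : ℂ) ^ (-(s + 1)) := by
  unfold mellin fractTail
  have : ∀ t : ℝ, (t : ℂ) ^ (-s - 1) •
      Set.indicator (Set.Ioi 1) (fun t : ℝ => ((Int.fract t : ℝ) : ℂ)) t =
      Set.indicator (Set.Ioi 1) (fun t : ℝ => ((Int.fract t : ℝ) : ℂ) * (t : ℂ) ^ (-(s + 1))) t := by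
    intro t
    by_cases ht : t ∈ Set.Ioi (1 : ℝ)
    · rw [Set.indicator_of_mem ht, Set.indicator_of_mem ht, smul_eq_mul, mul_comm]
      ring_nf
    · rw [Set.indicator_of_notMem ht, Set.indicator_of_notMem ht, smul_zero]
  simp only [this]
  rw [setIntegral_indicator measurableSet_Ioi, Set.inter_eq_right.mpr]
  exact Set.Ioi_subset_Ioi zero_le_one

lemma differentiableAt_mellin_fractTail {s : ℂ} (hs : 0 < s.re) :
    DifferentiableAt ℂ (fun s => mellin fractTail (-s)) s := by
  have h : DifferentiableAt ℂ (mellin fractTail) (-s) := by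
    refine mellin_differentiableAt_of_isBigO_rpow (a := 0) (b := (-s).re - 1) ?_ ?_ ?_ ?_ ?_
    · refine LocallyIntegrable.locallyIntegrableOn ?_ _
      refine LocallyIntegrable.mono (f := fun _ : ℝ => (1 : ℝ)) (locallyIntegrable_const (1 : ℝ))
        measurable_fractTail.aestronglyMeasurable (ae_of_all _ fun t => ?_)
      simpa using norm_fractTail_le t
    · refine Asymptotics.isBigO_of_le _ fun t => ?_
      simpa using norm_fractTail_le t
    · simpa using hs
    · refine Asymptotics.IsBigO.of_bound 0 ?_
      have : Set.Iio (1 : ℝ) ∈ 𝓝[>] (0 : ℝ) := mem_nhdsWithin_of_mem_nhds (Iio_mem_nhds one_pos)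
      filter_upwards [this] with t ht
      have : t ∉ Set.Ioi (1 : ℝ) := by simpa using le_of_lt ht
      simp [fractTail, Set.indicator_of_notMem this]
    · linarith
  exact h.comp s differentiableAt_id.neg

/-- Abel summation gives ζ(s) = s ∫₁^∞ ⌊t⌋ t^{-s-1} dt; insert ⌊t⌋ = t - {t}. -/
lemma Z_eq_of_one_lt_re {s : ℂ} (hs : 1 < s.re) :
    Z s = s - s * (s - 1) * mellin fractTail (-s) := by
  have hs1 : s ≠ 1 := fun h => by rw [h] at hs; simp at hs
  have hs10 : s - 1 ≠ 0 := sub_ne_zero.mpr hs1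
  rw [Z_apply hs1, ← LSeries_one_eq_riemannZeta hs]
  have h := LSeries_eq_mul_integral_of_nonneg (fun _ => 1) zero_le_one (s := s) hs
    (by simpa using Asymptotics.isBigO_refl (fun n : ℕ => (n : ℝ)) atTop) (fun _ => zero_le_one)
  have h1 : LSeries 1 s = LSeries (fun _ => ((1 : ℝ) : ℂ)) s := by
    congr 1
  have hint1 : IntegrableOn (fun t : ℝ => (t : ℂ) ^ (-s)) (Set.Ioi 1) :=
    integrableOn_Ioi_cpow_of_lt (by simpa using hs) one_pos
  have hint2 : IntegrableOn (fun t : ℝ => ((Int.fract t : ℝ) : ℂ) * (t : ℂ) ^ (-(s + 1)))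
      (Set.Ioi 1) := by
    have hbase : IntegrableOn (fun t : ℝ => (t : ℂ) ^ (-(s + 1))) (Set.Ioi 1) :=
      integrableOn_Ioi_cpow_of_lt (by simp; linarith) one_pos
    refine Integrable.bdd_mul (c := 1) hbase
      (Complex.measurable_ofReal.comp measurable_fract).aestronglyMeasurable
      (ae_of_all _ fun t => ?_)
    rw [Complex.norm_real, Real.norm_of_nonneg (Int.fract_nonneg t)]
    exact (Int.fract_lt_one t).le
  have h2 : ∫ t in Set.Ioi (1 : ℝ), (∑ k ∈ Finset.Icc 1 ⌊t⌋₊, ((1 : ℝ) : ℂ)) * (t : ℂ) ^ (-(s + 1)) =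
      (∫ t in Set.Ioi (1 : ℝ), (t : ℂ) ^ (-s)) - mellin fractTail (-s) := by
    rw [mellin_fractTail, ← integral_sub hint1 hint2]
    refine setIntegral_congr_fun measurableSet_Ioi fun t ht => ?_
    have ht : (1 : ℝ) < t := ht
    have ht0 : (t : ℂ) ≠ 0 := by
      exact_mod_cast (by linarith : t ≠ 0)
    have hfl : ((⌊t⌋₊ : ℝ)) = t - Int.fract t := by
      rw [natCast_floor_eq_intCast_floor (by linarith)]
      exact (Int.self_sub_fract t).symm
    have hfl' : ((⌊t⌋₊ : ℂ)) = t - (Int.fract t : ℝ) := by exact_mod_cast congrArg Complex.ofReal hfl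
    simp only [Complex.ofReal_one, Finset.sum_const, Nat.card_Icc, add_tsub_cancel_right,
      nsmul_eq_mul, mul_one]
    rw [hfl', sub_mul]
    congr 1
    rw [neg_add, Complex.cpow_add _ _ ht0, Complex.cpow_neg_one]
    field_simp
  rw [h1, h, h2, integral_Ioi_cpow_of_lt (by simpa using hs) one_pos]
  simp only [Complex.ofReal_one, Complex.one_cpow]
  have h3 : -s + 1 ≠ 0 := by
    intro h
    apply hs10
    linear_combination -h
  field_simp
  ring

/-- Both sides are analytic in the half-plane Re s > 0, so the identity theorem applies. -/
lemma Z_eq_of_re_pos {s : ℂ} (hs : 0 < s.re) :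
    Z s = s - s * (s - 1) * mellin fractTail (-s) := by
  have hopen : IsOpen {s : ℂ | 0 < s.re} := isOpen_lt continuous_const Complex.continuous_re
  have hconv : IsPreconnected {s : ℂ | 0 < s.re} :=
    (convex_halfSpace_re_gt 0).isPreconnected
  have h1 : AnalyticOnNhd ℂ Z {s : ℂ | 0 < s.re} :=
    (differentiable_Z.differentiableOn).analyticOnNhd hopen
  have h2 : AnalyticOnNhd ℂ (fun s => s - s * (s - 1) * mellin fractTail (-s))
      {s : ℂ | 0 < s.re} := by
    refine DifferentiableOn.analyticOnNhd (fun s hs => ?_) hopen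
    have := differentiableAt_mellin_fractTail hs
    exact DifferentiableAt.differentiableWithinAt (by fun_prop)
  refine h1.eqOn_of_preconnected_of_eventuallyEq h2 hconv (z₀ := 2) (by simp) ?_ hs
  have : {s : ℂ | 1 < s.re} ∈ 𝓝 (2 : ℂ) :=
    (isOpen_lt continuous_const Complex.continuous_re).mem_nhds (by simp)
  filter_upwards [this] with s hs using Z_eq_of_one_lt_re hs

lemma norm_mellin_fractTail_le {s : ℂ} (hs : 1 / 2 ≤ s.re) : ‖mellin fractTail (-s)‖ ≤ 2 := by
  rw [mellin_fractTail]
  have hI : IntegrableOn (fun t : ℝ => t ^ (-(3 / 2) : ℝ)) (Set.Ioi 1) :=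
    integrableOn_Ioi_rpow_of_lt (by norm_num) one_pos
  refine (norm_integral_le_of_norm_le hI ?_).trans ?_
  · filter_upwards [ae_restrict_mem measurableSet_Ioi] with t ht
    have ht : (1 : ℝ) < t := ht
    rw [norm_mul, Complex.norm_real, Real.norm_of_nonneg (Int.fract_nonneg t),
      Complex.norm_cpow_eq_rpow_re_of_pos (by linarith)]
    refine (mul_le_of_le_one_left (by positivity) (Int.fract_lt_one t).le).trans ?_
    refine Real.rpow_le_rpow_of_exponent_le ht.le ?_
    simp only [Complex.neg_re, Complex.add_re, Complex.one_re]
    linarith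
  · rw [integral_Ioi_rpow_of_lt (by norm_num) one_pos]
    norm_num

lemma norm_Z_le {s : ℂ} (hs : 1 / 2 ≤ s.re) : ‖Z s‖ ≤ 3 * (1 + ‖s‖) ^ 2 := by
  rw [Z_eq_of_re_pos (by linarith)]
  have h1 := norm_mellin_fractTail_le hs
  have h2 : ‖s - 1‖ ≤ ‖s‖ + 1 := (norm_sub_le _ _).trans (by simp)
  have h0 := norm_nonneg s
  calc ‖s - s * (s - 1) * mellin fractTail (-s)‖ ≤ ‖s‖ + ‖s‖ * ‖s - 1‖ * ‖mellin fractTail (-s)‖ := by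
        refine (norm_sub_le _ _).trans ?_
        rw [norm_mul, norm_mul]
    _ ≤ ‖s‖ + ‖s‖ * (‖s‖ + 1) * 2 := by gcongr
    _ ≤ _ := by nlinarith

/-! ### The logarithm of ζ to the right of the critical line -/

/-- `M` is the holomorphic logarithm of `(s - 1) ζ(s)` on the half-plane `Re s > 1/2` that is real
on the real axis. -/
structure IsLogZ (M : ℂ → ℂ) : Prop where
  differentiableOn : DifferentiableOn ℂ M {s | 1 / 2 < s.re}
  exp_eq : ∀ s : ℂ, 1 / 2 < s.re → Complex.exp (M s) = Z s
  im_ofReal : ∀ v : ℝ, 1 / 2 < v → (M v).im = 0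

lemma isOpen_half : IsOpen {s : ℂ | 1 / 2 < s.re} :=
  isOpen_lt continuous_const Complex.continuous_re

lemma Z_ne_zero (hRH : RiemannHypothesis) {s : ℂ} (hs : 1 / 2 < s.re) : Z s ≠ 0 := by
  by_cases h1 : s = 1
  · rw [h1, Z_one]
    exact one_ne_zero
  rw [Z_apply h1]
  refine mul_ne_zero (sub_ne_zero.mpr h1) fun h0 => ?_
  have := hRH s h0 (by
    rintro ⟨n, rfl⟩
    simp at hs
    have : (0 : ℝ) ≤ n := n.cast_nonneg
    linarith) h1
  linarith

lemma riemannZeta_two_re_pos : 0 < (Z 2).re ∧ (Z 2).im = 0 := by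
  rw [Z_apply (by norm_num), riemannZeta_two]
  have : ((2 : ℂ) - 1) * ((Real.pi : ℂ) ^ 2 / 6) = ((Real.pi ^ 2 / 6 : ℝ) : ℂ) := by
    push_cast
    ring
  rw [this]
  exact ⟨by rw [Complex.ofReal_re]; positivity, Complex.ofReal_im _⟩

/-- Z has no zeros in the half-plane, which is convex, so Z'/Z has a primitive M; normalised at 2, Z
e^{-M} is constantly 1. On the real axis Z is real, so Im M is a multiple of π; being continuous, it
keeps its value 0 at 2. -/
lemma exists_isLogZ (hRH : RiemannHypothesis) : ∃ M, IsLogZ M := by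
  have hconv : Convex ℝ {s : ℂ | 1 / 2 < s.re} := convex_halfSpace_re_gt _
  have hZ' : Differentiable ℂ (deriv Z) := by
    have := differentiable_Z
    exact (this.contDiff (n := 2)).differentiable_deriv_two
  have hd : DifferentiableOn ℂ (fun s => deriv Z s / Z s) {s : ℂ | 1 / 2 < s.re} := fun s hs =>
    ((hZ' s).div (differentiable_Z s) (Z_ne_zero hRH hs)).differentiableWithinAt
  obtain ⟨P, hP⟩ := hconv.exists_forall_hasDerivWithinAt hd
  have hP' : ∀ s : ℂ, 1 / 2 < s.re → HasDerivAt P (deriv Z s / Z s) s := fun s hs =>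
    (hP s hs).hasDerivAt (isOpen_half.mem_nhds hs)
  set M : ℂ → ℂ := fun s => P s - P 2 + Complex.log (Z 2) with hM
  have h2 : (1 : ℝ) / 2 < (2 : ℂ).re := by norm_num
  have hZ2 : Z 2 ≠ 0 := Z_ne_zero hRH h2
  have hM' : ∀ s : ℂ, 1 / 2 < s.re → HasDerivAt M (deriv Z s / Z s) s := fun s hs =>
    ((hP' s hs).sub_const _).add_const _
  have hexp : ∀ s : ℂ, 1 / 2 < s.re → Complex.exp (M s) = Z s := by
    have hconst : ∀ s : ℂ, 1 / 2 < s.re →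
        HasDerivAt (fun s => Z s * Complex.exp (-M s)) 0 s := fun s hs => by
      have h := (differentiable_Z s).hasDerivAt.fun_mul (hM' s hs).fun_neg.cexp
      refine h.congr_deriv ?_
      have := Z_ne_zero hRH hs
      field_simp
      ring
    intro s hs
    have h : Z s * Complex.exp (-M s) = Z 2 * Complex.exp (-M 2) := by
      refine isOpen_half.is_const_of_deriv_eq_zero hconv.isPreconnected
        (f := fun s => Z s * Complex.exp (-M s))
        (fun s hs => (hconst s hs).differentiableAt.differentiableWithinAt)
        (fun s hs => (hconst s hs).deriv) hs h2
    have hM2 : Complex.exp (-M 2) = (Z 2)⁻¹ := by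
      simp only [hM, sub_self, zero_add]
      rw [Complex.exp_neg, Complex.exp_log hZ2]
    rw [hM2, mul_inv_cancel₀ hZ2, Complex.exp_neg] at h
    have := Complex.exp_ne_zero (M s)
    field_simp at h
    exact h.symm
  refine ⟨M, fun s hs => (hM' s hs).differentiableAt.differentiableWithinAt, hexp, ?_⟩
  have hcont : ContinuousOn (fun v : ℝ => (M v).im) (Set.Ioi (1 / 2)) := fun v hv =>
    (Complex.continuous_im.continuousAt.comp ((hM' v (by simpa using hv)).continuousAt.comp
      Complex.continuous_ofReal.continuousAt)).continuousWithinAt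
  intro v hv
  have h0 : (M (2 : ℝ)).im = 0 := by
    simp only [hM, Complex.ofReal_ofNat, sub_self, zero_add, Complex.log_im]
    rw [Complex.arg_eq_zero_iff]
    exact ⟨riemannZeta_two_re_pos.1.le, riemannZeta_two_re_pos.2⟩
  rw [← h0]
  refine eq_of_continuousOn_of_int_mul isPreconnected_Ioi hcont Real.pi_pos (fun v hv => ?_) hv
    (by norm_num : (2 : ℝ) ∈ Set.Ioi (1 / 2))
  have he := hexp v (by simpa using hv)
  have hs : Real.sin (M v).im = 0 := by
    have h3 := congrArg Complex.im he
    rw [Z_ofReal_im, Complex.exp_im] at h3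
    exact (mul_eq_zero.mp h3).resolve_left (Real.exp_ne_zero _)
  obtain ⟨k, hk⟩ := Real.sin_eq_zero_iff.mp hs
  exact ⟨k, hk.symm⟩

/-- The logarithm of `ζ` with the pole at `1` put back. On the real segment `(1/2, 1)` it takes the
boundary values from the upper half-plane. -/
def logZeta (M : ℂ → ℂ) (s : ℂ) : ℂ := M s - Complex.log (s - 1)


variable {M : ℂ → ℂ}

lemma exp_logZeta (hM : IsLogZ M) {s : ℂ} (hs : 1 / 2 < s.re) (hs1 : s ≠ 1) :
    Complex.exp (logZeta M s) = riemannZeta s := by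
  have h := sub_ne_zero.mpr hs1
  rw [logZeta, Complex.exp_sub, hM.exp_eq s hs, Complex.exp_log h, Z_apply hs1]
  field_simp

lemma logZeta_re (hM : IsLogZ M) {s : ℂ} (hs : 1 / 2 < s.re) (hs1 : s ≠ 1) :
    (logZeta M s).re = Real.log ‖riemannZeta s‖ := by
  rw [← exp_logZeta hM hs hs1, Complex.norm_exp, Real.log_exp]

lemma M_re (hM : IsLogZ M) {s : ℂ} (hs : 1 / 2 < s.re) : (M s).re = Real.log ‖Z s‖ := by
  rw [← hM.exp_eq s hs, Complex.norm_exp, Real.log_exp]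

/-- The value -π on (1/2, 1) is the argument picked up by passing above the pole. Its iterated
integrals produce the constants δ_n with n even. -/
lemma logZeta_im_ofReal (hM : IsLogZ M) {v : ℝ} (hv : 1 / 2 < v) :
    (logZeta M v).im = if v < 1 then -Real.pi else 0 := by
  rw [logZeta, Complex.sub_im, hM.im_ofReal v hv, Complex.log_im,
    show (v : ℂ) - 1 = ((v - 1 : ℝ) : ℂ) by push_cast; rfl]
  split_ifs with h
  · rw [Complex.arg_ofReal_of_neg (by linarith), zero_sub]
  · rw [Complex.arg_ofReal_of_nonneg (by linarith), sub_zero]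

lemma differentiableAt_M (hM : IsLogZ M) {s : ℂ} (hs : 1 / 2 < s.re) : DifferentiableAt ℂ M s :=
  hM.differentiableOn.differentiableAt (isOpen_half.mem_nhds hs)

lemma differentiableAt_logZeta (hM : IsLogZ M) {s : ℂ} (hs : 1 / 2 < s.re)
    (hs1 : s - 1 ∈ Complex.slitPlane) : DifferentiableAt ℂ (logZeta M) s := by
  unfold logZeta
  exact (differentiableAt_M hM hs).sub ((differentiableAt_id.sub_const 1).clog hs1)

/-- On the negative axis the principal logarithm is continuous from above, and only the closed upper
half-plane is considered. -/
lemma continuousOn_logZeta (hM : IsLogZ M) :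
    ContinuousOn (logZeta M) {s | 1 / 2 < s.re ∧ 0 ≤ s.im ∧ s ≠ 1} := by
  intro s hs
  refine (differentiableAt_M hM hs.1).continuousAt.continuousWithinAt.sub ?_
  have hs1 : s - 1 ≠ 0 := sub_ne_zero.mpr hs.2.2
  by_cases hsl : s - 1 ∈ Complex.slitPlane
  · exact ((differentiableAt_id.sub_const 1).clog hsl).continuousAt.continuousWithinAt
  · rw [Complex.mem_slitPlane_iff, not_or, not_lt, not_not] at hsl
    have hne : (s - 1).re < 0 := lt_of_le_of_ne hsl.1 fun h => hs1 (Complex.ext h hsl.2)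
    have h := Complex.continuousWithinAt_log_of_re_neg_of_im_zero hne hsl.2
    refine ContinuousWithinAt.comp (t := {z : ℂ | 0 ≤ z.im}) (f := fun s : ℂ => s - 1) h
      (by fun_prop) fun z hz => ?_
    simpa using hz.2.1

/-- The Dirichlet series with coefficients `Λ(k) / (log k)^j`. -/
def mangoldtSeries (j : ℕ) (s : ℂ) : ℂ :=
  LSeries (fun k => ((vonMangoldt k / Real.log k ^ j : ℝ) : ℂ)) s

lemma norm_mangoldt_div_le (j k : ℕ) :
    ‖((vonMangoldt k / Real.log k ^ (j + 1) : ℝ) : ℂ)‖ ≤ (Real.log 2 ^ j)⁻¹ := by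
  rw [Complex.norm_real, Real.norm_eq_abs, abs_div, abs_pow,
    abs_of_nonneg ArithmeticFunction.vonMangoldt_nonneg,
    abs_of_nonneg (Real.log_natCast_nonneg k)]
  have hl2 : 0 < Real.log 2 := Real.log_pos (by norm_num)
  rcases lt_or_ge k 2 with hk | hk
  · have : vonMangoldt k = 0 := by
      interval_cases k <;> simp
    rw [this, zero_div]
    positivity
  · have hl : Real.log 2 ≤ Real.log k := Real.log_le_log (by norm_num) (by exact_mod_cast hk)
    have hl0 : 0 < Real.log k := by linarith
    calc vonMangoldt k / Real.log k ^ (j + 1) ≤ Real.log k / Real.log k ^ (j + 1) := by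
          gcongr
          exact ArithmeticFunction.vonMangoldt_le_log
      _ = (Real.log k ^ j)⁻¹ := by
          rw [pow_succ]
          field_simp
      _ ≤ _ := by gcongr

lemma lseriesSummable_mangoldt (j : ℕ) {s : ℂ} (hs : 1 < s.re) :
    LSeriesSummable (fun k => ((vonMangoldt k / Real.log k ^ (j + 1) : ℝ) : ℂ)) s :=
  LSeriesSummable_of_bounded_of_one_lt_re (fun k _ => norm_mangoldt_div_le j k) hs

/-- Both sides are continuous logarithms of ζ on a connected half-plane, so they differ by a
constant. At 2 both are real, and the exponentials have the same norm. -/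
lemma logZeta_eq_mangoldtSeries (hM : IsLogZ M) {s : ℂ} (hs : 1 < s.re) :
    logZeta M s = mangoldtSeries 1 s := by
  have hconv : IsPreconnected {s : ℂ | 1 < s.re} := (convex_halfSpace_re_gt 1).isPreconnected
  have hne : ∀ s : ℂ, 1 < s.re → s ≠ 1 := fun s hs h => by simp [h] at hs
  have h1 : ContinuousOn (logZeta M) {s : ℂ | 1 < s.re} := fun s hs =>
    (differentiableAt_logZeta hM (by linarith [Set.mem_ofPred.mp hs]) (by
      rw [Complex.mem_slitPlane_iff]
      left
      simpa using hs)).continuousAt.continuousWithinAt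
  have h2 : ContinuousOn (mangoldtSeries 1) {s : ℂ | 1 < s.re} := fun s hs => by
    refine (LSeries_hasDerivAt ?_).continuousAt.continuousWithinAt
    refine (LSeries.abscissaOfAbsConv_le_of_le_const ⟨_, fun k _ =>
      norm_mangoldt_div_le 0 k⟩).trans_lt ?_
    exact_mod_cast hs
  have hexp : ∀ s ∈ {s : ℂ | 1 < s.re},
      Complex.exp (logZeta M s) = Complex.exp (mangoldtSeries 1 s) := fun s hs => by
    rw [exp_logZeta hM (by linarith [Set.mem_ofPred.mp hs]) (hne s hs),
      ← riemannZeta_eq_exp_LSeries hs, mangoldtSeries]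
    simp
  have h := sub_eq_sub_of_exp_eq_exp hconv h1 h2 hexp hs (y := ((2 : ℝ) : ℂ)) (by simp)
  suffices h0 : logZeta M ((2 : ℝ) : ℂ) = mangoldtSeries 1 ((2 : ℝ) : ℂ) by
    rw [h0, sub_self] at h
    exact sub_eq_zero.mp h
  have him1 : (logZeta M ((2 : ℝ) : ℂ)).im = 0 := by
    rw [logZeta_im_ofReal hM (by norm_num), if_neg (by norm_num)]
  have him2 : (mangoldtSeries 1 ((2 : ℝ) : ℂ)).im = 0 := by
    rw [mangoldtSeries, LSeries, Complex.im_tsum (lseriesSummable_mangoldt 0 (by simp))]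
    convert tsum_zero with k
    rw [LSeries.term_def]
    split_ifs
    · simp
    · rw [← Complex.ofReal_natCast, ← Complex.ofReal_cpow (by positivity), ← Complex.ofReal_div,
        Complex.ofReal_im]
  have hre := hexp ((2 : ℝ) : ℂ) (by simp)
  have hn := congrArg norm hre
  rw [Complex.norm_exp, Complex.norm_exp, Real.exp_eq_exp] at hn
  exact Complex.ext hn (by rw [him1, him2])

lemma two_rpow_neg_le_exp {a : ℝ} (ha : 0 ≤ a) : (2 : ℝ) ^ (-a) ≤ Real.exp (-(a / 2)) := by
  rw [Real.rpow_def_of_pos (by norm_num), Real.exp_le_exp]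
  nlinarith [Real.log_two_gt_d9]

/-- Exponential decay of `log ζ` to the right. -/
lemma exists_norm_logZeta_le (hM : IsLogZ M) :
    ∃ K : ℝ, 0 ≤ K ∧ ∀ s : ℂ, 2 ≤ s.re → ‖logZeta M s‖ ≤ K * Real.exp (-(s.re / 2)) := by
  have hsum : Summable fun k : ℕ => ((k : ℝ) ^ 2)⁻¹ :=
    Real.summable_nat_pow_inv.mpr (by norm_num)
  refine ⟨(∑' k : ℕ, ((k : ℝ) ^ 2)⁻¹) * Real.exp 1,
    mul_nonneg (tsum_nonneg fun k => by positivity) (Real.exp_pos _).le, fun s hs => ?_⟩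
  rw [logZeta_eq_mangoldtSeries hM (by linarith), mangoldtSeries, LSeries]
  have hb : ∀ k : ℕ, ‖LSeries.term (fun k => ((vonMangoldt k / Real.log k ^ 1 : ℝ) : ℂ)) s k‖ ≤
      ((k : ℝ) ^ 2)⁻¹ * (Real.exp 1 * Real.exp (-(s.re / 2))) := fun k => by
    rw [LSeries.norm_term_eq]
    split_ifs with hk
    · positivity
    rcases lt_or_ge k 2 with hk2 | hk2
    · have : vonMangoldt k = 0 := by
        interval_cases k <;> simp
      rw [this]
      simp
      positivity
    have hk0 : (0 : ℝ) < k := by positivity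
    have hk2R : (2 : ℝ) ≤ k := by exact_mod_cast hk2
    have h1 : ‖((vonMangoldt k / Real.log k ^ 1 : ℝ) : ℂ)‖ ≤ 1 := by
      simpa using norm_mangoldt_div_le 0 k
    -- Split off k^{-2}, which is summable. The rest is at most 2^{-(σ-2)} ≤ e^{-(σ-2)/2} because
    -- log 2 > 1/2; this is the origin of the factor e.
    have h2 : ((k : ℝ) ^ s.re)⁻¹ ≤ ((k : ℝ) ^ 2)⁻¹ * (Real.exp 1 * Real.exp (-(s.re / 2))) := by
      have e1 : ((k : ℝ) ^ s.re)⁻¹ = ((k : ℝ) ^ 2)⁻¹ * (k : ℝ) ^ (-(s.re - 2)) := by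
        rw [← Real.rpow_neg hk0.le, ← Real.rpow_natCast, ← Real.rpow_neg hk0.le,
          ← Real.rpow_add hk0]
        congr 1
        push_cast
        ring
      rw [e1]
      gcongr
      calc (k : ℝ) ^ (-(s.re - 2)) ≤ (2 : ℝ) ^ (-(s.re - 2)) :=
            Real.rpow_le_rpow_of_nonpos (by norm_num) hk2R (by linarith)
        _ ≤ Real.exp (-((s.re - 2) / 2)) := two_rpow_neg_le_exp (by linarith)
        _ = _ := by rw [← Real.exp_add]; ring_nf
    calc _ ≤ 1 * ((k : ℝ) ^ s.re)⁻¹ := by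
          rw [div_eq_mul_inv]
          gcongr
      _ ≤ _ := by rw [one_mul]; exact h2
  refine (tsum_of_norm_bounded (hsum.mul_right _).hasSum hb).trans (le_of_eq ?_)
  rw [tsum_mul_right]
  ring

/-! ### Behaviour of the logarithm near the critical line -/

lemma exists_Z_eq_pow_mul (s₀ : ℂ) : ∃ (k : ℕ) (h : ℂ → ℂ), AnalyticAt ℂ h s₀ ∧ h s₀ ≠ 0 ∧
    ∀ᶠ z in 𝓝 s₀, Z z = (z - s₀) ^ k * h z := by
  have hA : AnalyticOnNhd ℂ Z Set.univ :=
    differentiable_Z.differentiableOn.analyticOnNhd isOpen_univ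
  have hne : ¬ ∀ᶠ z in 𝓝 s₀, Z z = 0 := fun h => by
    have := hA.eqOn_zero_of_preconnected_of_eventuallyEq_zero isPreconnected_univ
      (Set.mem_univ s₀) h (Set.mem_univ 1)
    rw [Z_one] at this
    exact one_ne_zero this
  simpa only [smul_eq_mul] using
    (hA s₀ (Set.mem_univ _)).exists_eventuallyEq_pow_smul_nonzero_iff.mpr hne

lemma div_mem_slitPlane_of_norm_lt {a b : ℂ} (h : ‖a / b - 1‖ < 1) :
    a / b ∈ Complex.slitPlane := by
  have := Complex.mem_slitPlane_of_norm_lt_one h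
  rwa [add_sub_cancel] at this

/-- Write Z = (z - s₀)^k h with h(s₀) ≠ 0. For Re z > 1/2, z - s₀ lies in the right half-plane, so M
equals k log(z - s₀) + log h up to a constant. Thus Im M stays bounded even at a zero, and Re M is
at most logarithmic. As |z - s₀| ≥ Re z - 1/2, the bound depends on Re z alone and is uniform in
height. -/
lemma exists_local_bound_of_re_eq (hM : IsLogZ M) {s₀ : ℂ} (hs₀ : s₀.re = 1 / 2) :
    ∃ r > 0, ∃ K : ℝ, ∀ z ∈ Metric.ball s₀ r, 1 / 2 < z.re →
      |(M z).im| ≤ K ∧ |(M z).re| ≤ K * (1 + |Real.log (z.re - 1 / 2)|) := by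
  obtain ⟨k, h, hh, hh0, heq⟩ := exists_Z_eq_pow_mul s₀
  have hcont : ∀ᶠ z in 𝓝 s₀, ContinuousAt h z := hh.eventually_continuousAt
  have hnear : ∀ᶠ z in 𝓝 s₀, ‖h z / h s₀ - 1‖ < 1 / 2 := by
    have : ContinuousAt (fun z => ‖h z / h s₀ - 1‖) s₀ :=
      ((hh.continuousAt.div_const _).sub_const _).norm
    refine this.eventually_lt continuousAt_const ?_
    rw [div_self hh0, sub_self, norm_zero]
    norm_num
  obtain ⟨r, hr, hball⟩ := Metric.eventually_nhds_iff_ball.mp (heq.and (hcont.and hnear))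
  -- A radius at most 1 makes both logarithms in the comparison nonpositive.
  set ρ := min r 1 with hρ
  have hρ0 : 0 < ρ := lt_min hr one_pos
  set B := Metric.ball s₀ ρ ∩ {z : ℂ | 1 / 2 < z.re} with hB
  have hBsub : ∀ z ∈ B, z ∈ Metric.ball s₀ r := fun z hz =>
    Metric.ball_subset_ball (min_le_left _ _) hz.1
  have hBconn : IsPreconnected B :=
    ((convex_ball s₀ ρ).inter (convex_halfSpace_re_gt _)).isPreconnected
  -- Normalising by h(s₀) keeps the argument of the logarithm near 1, away from the branch cut.
  set q : ℂ → ℂ := fun z => k * Complex.log (z - s₀) + (Complex.log (h z / h s₀) +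
    Complex.log (h s₀)) with hq
  have hslit : ∀ z ∈ B, z - s₀ ∈ Complex.slitPlane := fun z hz => by
    rw [Complex.mem_slitPlane_iff]
    left
    have := Set.mem_ofPred.mp hz.2
    rw [Complex.sub_re, hs₀]
    linarith
  have hslit2 : ∀ z ∈ B, h z / h s₀ ∈ Complex.slitPlane := fun z hz =>
    div_mem_slitPlane_of_norm_lt (((hball z (hBsub z hz)).2.2).trans (by norm_num))
  have hqcont : ContinuousOn q B := fun z hz => by
    have h1 : ContinuousAt (fun z => Complex.log (z - s₀)) z :=
      (continuousAt_id.sub continuousAt_const).clog (hslit z hz)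
    have h2 : ContinuousAt (fun z => Complex.log (h z / h s₀)) z :=
      ((hball z (hBsub z hz)).2.1.div_const _).clog (hslit2 z hz)
    exact ((continuousAt_const.mul h1).add (h2.add continuousAt_const)).continuousWithinAt
  have hMcont : ContinuousOn M B := hM.differentiableOn.continuousOn.mono Set.inter_subset_right
  have hne : ∀ z ∈ B, h z ≠ 0 := fun z hz h0 => by
    have := (hball z (hBsub z hz)).2.2
    rw [h0, zero_div, zero_sub, norm_neg, norm_one] at this
    norm_num at this
  have hexp : ∀ z ∈ B, Complex.exp (M z) = Complex.exp (q z) := fun z hz => by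
    rw [hM.exp_eq z hz.2, (hball z (hBsub z hz)).1, hq, Complex.exp_add, Complex.exp_add,
      Complex.exp_nat_mul, Complex.exp_log (Complex.slitPlane_ne_zero (hslit z hz)),
      Complex.exp_log (Complex.slitPlane_ne_zero (hslit2 z hz)), Complex.exp_log hh0]
    field_simp
  set z₁ : ℂ := s₀ + (ρ / 2 : ℝ) with hz₁
  have hz₁B : z₁ ∈ B := by
    refine ⟨?_, ?_⟩
    · rw [Metric.mem_ball, hz₁, dist_eq_norm, add_sub_cancel_left, Complex.norm_real,
        Real.norm_of_nonneg (by positivity)]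
      linarith
    · simp only [hz₁, Set.mem_ofPred_eq, Complex.add_re, Complex.ofReal_re, hs₀]
      linarith
  have hlogh0 : 0 ≤ |Real.log ‖h s₀‖| := abs_nonneg _
  refine ⟨ρ, hρ0, k * Real.pi + 2 * Real.pi + |(M z₁ - q z₁).im| + (k + 1 + |Real.log ‖h s₀‖|),
    fun z hz hzre => ?_⟩
  have hzB : z ∈ B := ⟨hz, hzre⟩
  have hdiff := sub_eq_sub_of_exp_eq_exp hBconn hMcont hqcont hexp hzB hz₁B
  have hk0 : (0 : ℝ) ≤ k := k.cast_nonneg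
  have hpi := Real.pi_pos
  constructor
  · have him : (M z).im = (q z).im + (M z₁ - q z₁).im := by
      rw [← hdiff, Complex.sub_im]
      ring
    have hqim : |(q z).im| ≤ k * Real.pi + 2 * Real.pi := by
      have e : (q z).im = k * (z - s₀).arg + ((h z / h s₀).arg + (h s₀).arg) := by
        simp [hq, Complex.log_im]
      rw [e]
      have a1 := Complex.abs_arg_le_pi (z - s₀)
      have a2 := Complex.abs_arg_le_pi (h z / h s₀)
      have a3 := Complex.abs_arg_le_pi (h s₀)
      have a4 : |k * (z - s₀).arg| ≤ k * Real.pi := by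
        rw [abs_mul, abs_of_nonneg hk0]
        gcongr
      calc _ ≤ |k * (z - s₀).arg| + (|(h z / h s₀).arg| + |(h s₀).arg|) :=
            (abs_add_le _ _).trans (add_le_add_right (abs_add_le _ _) _)
        _ ≤ _ := by linarith
    rw [him]
    refine (abs_add_le _ _).trans ?_
    linarith
  · have hsub0 : z - s₀ ≠ 0 := Complex.slitPlane_ne_zero (hslit z hzB)
    have hre : (M z).re = k * Real.log ‖z - s₀‖ + (Real.log ‖h z / h s₀‖ + Real.log ‖h s₀‖) := by
      rw [M_re hM hzre, (hball z (hBsub z hzB)).1, norm_mul, norm_pow,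
        Real.log_mul (by positivity) (norm_ne_zero_iff.mpr (hne z hzB)), Real.log_pow, norm_div,
        Real.log_div (norm_ne_zero_iff.mpr (hne z hzB)) (norm_ne_zero_iff.mpr hh0)]
      ring
    have hd1 : z.re - 1 / 2 ≤ ‖z - s₀‖ := by
      have := Complex.re_le_norm (z - s₀)
      rwa [Complex.sub_re, hs₀] at this
    have hd2 : ‖z - s₀‖ ≤ 1 := by
      rw [← dist_eq_norm]
      exact (Metric.mem_ball.mp hz).le.trans (min_le_right _ _)
    have hl1 : |Real.log ‖z - s₀‖| ≤ |Real.log (z.re - 1 / 2)| := by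
      rw [abs_of_nonpos (Real.log_nonpos (norm_nonneg _) hd2),
        abs_of_nonpos (Real.log_nonpos (by linarith) (by linarith))]
      exact neg_le_neg (Real.log_le_log (by linarith) hd1)
    have hl2 : |Real.log ‖h z / h s₀‖| ≤ 1 := by
      have hn := (hball z (hBsub z hzB)).2.2
      set w := h z / h s₀
      have h1 : ‖w‖ ≤ 3 / 2 := by
        calc ‖w‖ = ‖(w - 1) + 1‖ := by ring_nf
          _ ≤ ‖w - 1‖ + 1 := (norm_add_le _ _).trans (by simp)
          _ ≤ _ := by linarith
      have h2 : 1 / 2 ≤ ‖w‖ := by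
        have : (1 : ℝ) ≤ ‖w - 1‖ + ‖w‖ := by
          calc (1 : ℝ) = ‖(1 : ℂ)‖ := by simp
            _ = ‖w - (w - 1)‖ := by ring_nf
            _ ≤ _ := (norm_sub_le _ _).trans (by linarith)
        linarith
      rw [abs_le]
      constructor
      · have := Real.log_le_log (by norm_num) h2
        rw [one_div, Real.log_inv] at this
        linarith [Real.log_two_lt_d9]
      · have := Real.log_le_sub_one_of_pos (by linarith : 0 < ‖w‖)
        linarith
    rw [hre]
    set a := |Real.log (z.re - 1 / 2)|
    have ha : 0 ≤ a := abs_nonneg _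
    have h3 : |k * Real.log ‖z - s₀‖| ≤ k * a := by
      rw [abs_mul, abs_of_nonneg hk0]
      gcongr
    have hP : 0 ≤ k * Real.pi + 2 * Real.pi + |(M z₁ - q z₁).im| := by positivity
    calc _ ≤ |k * Real.log ‖z - s₀‖| + (|Real.log ‖h z / h s₀‖| + |Real.log ‖h s₀‖|) :=
          (abs_add_le _ _).trans (add_le_add_right (abs_add_le _ _) _)
      _ ≤ k * a + (1 + |Real.log ‖h s₀‖|) := by gcongr
      _ ≤ (k + 1 + |Real.log ‖h s₀‖|) * (1 + a) := by nlinarith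
      _ ≤ _ := mul_le_mul_of_nonneg_right (by linarith) (by linarith)

lemma exists_local_bound (hM : IsLogZ M) {s₀ : ℂ} (hs₀ : 1 / 2 ≤ s₀.re) :
    ∃ r > 0, ∃ K : ℝ, ∀ z ∈ Metric.ball s₀ r, 1 / 2 < z.re →
      |(M z).im| ≤ K ∧ |(M z).re| ≤ K * (1 + |Real.log (z.re - 1 / 2)|) := by
  rcases hs₀.eq_or_lt with h | h
  · exact exists_local_bound_of_re_eq hM h.symm
  · have hc : ContinuousAt (fun z => ‖M z‖) s₀ := (differentiableAt_M hM h).continuousAt.norm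
    have := hc.eventually_lt continuousAt_const (lt_add_one ‖M s₀‖)
    obtain ⟨r, hr, hball⟩ := Metric.eventually_nhds_iff_ball.mp this
    refine ⟨r, hr, ‖M s₀‖ + 1, fun z hz _ => ⟨?_, ?_⟩⟩
    · exact (Complex.abs_im_le_norm _).trans (hball z hz).le
    · refine (Complex.abs_re_le_norm _).trans ((hball z hz).le.trans ?_)
      have := abs_nonneg (Real.log (z.re - 1 / 2))
      nlinarith [norm_nonneg (M s₀)]

/-- Bounds for the logarithm on a rectangle touching the critical line. -/
lemma exists_bound_on_rect (hM : IsLogZ M) (T : ℝ) :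
    ∃ K : ℝ, 0 ≤ K ∧ ∀ z : ℂ, 1 / 2 < z.re → z.re ≤ 2 → 0 ≤ z.im → z.im ≤ T →
      |(M z).im| ≤ K ∧ |(M z).re| ≤ K * (1 + |Real.log (z.re - 1 / 2)|) := by
  have hcpt : IsCompact (Set.Icc (1 / 2 : ℝ) 2 ×ℂ Set.Icc 0 T) := isCompact_Icc.reProdIm isCompact_Icc
  have key : ∃ K : ℝ, ∀ z ∈ Set.Icc (1 / 2 : ℝ) 2 ×ℂ Set.Icc 0 T, 1 / 2 < z.re →
      |(M z).im| ≤ K ∧ |(M z).re| ≤ K * (1 + |Real.log (z.re - 1 / 2)|) := by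
    refine hcpt.induction_on (p := fun S => ∃ K : ℝ, ∀ z ∈ S, 1 / 2 < z.re →
      |(M z).im| ≤ K ∧ |(M z).re| ≤ K * (1 + |Real.log (z.re - 1 / 2)|)) ?_ ?_ ?_ ?_
    · exact ⟨0, fun z hz => absurd hz (Set.notMem_empty z)⟩
    · rintro S S' hSS' ⟨K, hK⟩
      exact ⟨K, fun z hz => hK z (hSS' hz)⟩
    · rintro S S' ⟨K, hK⟩ ⟨K', hK'⟩
      refine ⟨max K K', fun z hz hz2 => ?_⟩
      have ha := abs_nonneg (Real.log (z.re - 1 / 2))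
      rcases hz with hz | hz
      · refine ⟨(hK z hz hz2).1.trans (le_max_left _ _), (hK z hz hz2).2.trans ?_⟩
        gcongr
        exact le_max_left _ _
      · refine ⟨(hK' z hz hz2).1.trans (le_max_right _ _), (hK' z hz hz2).2.trans ?_⟩
        gcongr
        exact le_max_right _ _
    · intro s hs
      obtain ⟨r, hr, K, hK⟩ := exists_local_bound hM (s₀ := s) hs.1.1
      exact ⟨Metric.ball s r, mem_nhdsWithin_of_mem_nhds (Metric.ball_mem_nhds s hr), K, hK⟩
  obtain ⟨K, hK⟩ := key
  refine ⟨|K|, abs_nonneg K, fun z h1 h2 h3 h4 => ?_⟩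
  obtain ⟨ha, hb⟩ := hK z ⟨⟨h1.le, h2⟩, h3, h4⟩ h1
  refine ⟨ha.trans (le_abs_self K), hb.trans ?_⟩
  have := abs_nonneg (Real.log (z.re - 1 / 2))
  gcongr
  exact le_abs_self K

/-- At a point of the critical line that is not a zero, the logarithm has a limit from the right. -/
lemma exists_tendsto_M (hM : IsLogZ M) {s₀ : ℂ} (hs₀ : s₀.re = 1 / 2) (hZ : Z s₀ ≠ 0) :
    ∃ ℓ : ℂ, Tendsto M (𝓝[{z | 1 / 2 < z.re}] s₀) (𝓝 ℓ) := by
  have hnear : ∀ᶠ z in 𝓝 s₀, ‖Z z / Z s₀ - 1‖ < 1 := by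
    have : ContinuousAt (fun z => ‖Z z / Z s₀ - 1‖) s₀ :=
      (((differentiable_Z s₀).continuousAt.div_const _).sub_const _).norm
    refine this.eventually_lt continuousAt_const ?_
    rw [div_self hZ, sub_self, norm_zero]
    norm_num
  obtain ⟨r, hr, hball⟩ := Metric.eventually_nhds_iff_ball.mp hnear
  set B := Metric.ball s₀ r ∩ {z : ℂ | 1 / 2 < z.re} with hB
  have hBconn : IsPreconnected B :=
    ((convex_ball s₀ r).inter (convex_halfSpace_re_gt _)).isPreconnected
  set q : ℂ → ℂ := fun z => Complex.log (Z z / Z s₀) + Complex.log (Z s₀) with hq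
  have hqc : ∀ z ∈ Metric.ball s₀ r, ContinuousAt q z := fun z hz =>
    (((differentiable_Z z).continuousAt.div_const _).clog
      (div_mem_slitPlane_of_norm_lt (hball z hz))).add continuousAt_const
  have hMcont : ContinuousOn M B := hM.differentiableOn.continuousOn.mono Set.inter_subset_right
  have hexp : ∀ z ∈ B, Complex.exp (M z) = Complex.exp (q z) := fun z hz => by
    rw [hM.exp_eq z hz.2, hq, Complex.exp_add, Complex.exp_log (Complex.slitPlane_ne_zero
      (div_mem_slitPlane_of_norm_lt (hball z hz.1))), Complex.exp_log hZ]
    field_simp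
  set z₁ : ℂ := s₀ + (r / 2 : ℝ) with hz₁
  have hz₁B : z₁ ∈ B := by
    refine ⟨?_, ?_⟩
    · rw [Metric.mem_ball, hz₁, dist_eq_norm, add_sub_cancel_left, Complex.norm_real,
        Real.norm_of_nonneg (by positivity)]
      linarith
    · simp only [hz₁, Set.mem_ofPred_eq, Complex.add_re, Complex.ofReal_re, hs₀]
      linarith
  refine ⟨q s₀ + (M z₁ - q z₁), ?_⟩
  have hlim : Tendsto (fun z => q z + (M z₁ - q z₁)) (𝓝[{z | 1 / 2 < z.re}] s₀)
      (𝓝 (q s₀ + (M z₁ - q z₁))) :=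
    ((hqc s₀ (Metric.mem_ball_self hr)).tendsto.mono_left nhdsWithin_le_nhds).add_const _
  refine hlim.congr' ?_
  filter_upwards [self_mem_nhdsWithin,
    mem_nhdsWithin_of_mem_nhds (Metric.ball_mem_nhds s₀ hr)] with z hz1 hz2
  rw [← sub_eq_sub_of_exp_eq_exp hBconn hMcont (fun z hz => (hqc z hz.1).continuousWithinAt) hexp
    ⟨hz2, hz1⟩ hz₁B]
  ring

/-! ### Iterated horizontal integration -/

/-- Integration along the horizontal half-line to the right of `s`. -/
def horInt (Φ : ℂ → ℂ) (s : ℂ) : ℂ := ∫ v in Set.Ioi s.re, Φ (v + s.im * Complex.I)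

/-- Functions on the upper right quadrant at `1/2` that can be integrated along horizontal lines,
locally uniformly in the ordinate. -/
structure HorAdmissible (Φ : ℂ → ℂ) : Prop where
  continuousOn : ContinuousOn Φ {s | 1 / 2 < s.re ∧ 0 ≤ s.im ∧ s ≠ 1}
  differentiableOn : DifferentiableOn ℂ Φ {s | 1 / 2 < s.re ∧ 0 < s.im}
  dominated : ∀ T : ℝ, ∃ W : ℝ → ℝ, IntegrableOn W (Set.Ioi (1 / 2)) ∧
    ∀ v : ℝ, 1 / 2 < v → v ≠ 1 → ∀ t : ℝ, 0 ≤ t → t ≤ T → ‖Φ (v + t * Complex.I)‖ ≤ W v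
  decay : ∀ T : ℝ, ∃ K : ℝ, 0 ≤ K ∧ ∀ v : ℝ, 2 ≤ v → ∀ t : ℝ, 0 ≤ t → t ≤ T →
    ‖Φ (v + t * Complex.I)‖ ≤ K * Real.exp (-(v / 2))

lemma re_add_mul_I (v t : ℝ) : ((v : ℂ) + t * Complex.I).re = v := by simp

lemma im_add_mul_I (v t : ℝ) : ((v : ℂ) + t * Complex.I).im = t := by simp

lemma add_mul_I_ne_one {v t : ℝ} (hv : v ≠ 1) : (v : ℂ) + t * Complex.I ≠ 1 := fun h => by
  have := congrArg Complex.re h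
  rw [re_add_mul_I, Complex.one_re] at this
  exact hv this

lemma isOpen_quadrant : IsOpen {s : ℂ | 1 / 2 < s.re ∧ 0 < s.im} :=
  isOpen_half.inter (isOpen_lt continuous_const Complex.continuous_im)

lemma convex_quadrant : Convex ℝ {s : ℂ | 1 / 2 < s.re ∧ 0 < s.im} :=
  (convex_halfSpace_re_gt _).inter (convex_halfSpace_im_gt _)

lemma diff_one_ae_eq : (Set.Ioi (1 / 2 : ℝ) \ {1} : Set ℝ) =ᵐ[volume] Set.Ioi (1 / 2 : ℝ) :=
  sdiff_null_ae_eq_self (measure_singleton 1)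

lemma integrableOn_Ioi_exp_neg_half (a : ℝ) :
    IntegrableOn (fun v : ℝ => Real.exp (-(v / 2))) (Set.Ioi a) := by
  have := integrableOn_exp_mul_Ioi (a := -(1 / 2)) (by norm_num) a
  refine this.congr_fun (fun v _ => ?_) measurableSet_Ioi
  simp only
  ring_nf

lemma integral_Ioi_exp_neg_half (a : ℝ) :
    ∫ v in Set.Ioi a, Real.exp (-(v / 2)) = 2 * Real.exp (-(a / 2)) := by
  have := integral_exp_mul_Ioi (a := -(1 / 2)) (by norm_num) a
  rw [show (fun v : ℝ => Real.exp (-(v / 2))) = fun v => Real.exp (-(1 / 2) * v) by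
    ext v; ring_nf, this]
  ring_nf

namespace HorAdmissible

variable {Φ : ℂ → ℂ}

lemma integrableOn (h : HorAdmissible Φ) {t : ℝ} (ht : 0 ≤ t) :
    IntegrableOn (fun v : ℝ => Φ (v + t * Complex.I)) (Set.Ioi (1 / 2)) := by
  obtain ⟨W, hW, hb⟩ := h.dominated t
  rw [← integrableOn_congr_set_ae diff_one_ae_eq] at hW ⊢
  have hms : MeasurableSet (Set.Ioi (1 / 2 : ℝ) \ {1}) :=
    measurableSet_Ioi.diff (measurableSet_singleton 1)
  refine Integrable.mono' hW (ContinuousOn.aestronglyMeasurable ?_ hms) ?_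
  · refine h.continuousOn.comp (by fun_prop) fun v hv => ?_
    refine ⟨?_, ?_, add_mul_I_ne_one hv.2⟩
    · rw [re_add_mul_I]; exact hv.1
    · rw [im_add_mul_I]; exact ht
  · filter_upwards [ae_restrict_mem hms] with v hv
    exact hb v hv.1 hv.2 t ht le_rfl

/-- Decay e^{-v/2} is reproduced by integration. For v < 2 the full integral of the majorant is
used, with e · e^{-v/2} ≥ 1. So admissibility passes from Φ to its horizontal integral. -/
lemma norm_horInt_le (h : HorAdmissible Φ) (T : ℝ) :
    ∃ K : ℝ, 0 ≤ K ∧ ∀ v : ℝ, 1 / 2 ≤ v → ∀ t : ℝ, 0 ≤ t → t ≤ T →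
      ‖horInt Φ (v + t * Complex.I)‖ ≤ K * Real.exp (-(v / 2)) := by
  obtain ⟨W, hW, hb⟩ := h.dominated T
  obtain ⟨K, hK0, hK⟩ := h.decay T
  set I := ∫ v in Set.Ioi (1 / 2 : ℝ), ‖W v‖ with hI
  have hI0 : 0 ≤ I := integral_nonneg fun v => norm_nonneg _
  refine ⟨2 * K + I * Real.exp 1, by positivity, fun v hv t ht0 htT => ?_⟩
  unfold horInt
  rw [re_add_mul_I, im_add_mul_I]
  rcases le_or_gt 2 v with hv2 | hv2
  · have : ‖∫ u in Set.Ioi v, Φ (u + t * Complex.I)‖ ≤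
        ∫ u in Set.Ioi v, K * Real.exp (-(u / 2)) := by
      refine norm_integral_le_of_norm_le ((integrableOn_Ioi_exp_neg_half v).const_mul K) ?_
      filter_upwards [ae_restrict_mem measurableSet_Ioi] with u hu
      exact hK u (hv2.trans (le_of_lt hu)) t ht0 htT
    rw [integral_const_mul, integral_Ioi_exp_neg_half] at this
    refine this.trans ?_
    have h1 := Real.exp_pos (-(v / 2))
    have h2 := Real.exp_pos 1
    nlinarith [mul_nonneg (mul_nonneg hI0 h2.le) h1.le]
  · have h1 : ‖∫ u in Set.Ioi v, Φ (u + t * Complex.I)‖ ≤ ∫ u in Set.Ioi v, ‖W u‖ := by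
      refine norm_integral_le_of_norm_le ((hW.mono_set (Set.Ioi_subset_Ioi hv)).norm) ?_
      have hne : ∀ᵐ u ∂(volume.restrict (Set.Ioi v)), u ≠ 1 :=
        ae_restrict_of_ae (Measure.ae_ne volume 1)
      filter_upwards [ae_restrict_mem measurableSet_Ioi, hne] with u hu hu1
      exact (hb u (lt_of_le_of_lt hv hu) hu1 t ht0 htT).trans (le_abs_self _)
    have h2 : ∫ u in Set.Ioi v, ‖W u‖ ≤ I :=
      setIntegral_mono_set hW.norm (ae_of_all _ fun u => norm_nonneg _)
        (Set.Ioi_subset_Ioi hv).eventuallyLE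
    have h3 : 1 ≤ Real.exp 1 * Real.exp (-(v / 2)) := by
      rw [← Real.exp_add]
      exact Real.one_le_exp (by linarith)
    have h4 := Real.exp_pos (-(v / 2))
    calc _ ≤ I * 1 := by linarith
      _ ≤ I * (Real.exp 1 * Real.exp (-(v / 2))) := by gcongr
      _ ≤ _ := by nlinarith [mul_nonneg hK0 h4.le]

/-- A domain of integration independent of s, as dominated convergence requires. -/
lemma horInt_eq_indicator (Φ : ℂ → ℂ) {s : ℂ} (hs : 1 / 2 ≤ s.re) :
    horInt Φ s = ∫ v in Set.Ioi (1 / 2 : ℝ),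
      Set.indicator (Set.Ioi s.re) (fun v : ℝ => Φ (v + s.im * Complex.I)) v := by
  rw [setIntegral_indicator measurableSet_Ioi, Set.inter_eq_right.mpr (Set.Ioi_subset_Ioi hs)]
  rfl

/-- Dominated convergence; the integrand may jump only at v = Re s₀ or misbehave at v = 1, a null
set. The region includes the critical line: one integration already removes the singularities at the
zeros. -/
lemma continuousOn_horInt (h : HorAdmissible Φ) :
    ContinuousOn (horInt Φ) {s | 1 / 2 ≤ s.re ∧ 0 ≤ s.im} := by
  intro s₀ hs₀
  obtain ⟨W, hW, hb⟩ := h.dominated (s₀.im + 1)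
  have hcongr : ContinuousWithinAt (fun s : ℂ => ∫ v in Set.Ioi (1 / 2 : ℝ),
      Set.indicator (Set.Ioi s.re) (fun v : ℝ => Φ (v + s.im * Complex.I)) v)
      {s | 1 / 2 ≤ s.re ∧ 0 ≤ s.im} s₀ := by
    have hnear : ∀ᶠ s : ℂ in 𝓝[{s | 1 / 2 ≤ s.re ∧ 0 ≤ s.im}] s₀, s.im ≤ s₀.im + 1 := by
      refine nhdsWithin_le_nhds ?_
      exact (Complex.continuous_im.continuousAt.eventually_lt continuousAt_const
        (lt_add_one s₀.im)).mono fun s hs => hs.le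
    refine continuousWithinAt_of_dominated (bound := fun v => ‖W v‖) ?_ ?_ hW.norm ?_
    · filter_upwards [self_mem_nhdsWithin] with s hs
      exact ((h.integrableOn hs.2).aestronglyMeasurable).indicator measurableSet_Ioi
    · filter_upwards [self_mem_nhdsWithin, hnear] with s hs hsT
      have hne : ∀ᵐ u ∂(volume.restrict (Set.Ioi (1 / 2 : ℝ))), u ≠ 1 :=
        ae_restrict_of_ae (Measure.ae_ne volume 1)
      filter_upwards [ae_restrict_mem measurableSet_Ioi, hne] with v hv hv1
      refine (norm_indicator_le_norm_self _ _).trans ?_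
      exact (hb v hv hv1 s.im hs.2 hsT).trans (le_abs_self _)
    · have hne : ∀ᵐ u ∂(volume.restrict (Set.Ioi (1 / 2 : ℝ))), u ≠ 1 :=
        ae_restrict_of_ae (Measure.ae_ne volume 1)
      have hne2 : ∀ᵐ u ∂(volume.restrict (Set.Ioi (1 / 2 : ℝ))), u ≠ s₀.re :=
        ae_restrict_of_ae (Measure.ae_ne volume s₀.re)
      filter_upwards [ae_restrict_mem measurableSet_Ioi, hne, hne2] with v hv hv1 hv2
      rcases lt_or_gt_of_ne hv2 with hlt | hgt
      · have hev : ∀ᶠ s : ℂ in 𝓝[{s | 1 / 2 ≤ s.re ∧ 0 ≤ s.im}] s₀, v < s.re :=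
          nhdsWithin_le_nhds
            (continuousAt_const.eventually_lt Complex.continuous_re.continuousAt hlt)
        refine (continuousWithinAt_const (b := (0 : ℂ))).congr_of_eventuallyEq ?_ ?_
        · filter_upwards [hev] with s hs
          exact Set.indicator_of_notMem (by simpa using hs.le) _
        · exact Set.indicator_of_notMem (by simpa using hlt.le) _
      · have hev : ∀ᶠ s : ℂ in 𝓝[{s | 1 / 2 ≤ s.re ∧ 0 ≤ s.im}] s₀, s.re < v :=
          nhdsWithin_le_nhds
            (Complex.continuous_re.continuousAt.eventually_lt continuousAt_const hgt)
        have hc : ContinuousWithinAt (fun s : ℂ => Φ (v + s.im * Complex.I))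
            {s | 1 / 2 ≤ s.re ∧ 0 ≤ s.im} s₀ := by
          refine ContinuousWithinAt.comp (t := {s | 1 / 2 < s.re ∧ 0 ≤ s.im ∧ s ≠ 1})
            (f := fun s : ℂ => (v : ℂ) + s.im * Complex.I) ?_ (by fun_prop) fun s hs => ?_
          · refine h.continuousOn _ ⟨?_, ?_, add_mul_I_ne_one hv1⟩
            · rw [re_add_mul_I]; exact hv
            · rw [im_add_mul_I]; exact hs₀.2
          · refine ⟨?_, ?_, add_mul_I_ne_one hv1⟩
            · rw [re_add_mul_I]; exact hv
            · rw [im_add_mul_I]; exact hs.2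
        refine hc.congr_of_eventuallyEq ?_ ?_
        · filter_upwards [hev] with s hs
          exact Set.indicator_of_mem (by simpa using hs) _
        · exact Set.indicator_of_mem (by simpa using hgt) _
  exact hcongr.congr (fun s hs => horInt_eq_indicator Φ hs.1) (horInt_eq_indicator Φ hs₀.1)

/-- If P is a primitive of Φ on the convex quadrant, `horInt Φ` + P at z is the limit of P far to
the right at the same height. Since P' = Φ decays, the limits at two heights agree, so the sum is
constant. -/
lemma hasDerivAt_horInt (h : HorAdmissible Φ) {s : ℂ} (hs : 1 / 2 < s.re) (hs' : 0 < s.im) :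
    HasDerivAt (horInt Φ) (-Φ s) s := by
  obtain ⟨P, hP⟩ := convex_quadrant.exists_forall_hasDerivWithinAt h.differentiableOn
  have hP' : ∀ z : ℂ, 1 / 2 < z.re → 0 < z.im → HasDerivAt P (Φ z) z := fun z h1 h2 =>
    (hP z ⟨h1, h2⟩).hasDerivAt (isOpen_quadrant.mem_nhds ⟨h1, h2⟩)
  have hlim : ∀ z : ℂ, 1 / 2 < z.re → 0 < z.im →
      Tendsto (fun V : ℝ => P (V + z.im * Complex.I)) atTop (𝓝 (horInt Φ z + P z)) := by
    intro z h1 h2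
    have hint : IntegrableOn (fun v : ℝ => Φ (v + z.im * Complex.I)) (Set.Ioi z.re) :=
      (h.integrableOn h2.le).mono_set (Set.Ioi_subset_Ioi h1.le)
    have ht := intervalIntegral_tendsto_integral_Ioi z.re hint tendsto_id
    refine (ht.add_const (P z)).congr' ?_
    filter_upwards [eventually_ge_atTop z.re] with V hV
    have hder : ∀ v ∈ Set.uIcc z.re V,
        HasDerivAt (fun v : ℝ => P (v + z.im * Complex.I)) (Φ (v + z.im * Complex.I)) v := by
      intro v hv
      rw [Set.uIcc_of_le hV] at hv
      have hd := hP' (v + z.im * Complex.I) (by rw [re_add_mul_I]; exact h1.trans_le hv.1)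
        (by rw [im_add_mul_I]; exact h2)
      have hin : HasDerivAt (fun w : ℂ => w + z.im * Complex.I) 1 (v : ℂ) :=
        (hasDerivAt_id _).add_const _
      simpa using (hd.comp (v : ℂ) hin).comp_ofReal
    rw [id, intervalIntegral.integral_eq_sub_of_hasDerivAt hder, Complex.re_add_im,
      sub_add_cancel]
    rw [intervalIntegrable_iff_integrableOn_Ioc_of_le hV]
    exact hint.mono_set Set.Ioc_subset_Ioi_self
  have hconst : ∀ z : ℂ, 1 / 2 < z.re → 0 < z.im → horInt Φ z + P z = horInt Φ s + P s := by
    intro z h1 h2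
    obtain ⟨K, hK0, hK⟩ := h.decay (max z.im s.im)
    have hdiff := (hlim z h1 h2).sub (hlim s hs hs')
    have hzero : Tendsto (fun V : ℝ => P (V + z.im * Complex.I) - P (V + s.im * Complex.I)) atTop
        (𝓝 0) := by
      have hexp : Tendsto (fun V : ℝ => K * Real.exp (-(V / 2)) *
          ‖((z.im - s.im : ℝ) : ℂ) * Complex.I‖) atTop (𝓝 0) := by
        have : Tendsto (fun V : ℝ => Real.exp (-(V / 2))) atTop (𝓝 0) :=
          Real.tendsto_exp_neg_atTop_nhds_zero.comp (tendsto_id.atTop_div_const (by norm_num))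
        simpa using (this.const_mul K).mul_const ‖((z.im - s.im : ℝ) : ℂ) * Complex.I‖
      refine squeeze_zero_norm' ?_ hexp
      filter_upwards [eventually_ge_atTop 2] with V hV
      have hconv : Convex ℝ {w : ℂ | V ≤ w.re ∧ 0 < w.im ∧ w.im ≤ max z.im s.im} :=
        (convex_halfSpace_re_ge _).inter
          ((convex_halfSpace_im_gt _).inter (convex_halfSpace_im_le _))
      have := hconv.norm_image_sub_le_of_norm_hasDerivWithin_le (f := P) (f' := Φ)
        (C := K * Real.exp (-(V / 2))) (x := V + s.im * Complex.I) (y := V + z.im * Complex.I)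
        (fun w hw => (hP' w (by linarith [hw.1]) hw.2.1).hasDerivWithinAt)
        (fun w hw => by
          have := hK w.re (hV.trans hw.1) w.im hw.2.1.le hw.2.2
          rw [Complex.re_add_im] at this
          refine this.trans ?_
          gcongr
          exact hw.1)
        (by
          simp only [Set.mem_ofPred_eq, re_add_mul_I, im_add_mul_I]
          exact ⟨le_rfl, hs', le_max_right _ _⟩)
        (by
          simp only [Set.mem_ofPred_eq, re_add_mul_I, im_add_mul_I]
          exact ⟨le_rfl, h2, le_max_left _ _⟩)
      rwa [show (V + z.im * Complex.I : ℂ) - (V + s.im * Complex.I) =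
        ((z.im - s.im : ℝ) : ℂ) * Complex.I by push_cast; ring] at this
    exact sub_eq_zero.mp (tendsto_nhds_unique hdiff hzero)
  have hd := (hP' s hs hs').const_sub (horInt Φ s + P s)
  refine hd.congr_of_eventuallyEq ?_
  filter_upwards [isOpen_quadrant.mem_nhds ⟨hs, hs'⟩] with z hz
  rw [← hconst z hz.1 hz.2]
  ring

lemma horInt (h : HorAdmissible Φ) : HorAdmissible (horInt Φ) where
  continuousOn := h.continuousOn_horInt.mono fun s hs => ⟨hs.1.le, hs.2.1⟩
  differentiableOn := fun s hs =>
    (h.hasDerivAt_horInt hs.1 hs.2).differentiableAt.differentiableWithinAt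
  dominated := fun T => by
    obtain ⟨K, hK0, hK⟩ := h.norm_horInt_le T
    exact ⟨fun v => K * Real.exp (-(v / 2)), (integrableOn_Ioi_exp_neg_half _).const_mul K,
      fun v hv _ t ht0 htT => hK v hv.le t ht0 htT⟩
  decay := fun T => by
    obtain ⟨K, hK0, hK⟩ := h.norm_horInt_le T
    exact ⟨K, hK0, fun v hv t ht0 htT => hK v (by linarith) t ht0 htT⟩

end HorAdmissible


lemma abs_log_le_of_le {a w b : ℝ} (ha : 0 < a) (haw : a ≤ w) (hwb : w ≤ b) :
    |Real.log w| ≤ |Real.log a| + |Real.log b| := by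
  have h1 := Real.log_le_log ha haw
  have h2 := Real.log_le_log (ha.trans_le haw) hwb
  rw [abs_le]
  constructor <;>
  linarith [neg_abs_le (Real.log a), le_abs_self (Real.log b), abs_nonneg (Real.log a),
    abs_nonneg (Real.log b)]

lemma horAdmissible_logZeta (hM : IsLogZ M) : HorAdmissible (logZeta M) where
  continuousOn := continuousOn_logZeta hM
  differentiableOn := fun s hs => (differentiableAt_logZeta hM hs.1 (by
    rw [Complex.mem_slitPlane_iff]
    right
    simpa using hs.2.ne')).differentiableWithinAt
  decay := fun T => by
    obtain ⟨K, hK0, hK⟩ := exists_norm_logZeta_le hM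
    refine ⟨K, hK0, fun v hv t _ _ => ?_⟩
    have := hK (v + t * Complex.I) (by rwa [re_add_mul_I])
    rwa [re_add_mul_I] at this
  dominated := fun T => by
    obtain ⟨K, hK0, hK⟩ := exists_norm_logZeta_le hM
    obtain ⟨K', hK'0, hK'⟩ := exists_bound_on_rect hM T
    have hlogint : ∀ c : ℝ, IntegrableOn (fun v : ℝ => |Real.log (v - c)|) (Set.Ioc (1 / 2) 2) := by
      intro c
      have h1 : IntervalIntegrable (fun v : ℝ => Real.log (v - c)) volume (1 / 2) 2 := by
        have := (intervalIntegral.intervalIntegrable_log' (a := 1 / 2 - c) (b := 2 - c)).comp_sub_right c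
        simpa using this
      exact ((intervalIntegrable_iff_integrableOn_Ioc_of_le (by norm_num)).mp h1).abs
    -- The singularity at v = 1/2 accounts for zeros on the critical line, the one at v = 1 for the
    -- pole; both are integrable, uniformly for 0 ≤ t ≤ T.
    set V : ℝ → ℝ := fun v => (2 * K' + Real.pi + |Real.log (T + 2)|) +
      (K' * |Real.log (v - 1 / 2)| + |Real.log (v - 1)|) with hV
    have hVint : IntegrableOn V (Set.Ioc (1 / 2) 2) :=
      (integrableOn_const (by simp)).add (((hlogint (1 / 2)).const_mul K').add (hlogint 1))
    refine ⟨fun v => K * Real.exp (-(v / 2)) + Set.indicator (Set.Ioc (1 / 2) 2) V v,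
      ((integrableOn_Ioi_exp_neg_half _).const_mul K).add ?_, fun v hv hv1 t ht0 htT => ?_⟩
    · exact ((integrable_indicator_iff measurableSet_Ioc).mpr hVint).integrableOn
    · change _ ≤ K * Real.exp (-(v / 2)) + Set.indicator (Set.Ioc (1 / 2) 2) V v
      rcases le_or_gt v 2 with hv2 | hv2
      · rw [Set.indicator_of_mem (Set.mem_Ioc.mpr ⟨hv, hv2⟩)]
        have hpos : 0 ≤ K * Real.exp (-(v / 2)) := by positivity
        refine le_trans ?_ (le_add_of_nonneg_left hpos)
        set z : ℂ := v + t * Complex.I with hz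
        have hzre : z.re = v := re_add_mul_I v t
        have hzim : z.im = t := im_add_mul_I v t
        obtain ⟨h1, h2⟩ := hK' z (by rwa [hzre]) (by rwa [hzre]) (by rwa [hzim]) (by rwa [hzim])
        rw [hzre] at h2
        have h3 : ‖M z‖ ≤ 2 * K' + K' * |Real.log (v - 1 / 2)| := by
          refine (Complex.norm_le_abs_re_add_abs_im _).trans ?_
          linarith
        have h4 : ‖Complex.log (z - 1)‖ ≤ |Real.log (v - 1)| + |Real.log (T + 2)| + Real.pi := by
          refine (Complex.norm_le_abs_re_add_abs_im _).trans ?_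
          rw [Complex.log_re, Complex.log_im]
          refine add_le_add ?_ (Complex.abs_arg_le_pi _)
          have h5 : |v - 1| ≤ ‖z - 1‖ := by
            have := Complex.abs_re_le_norm (z - 1)
            rwa [Complex.sub_re, hzre, Complex.one_re] at this
          have h6 : ‖z - 1‖ ≤ T + 2 := by
            refine (Complex.norm_le_abs_re_add_abs_im _).trans ?_
            rw [Complex.sub_re, Complex.sub_im, hzre, hzim, Complex.one_re, Complex.one_im, sub_zero,
              abs_of_nonneg ht0]
            have : |v - 1| ≤ 2 := abs_le.mpr ⟨by linarith, by linarith⟩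
            linarith
          have := abs_log_le_of_le (abs_pos.mpr (sub_ne_zero.mpr hv1)) h5 h6
          rwa [Real.log_abs] at this
        rw [logZeta]
        refine (norm_sub_le _ _).trans ?_
        simp only [hV]
        linarith
      · rw [Set.indicator_of_notMem (fun h => absurd (Set.mem_Ioc.mp h).2 (not_le.mpr hv2)), add_zero]
        have := hK (v + t * Complex.I) (by rw [re_add_mul_I]; exact hv2.le)
        rwa [re_add_mul_I] at this

/-! ### The functions S_n as boundary values -/

/-- The iterated horizontal integrals of `log ζ`. -/
def iterInt (M : ℂ → ℂ) : ℕ → ℂ → ℂ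
  | 0 => logZeta M
  | n + 1 => horInt (iterInt M n)

lemma horAdmissible_iterInt (hM : IsLogZ M) : ∀ n, HorAdmissible (iterInt M n)
  | 0 => horAdmissible_logZeta hM
  | n + 1 => (horAdmissible_iterInt hM n).horInt

lemma exp_eq_norm_mul_exp_im (z : ℂ) :
    Complex.exp z = ‖Complex.exp z‖ * Complex.exp (z.im * Complex.I) := by
  rw [Complex.norm_exp, Complex.ofReal_exp, ← Complex.exp_add, Complex.re_add_im]

/-- Two continuous arguments of a nonvanishing function that agree at one point are equal. -/
lemma eq_of_polar {S : Set ℝ} (hS : IsPreconnected S) {w : ℝ → ℂ} (hw : ∀ u ∈ S, w u ≠ 0)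
    {θ θ' : ℝ → ℝ} (hθ : ContinuousOn θ S) (hθ' : ContinuousOn θ' S)
    (h : ∀ u ∈ S, w u = ‖w u‖ * Complex.exp (θ u * Complex.I))
    (h' : ∀ u ∈ S, w u = ‖w u‖ * Complex.exp (θ' u * Complex.I))
    {x y : ℝ} (hx : x ∈ S) (hy : y ∈ S) (hxy : θ x = θ' x) : θ y = θ' y := by
  have hexp : ∀ u ∈ S, Complex.exp (θ u * Complex.I) = Complex.exp (θ' u * Complex.I) := by
    intro u hu
    have hn : (‖w u‖ : ℂ) ≠ 0 := by exact_mod_cast norm_ne_zero_iff.mpr (hw u hu)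
    exact mul_left_cancel₀ hn ((h u hu).symm.trans (h' u hu))
  have := sub_eq_sub_of_exp_eq_exp hS
    (p := fun u => (θ u : ℂ) * Complex.I) (q := fun u => (θ' u : ℂ) * Complex.I)
    ((Complex.continuous_ofReal.comp_continuousOn hθ).mul continuousOn_const)
    ((Complex.continuous_ofReal.comp_continuousOn hθ').mul continuousOn_const) hexp hx hy
  rw [hxy, sub_self] at this
  have h2 := congrArg Complex.im this
  simp at h2
  linarith

/-- Im log ζ along the two segments, extended by its limit at 1/2, is an admissible argument. Since
ζ does not vanish on the path, `eq_of_polar` on each segment shows that any other choice, in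
particular that of `argZeta`, has the same end value. -/
lemma tendsto_logZeta_im (hM : IsLogZ M) {t : ℝ} (ht : 0 < t) (hord : ¬ IsOrdinate t) :
    Tendsto (fun σ : ℝ => (logZeta M (σ + t * Complex.I)).im) (𝓝[>] (1 / 2)) (𝓝 (argZeta t)) := by
  have hζ : ∀ σ : ℝ, riemannZeta (σ + t * Complex.I) ≠ 0 := fun σ h => hord ⟨σ, h⟩
  have hne1 : ∀ σ : ℝ, (σ : ℂ) + t * Complex.I ≠ 1 := fun σ h => by
    have := congrArg Complex.im h
    rw [im_add_mul_I, Complex.one_im] at this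
    exact ht.ne' this
  have hζc : Continuous fun σ : ℝ => riemannZeta (σ + t * Complex.I) := by
    rw [continuous_iff_continuousAt]
    intro σ
    exact ContinuousAt.comp (differentiableAt_riemannZeta (hne1 σ)).continuousAt
      (f := fun σ : ℝ => (σ : ℂ) + t * Complex.I) (by fun_prop)
  set s₀ : ℂ := ((1 / 2 : ℝ) : ℂ) + t * Complex.I with hs₀
  obtain ⟨ℓ, hℓ⟩ := exists_tendsto_M hM (s₀ := s₀) (re_add_mul_I _ _) (by
    rw [Z_apply (hne1 _)]
    exact mul_ne_zero (sub_ne_zero.mpr (hne1 _)) (hζ _))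
  have hline : Tendsto (fun σ : ℝ => (σ : ℂ) + t * Complex.I) (𝓝[>] (1 / 2))
      (𝓝[{z | 1 / 2 < z.re}] s₀) := by
    refine tendsto_nhdsWithin_of_tendsto_nhds_of_eventually_within _ ?_ ?_
    · have : Continuous fun σ : ℝ => (σ : ℂ) + t * Complex.I := by fun_prop
      exact this.continuousAt.tendsto.mono_left nhdsWithin_le_nhds
    · filter_upwards [self_mem_nhdsWithin] with σ hσ
      simp only [re_add_mul_I]
      exact hσ
  have hslit : ∀ σ : ℝ, (σ : ℂ) + t * Complex.I - 1 ∈ Complex.slitPlane := fun σ => by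
    rw [Complex.mem_slitPlane_iff]
    right
    simpa using ht.ne'
  set a : ℝ := (ℓ - Complex.log (s₀ - 1)).im with ha
  have hlim : Tendsto (fun σ : ℝ => (logZeta M (σ + t * Complex.I)).im) (𝓝[>] (1 / 2)) (𝓝 a) := by
    refine (Complex.continuous_im.tendsto _).comp ((hℓ.comp hline).sub ?_)
    have : ContinuousAt (fun z : ℂ => Complex.log (z - 1)) s₀ :=
      (continuousAt_id.sub continuousAt_const).clog (hslit _)
    exact (this.tendsto.mono_left nhdsWithin_le_nhds).comp hline
  suffices h : argZeta t = a by rwa [h]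
  set φ₀ : ℝ → ℝ := Function.update (fun σ : ℝ => (logZeta M (σ + t * Complex.I)).im) (1 / 2) a
    with hφ₀
  set θ₀ : ℝ → ℝ := fun u => (logZeta M (2 + u * Complex.I)).im with hθ₀
  have hpolar : ∀ σ : ℝ, 1 / 2 < σ → riemannZeta (σ + t * Complex.I) =
      ‖riemannZeta (σ + t * Complex.I)‖ *
        Complex.exp ((logZeta M (σ + t * Complex.I)).im * Complex.I) := fun σ hσ => by
    rw [← exp_logZeta hM (by rwa [re_add_mul_I]) (hne1 σ)]
    exact exp_eq_norm_mul_exp_im _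
  have hθc : ContinuousOn θ₀ (Set.Icc 0 t) := by
    refine Complex.continuous_im.comp_continuousOn ?_
    refine (continuousOn_logZeta hM).comp (by fun_prop) fun u hu => ⟨?_, ?_, ?_⟩
    · simp; norm_num
    · simpa using hu.1
    · intro h
      have := congrArg Complex.re h
      norm_num at this
  have hφc : ContinuousOn φ₀ (Set.Icc (1 / 2) 2) := by
    intro σ hσ
    rcases hσ.1.eq_or_lt with h | h
    · rw [← h, hφ₀, continuousWithinAt_update_same]
      refine hlim.mono_left (nhdsWithin_mono _ fun u hu => ?_)
      exact lt_of_le_of_ne hu.1.1 (Ne.symm hu.2)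
    · have hc : ContinuousAt (fun σ : ℝ => (logZeta M (σ + t * Complex.I)).im) σ := by
        refine Complex.continuous_im.continuousAt.comp ?_
        exact ContinuousAt.comp (differentiableAt_logZeta hM (by rwa [re_add_mul_I])
          (hslit σ)).continuousAt (f := fun σ : ℝ => (σ : ℂ) + t * Complex.I) (by fun_prop)
      refine (hc.congr ?_).continuousWithinAt
      filter_upwards [isOpen_ne.mem_nhds h.ne'] with u hu
      rw [hφ₀, Function.update_of_ne hu]
  have hθ0 : θ₀ 0 = 0 := by
    have := logZeta_im_ofReal hM (v := 2) (by norm_num)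
    rw [if_neg (by norm_num)] at this
    simpa [hθ₀] using this
  have hθp : ∀ u ∈ Set.Icc (0 : ℝ) t, riemannZeta (2 + u * Complex.I) =
      ‖riemannZeta (2 + u * Complex.I)‖ * Complex.exp (θ₀ u * Complex.I) := fun u hu => by
    have h1 : (2 + u * Complex.I : ℂ) ≠ 1 := fun h => by
      have := congrArg Complex.re h
      norm_num at this
    rw [hθ₀, ← exp_logZeta hM (by norm_num) h1]
    exact exp_eq_norm_mul_exp_im _
  have hφp : ∀ σ ∈ Set.Icc (1 / 2 : ℝ) 2, riemannZeta (σ + t * Complex.I) =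
      ‖riemannZeta (σ + t * Complex.I)‖ * Complex.exp (φ₀ σ * Complex.I) := by
    intro σ hσ
    rcases hσ.1.eq_or_lt with h | h
    · rw [← h, hφ₀, Function.update_self]
      have h1 : Tendsto (fun σ : ℝ => riemannZeta (σ + t * Complex.I)) (𝓝[>] (1 / 2))
          (𝓝 (riemannZeta ((1 / 2 : ℝ) + t * Complex.I))) :=
        (hζc.tendsto _).mono_left nhdsWithin_le_nhds
      have h2 : Tendsto (fun σ : ℝ => (‖riemannZeta (σ + t * Complex.I)‖ : ℂ) *
          Complex.exp ((logZeta M (σ + t * Complex.I)).im * Complex.I)) (𝓝[>] (1 / 2))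
          (𝓝 (‖riemannZeta ((1 / 2 : ℝ) + t * Complex.I)‖ * Complex.exp (a * Complex.I))) :=
        ((Complex.continuous_ofReal.tendsto _).comp h1.norm).mul
          ((Complex.continuous_exp.tendsto _).comp
            (((Complex.continuous_ofReal.tendsto _).comp hlim).mul_const _))
      refine tendsto_nhds_unique h1 (h2.congr' ?_)
      filter_upwards [self_mem_nhdsWithin] with σ hσ using (hpolar σ hσ).symm
    · rw [hφ₀, Function.update_of_ne h.ne']
      exact hpolar σ h
  have hφ2 : φ₀ 2 = θ₀ t := by
    rw [hφ₀, Function.update_of_ne (by norm_num)]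
    simp [hθ₀]
  have hex : IsArgAlongPath t a :=
    ⟨θ₀, φ₀, hθc, hφc, hθ0, hθp, hφ2, hφp, Function.update_self _ _ _⟩
  obtain ⟨θ, φ, h1, h2, h3, h4, h5, h6, h7⟩ := Classical.epsilon_spec (p := IsArgAlongPath t) ⟨a, hex⟩
  have hθt : θ t = θ₀ t := by
    refine eq_of_polar isPreconnected_Icc (w := fun u => riemannZeta (2 + u * Complex.I))
      (fun u _ => riemannZeta_ne_zero_of_one_le_re (by norm_num)) h1 hθc h4 hθp
      (Set.left_mem_Icc.mpr ht.le) (Set.right_mem_Icc.mpr ht.le) (by rw [h3, hθ0])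
  have hφh : φ (1 / 2) = φ₀ (1 / 2) := by
    refine eq_of_polar isPreconnected_Icc (w := fun σ => riemannZeta (σ + t * Complex.I))
      (fun σ _ => hζ σ) h2 hφc h6 hφp (x := 2) (by norm_num) (by norm_num) (by rw [h5, hφ2, hθt])
  rw [argZeta, ← h7, hφh, hφ₀, Function.update_self]

/-- Zeros of ζ are isolated. The convention for S at ordinates therefore concerns a null set and
does not influence the integrals. -/
lemma countable_setOf_isOrdinate : {t : ℝ | IsOrdinate t}.Countable := by
  have h : {t : ℝ | IsOrdinate t} ⊆ Complex.im '' riemannZetaZeros := by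
    rintro t ⟨σ, h⟩
    exact ⟨_, h, im_add_mul_I σ t⟩
  have hd : DiscreteTopology riemannZetaZeros := isDiscrete_riemannZetaZeros.to_subtype
  have hc : riemannZetaZeros.Countable := Set.countable_coe_iff.mp (TopologicalSpace.separableSpace_iff_countable.mp inferInstance)
  exact (hc.image _).mono h

/-- Almost everywhere, `π S` is the boundary value of the imaginary part of `log ζ`. -/
lemma ae_tendsto_logZeta_im (hM : IsLogZ M) : ∀ᵐ t : ℝ, 0 < t →
    Tendsto (fun σ : ℝ => (logZeta M (σ + t * Complex.I)).im) (𝓝[>] (1 / 2))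
      (𝓝 (Real.pi * S t)) := by
  filter_upwards [countable_setOf_isOrdinate.ae_notMem volume] with t ht ht0
  have ht : ¬ IsOrdinate t := ht
  rw [S, if_neg ht, ← mul_assoc, mul_one_div_cancel Real.pi_ne_zero, one_mul]
  exact tendsto_logZeta_im hM ht0 ht

lemma HorAdmissible.continuousOn_vertical {Φ : ℂ → ℂ} (h : HorAdmissible Φ) {σ : ℝ}
    (hσ : 1 / 2 < σ) (hσ1 : σ ≠ 1) :
    ContinuousOn (fun τ : ℝ => Φ (σ + τ * Complex.I)) (Set.Ici 0) := by
  refine h.continuousOn.comp (by fun_prop) fun τ hτ => ⟨?_, ?_, add_mul_I_ne_one hσ1⟩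
  · rwa [re_add_mul_I]
  · rwa [im_add_mul_I]

lemma HorAdmissible.continuousOn_horInt_vertical {Φ : ℂ → ℂ} (h : HorAdmissible Φ) {σ : ℝ}
    (hσ : 1 / 2 ≤ σ) :
    ContinuousOn (fun τ : ℝ => ZetaSn.horInt Φ (σ + τ * Complex.I)) (Set.Ici 0) := by
  refine h.continuousOn_horInt.comp (by fun_prop) fun τ hτ => ⟨?_, ?_⟩
  · rwa [re_add_mul_I]
  · rwa [im_add_mul_I]

/-- The imaginary part of `i^n` times the `n`-fold integral of `log ζ`. -/
def phase (M : ℂ → ℂ) (n : ℕ) (σ t : ℝ) : ℝ :=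
  (Complex.I ^ n * iterInt M n (σ + t * Complex.I)).im

lemma abs_phase_le (M : ℂ → ℂ) (n : ℕ) (σ t : ℝ) :
    |phase M n σ t| ≤ ‖iterInt M n (σ + t * Complex.I)‖ := by
  refine (Complex.abs_im_le_norm _).trans ?_
  rw [norm_mul, norm_pow, Complex.norm_I, one_pow, one_mul]

lemma continuousOn_phase (hM : IsLogZ M) (n : ℕ) {σ : ℝ} (hσ : 1 / 2 < σ) (hσ1 : σ ≠ 1) :
    ContinuousOn (phase M n σ) (Set.Ici 0) :=
  Complex.continuous_im.comp_continuousOn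
    (continuousOn_const.mul ((horAdmissible_iterInt hM n).continuousOn_vertical hσ hσ1))

/-- The derivative of i^{n+1} L_{n+1}(σ + it) in t is i^{n+1} · (-L_n) · i = i^n L_n. -/
lemma phase_succ_sub (hM : IsLogZ M) (n : ℕ) {σ t : ℝ} (hσ : 1 / 2 < σ) (hσ1 : σ ≠ 1)
    (ht : 0 ≤ t) :
    phase M (n + 1) σ t - phase M (n + 1) σ 0 = ∫ τ in (0 : ℝ)..t, phase M n σ τ := by
  have hA := horAdmissible_iterInt hM n
  symm
  refine intervalIntegral.integral_eq_sub_of_hasDerivAt_of_le ht ?_ (fun τ hτ => ?_) ?_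
  · exact (Complex.continuous_im.comp_continuousOn (continuousOn_const.mul
      (hA.continuousOn_horInt_vertical hσ.le))).mono Set.Icc_subset_Ici_self
  · have hd := hA.hasDerivAt_horInt (s := σ + τ * Complex.I) (by rwa [re_add_mul_I])
      (by rw [im_add_mul_I]; exact hτ.1)
    have hin : HasDerivAt (fun w : ℂ => (σ : ℂ) + w * Complex.I) Complex.I (τ : ℂ) := by
      simpa using ((hasDerivAt_id (τ : ℂ)).mul_const Complex.I).const_add (σ : ℂ)
    have h2 := ((hd.comp (τ : ℂ) hin).const_mul (Complex.I ^ (n + 1))).comp_ofReal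
    have h3 := Complex.imCLM.hasFDerivAt.comp_hasDerivAt τ h2
    refine h3.congr_deriv ?_
    rw [Complex.imCLM_apply, phase]
    congr 1
    rw [pow_succ]
    linear_combination (-Complex.I ^ n * iterInt M n (σ + τ * Complex.I)) * Complex.I_mul_I
  · refine ((continuousOn_phase hM n hσ hσ1).mono ?_).intervalIntegrable
    rw [Set.uIcc_of_le ht]
    exact Set.Icc_subset_Ici_self

/-- A majorant uniform in σ, for the passage σ → 1/2. In the case n = 0 it rests on the boundedness
of Im M near zeros. -/
lemma exists_abs_phase_le (hM : IsLogZ M) (n : ℕ) (T : ℝ) :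
    ∃ K : ℝ, ∀ σ : ℝ, 1 / 2 < σ → σ ≤ 2 → ∀ t : ℝ, 0 ≤ t → t ≤ T → |phase M n σ t| ≤ K := by
  rcases n with _ | n
  · obtain ⟨K, -, hK⟩ := exists_bound_on_rect hM T
    refine ⟨K + Real.pi, fun σ hσ hσ2 t ht htT => ?_⟩
    have h := (hK (σ + t * Complex.I) (by rwa [re_add_mul_I]) (by rwa [re_add_mul_I])
      (by rwa [im_add_mul_I]) (by rwa [im_add_mul_I])).1
    rw [phase, pow_zero, one_mul, iterInt, logZeta, Complex.sub_im, Complex.log_im]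
    exact (abs_sub _ _).trans (add_le_add h (Complex.abs_arg_le_pi _))
  · obtain ⟨K, hK0, hK⟩ := (horAdmissible_iterInt hM n).norm_horInt_le T
    refine ⟨K, fun σ hσ _ t ht htT => (abs_phase_le _ _ _ _).trans
      ((hK σ hσ.le t ht htT).trans ?_)⟩
    exact mul_le_of_le_one_right hK0 (Real.exp_le_one_iff.mpr (by linarith))

lemma tendsto_phase_succ (hM : IsLogZ M) (n : ℕ) {t : ℝ} (ht : 0 ≤ t) :
    Tendsto (fun σ => phase M (n + 1) σ t) (𝓝[>] (1 / 2)) (𝓝 (phase M (n + 1) (1 / 2) t)) := by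
  have hc : ContinuousOn (fun σ : ℝ => phase M (n + 1) σ t) (Set.Ici (1 / 2)) := by
    refine Complex.continuous_im.comp_continuousOn (continuousOn_const.mul ?_)
    refine (horAdmissible_iterInt hM n).continuousOn_horInt.comp (by fun_prop) fun σ hσ => ⟨?_, ?_⟩
    · rwa [re_add_mul_I]
    · rwa [im_add_mul_I]
  exact (hc (1 / 2) Set.self_mem_Ici).mono_left (nhdsWithin_mono _ Set.Ioi_subset_Ici_self)

/-- On the real axis log ζ has real part log |ζ| and imaginary part -π on (1/2, 1), 0 beyond;
integrate each part repeatedly. Only for n = 0 must the end point and the pole be excluded. -/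
lemma iterInt_ofReal (hM : IsLogZ M) (n : ℕ) : ∀ v : ℝ, 1 / 2 ≤ v → (n = 0 → v ≠ 1 / 2 ∧ v ≠ 1) →
    (iterInt M n v).re = iterLogZeta n v ∧
    (iterInt M n v).im = if v < 1 then -(Real.pi * iterOne n v) else 0 := by
  induction n with
  | zero =>
    intro v hv h
    obtain ⟨h1, h2⟩ := h rfl
    have hv' : 1 / 2 < v := lt_of_le_of_ne hv h1.symm
    constructor
    · exact logZeta_re hM (by simpa using hv') (by exact_mod_cast h2)
    · simpa [iterInt, iterOne] using logZeta_im_ofReal hM hv'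
  | succ n ih =>
    intro v hv _
    have hint : IntegrableOn (fun u : ℝ => iterInt M n u) (Set.Ioi v) := by
      have := (horAdmissible_iterInt hM n).integrableOn le_rfl
      simp only [Complex.ofReal_zero, zero_mul, add_zero] at this
      exact this.mono_set (Set.Ioi_subset_Ioi hv)
    have hdef : iterInt M (n + 1) v = ∫ u in Set.Ioi v, iterInt M n u := by
      simp [iterInt, horInt]
    have hae : ∀ᵐ u : ℝ ∂volume.restrict (Set.Ioi v), (iterInt M n u).re = iterLogZeta n u ∧
        (iterInt M n u).im = if u < 1 then -(Real.pi * iterOne n u) else 0 := by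
      have hne : ∀ᵐ u ∂(volume.restrict (Set.Ioi v)), u ≠ 1 :=
        ae_restrict_of_ae (Measure.ae_ne volume 1)
      filter_upwards [ae_restrict_mem measurableSet_Ioi, hne] with u hu hu1
      have : v < u := hu
      exact ih u (by linarith) fun _ => ⟨by linarith, hu1⟩
    constructor
    · rw [hdef, iterLogZeta]
      refine (integral_re hint).symm.trans (integral_congr_ae ?_)
      filter_upwards [hae] with u hu using hu.1
    · have h1 : (iterInt M (n + 1) v).im =
          ∫ u in Set.Ioi v, Set.indicator (Set.Iio 1) (fun u => -(Real.pi * iterOne n u)) u := by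
        rw [hdef]
        refine (integral_im hint).symm.trans (integral_congr_ae ?_)
        filter_upwards [hae] with u hu
        exact hu.2.trans (by simp [Set.indicator_apply])
      rw [h1, setIntegral_indicator measurableSet_Iio, Set.Ioi_inter_Iio]
      split_ifs with hv1
      · rw [← integral_Ioc_eq_integral_Ioo, ← intervalIntegral.integral_of_le hv1.le,
          intervalIntegral.integral_neg, intervalIntegral.integral_const_mul, iterOne]
      · rw [Set.Ioo_eq_empty hv1, setIntegral_empty]

/-- For even n the power i^n is real and selects the imaginary part of the iterated integral; for
odd n it selects the real part. This is the reason for the two shapes of δ_n. -/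
lemma phase_half_zero (hM : IsLogZ M) {n : ℕ} (hn : 1 ≤ n) :
    phase M n (1 / 2) 0 = Real.pi * δ n := by
  obtain ⟨hre, him⟩ := iterInt_ofReal hM n (1 / 2) le_rfl (by omega)
  rw [if_pos (by norm_num)] at him
  rw [phase, Complex.ofReal_zero, zero_mul, add_zero, δ]
  rcases n.even_or_odd' with ⟨k, rfl | rfl⟩
  · obtain ⟨j, rfl⟩ : ∃ j, k = j + 1 := ⟨k - 1, by omega⟩
    rw [if_neg (by simp), show (2 * (j + 1) - 1) / 2 = j by omega, pow_mul, Complex.I_sq]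
    have : ((-1 : ℂ)) ^ (j + 1) = (((-1) ^ (j + 1) : ℝ) : ℂ) := by push_cast; rfl
    rw [this, Complex.im_ofReal_mul, him]
    ring
  · rw [if_pos (by simp), show (2 * k + 1 - 1) / 2 = k by omega, pow_succ, pow_mul, Complex.I_sq]
    have : ((-1 : ℂ)) ^ k = (((-1) ^ k : ℝ) : ℂ) := by push_cast; rfl
    rw [this, mul_assoc, Complex.im_ofReal_mul, Complex.I_mul_im, hre]
    field_simp

/-- The functions `S_n` are boundary values of the iterated integrals of `log ζ`. -/
lemma Sn_succ_eq (hM : IsLogZ M) (n : ℕ) {t : ℝ} (ht : 0 ≤ t)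
    (hlim : ∀ᵐ τ : ℝ, 0 < τ →
      Tendsto (fun σ => phase M n σ τ) (𝓝[>] (1 / 2)) (𝓝 (Real.pi * Sn n τ))) :
    phase M (n + 1) (1 / 2) t = Real.pi * Sn (n + 1) t := by
  have hev : ∀ᶠ σ : ℝ in 𝓝[>] (1 / 2), 1 / 2 < σ ∧ σ < 1 := by
    filter_upwards [Ioo_mem_nhdsGT (by norm_num : (1 / 2 : ℝ) < 1)] with σ hσ using hσ
  obtain ⟨K, hK⟩ := exists_abs_phase_le hM n t
  -- The relation between consecutive phases holds for σ > 1/2 and is carried to σ = 1/2 by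
  -- dominated convergence.
  have h1 : Tendsto (fun σ => ∫ τ in (0 : ℝ)..t, phase M n σ τ) (𝓝[>] (1 / 2))
      (𝓝 (∫ τ in (0 : ℝ)..t, Real.pi * Sn n τ)) := by
    refine intervalIntegral.tendsto_integral_filter_of_dominated_convergence (fun _ => K) ?_ ?_
      intervalIntegrable_const ?_
    · filter_upwards [hev] with σ hσ
      refine ((continuousOn_phase hM n hσ.1 hσ.2.ne).mono ?_).aestronglyMeasurable measurableSet_uIoc
      rw [Set.uIoc_of_le ht]
      exact fun τ hτ => hτ.1.le
    · filter_upwards [hev] with σ hσ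
      refine ae_of_all _ fun τ hτ => ?_
      rw [Set.uIoc_of_le ht] at hτ
      exact hK σ hσ.1 (by linarith [hσ.2]) τ hτ.1.le hτ.2
    · filter_upwards [hlim] with τ h hτ
      rw [Set.uIoc_of_le ht] at hτ
      exact h hτ.1
  have h2 := (tendsto_phase_succ hM n ht).sub (tendsto_phase_succ hM n le_rfl)
  have h3 := tendsto_nhds_unique (h2.congr' (by
    filter_upwards [hev] with σ hσ using phase_succ_sub hM n hσ.1 hσ.2.ne ht)) h1
  rw [intervalIntegral.integral_const_mul, phase_half_zero hM (by omega : 1 ≤ n + 1)] at h3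
  rw [Sn, mul_add, ← h3]
  ring

lemma ae_tendsto_phase (hM : IsLogZ M) (n : ℕ) : ∀ᵐ τ : ℝ, 0 < τ →
    Tendsto (fun σ => phase M n σ τ) (𝓝[>] (1 / 2)) (𝓝 (Real.pi * Sn n τ)) := by
  induction n with
  | zero =>
    filter_upwards [ae_tendsto_logZeta_im hM] with τ h hτ
    simpa [phase, iterInt, Sn] using h hτ
  | succ n ih =>
    refine ae_of_all _ fun τ hτ => ?_
    rw [← Sn_succ_eq hM n hτ.le ih]
    exact tendsto_phase_succ hM n hτ.le

lemma Sn_eq (hM : IsLogZ M) {n : ℕ} (hn : 1 ≤ n) {t : ℝ} (ht : 0 ≤ t) :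
    Sn n t = 1 / Real.pi * phase M n (1 / 2) t := by
  obtain ⟨k, rfl⟩ : ∃ k, n = k + 1 := ⟨n - 1, by omega⟩
  rw [Sn_succ_eq hM k ht (ae_tendsto_phase hM k)]
  field_simp

/-! ### Dirichlet series of the iterated integrals -/

lemma abscissa_mangoldt_le (j : ℕ) : LSeries.abscissaOfAbsConv
    (fun k => ((vonMangoldt k / Real.log k ^ (j + 1) : ℝ) : ℂ)) ≤ 1 :=
  LSeries.abscissaOfAbsConv_le_of_le_const ⟨_, fun k _ => norm_mangoldt_div_le j k⟩

lemma hasDerivAt_mangoldtSeries (j : ℕ) {s : ℂ} (hs : 1 < s.re) :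
    HasDerivAt (mangoldtSeries (j + 2)) (-mangoldtSeries (j + 1) s) s := by
  have h := LSeries_hasDerivAt (lt_of_le_of_lt (abscissa_mangoldt_le (j + 1))
    (by exact_mod_cast hs : (1 : EReal) < s.re))
  refine h.congr_deriv ?_
  rw [mangoldtSeries]
  congr 1
  refine LSeries_congr (fun {k} hk => ?_) s
  rw [LSeries.logMul, ← Complex.natCast_log, ← Complex.ofReal_mul]
  congr 1
  by_cases hl : Real.log k = 0
  · have : vonMangoldt k = 0 := le_antisymm (hl ▸ ArithmeticFunction.vonMangoldt_le_log)
      ArithmeticFunction.vonMangoldt_nonneg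
    simp [this]
  · rw [pow_succ _ (j + 1)]
    field_simp

lemma norm_term_mangoldt (j : ℕ) (s : ℂ) (k : ℕ) :
    ‖LSeries.term (fun k => ((vonMangoldt k / Real.log k ^ j : ℝ) : ℂ)) s k‖ =
      vonMangoldt k / Real.log k ^ j * (k : ℝ) ^ (-s.re) := by
  rw [LSeries.norm_term_eq]
  split_ifs with hk
  · simp [hk]
  · rw [Complex.norm_real, Real.norm_of_nonneg, Real.rpow_neg (Nat.cast_nonneg k), div_eq_mul_inv]
    exact div_nonneg ArithmeticFunction.vonMangoldt_nonneg
      (pow_nonneg (Real.log_natCast_nonneg k) _)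

lemma norm_mangoldtSeries_le (j : ℕ) {s : ℂ} (hs : 1 < s.re) :
    ‖mangoldtSeries (j + 1) s‖ ≤ (mangoldtSeries (j + 1) s.re).re := by
  have h1 := lseriesSummable_mangoldt j hs
  have h2 := lseriesSummable_mangoldt j (s := (s.re : ℂ)) (by simpa using hs)
  rw [mangoldtSeries, LSeries, mangoldtSeries, LSeries, Complex.re_tsum h2]
  refine (norm_tsum_le_tsum_norm h1.norm).trans (le_of_eq (tsum_congr fun k => ?_))
  rw [norm_term_mangoldt, LSeries.term_def]
  split_ifs with hk
  · simp [hk]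
  · rw [← Complex.ofReal_natCast, ← Complex.ofReal_cpow (Nat.cast_nonneg k), ← Complex.ofReal_div,
      Complex.ofReal_re, Real.rpow_neg (Nat.cast_nonneg k), ← div_eq_mul_inv]

/-- On the real axis the limit is the first coefficient, zero as Λ(1) = 0; other heights are
dominated by the real axis. -/
lemma tendsto_mangoldtSeries (j : ℕ) (t : ℝ) :
    Tendsto (fun v : ℝ => mangoldtSeries (j + 1) (v + t * Complex.I)) atTop (𝓝 0) := by
  have h := LSeries.tendsto_atTop (lt_of_le_of_lt (abscissa_mangoldt_le j)
    (by exact_mod_cast EReal.coe_lt_top 1 : (1 : EReal) < ⊤))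
  have h0 : Tendsto (fun v : ℝ => (mangoldtSeries (j + 1) v).re) atTop (𝓝 0) := by
    have h1 := (Complex.continuous_re.tendsto _).comp h
    rwa [ArithmeticFunction.vonMangoldt_apply_one, zero_div, Complex.ofReal_zero,
      Complex.zero_re] at h1
  refine squeeze_zero_norm' ?_ h0
  filter_upwards [eventually_gt_atTop 1] with v hv
  have := norm_mangoldtSeries_le j (s := v + t * Complex.I) (by rwa [re_add_mul_I])
  rwa [re_add_mul_I] at this

/-- In the half-plane of absolute convergence the iterated integrals of `log ζ` are Dirichlet
series. -/
lemma iterInt_eq_mangoldtSeries (hM : IsLogZ M) (n : ℕ) : ∀ σ t : ℝ, 1 < σ → 0 ≤ t →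
    iterInt M n (σ + t * Complex.I) = mangoldtSeries (n + 1) (σ + t * Complex.I) := by
  induction n with
  | zero =>
    intro σ t hσ _
    exact logZeta_eq_mangoldtSeries hM (by rwa [re_add_mul_I])
  | succ n ih =>
    intro σ t hσ ht
    have hint : IntegrableOn (fun v : ℝ => iterInt M n (v + t * Complex.I)) (Set.Ioi σ) :=
      ((horAdmissible_iterInt hM n).integrableOn ht).mono_set (Set.Ioi_subset_Ioi (by linarith))
    have hd : ∀ v ∈ Set.Ici σ,
        HasDerivAt (fun v : ℝ => -mangoldtSeries (n + 2) (v + t * Complex.I))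
          (iterInt M n (v + t * Complex.I)) v := by
      intro v hv
      have hv' : 1 < v := hσ.trans_le hv
      have h1 := hasDerivAt_mangoldtSeries n (s := v + t * Complex.I) (by rwa [re_add_mul_I])
      have hin : HasDerivAt (fun w : ℂ => w + t * Complex.I) 1 (v : ℂ) :=
        (hasDerivAt_id _).add_const _
      refine ((h1.comp (v : ℂ) hin).comp_ofReal.neg).congr_deriv ?_
      rw [ih v t hv' ht]
      ring
    have hlim := (tendsto_mangoldtSeries (n + 1) t).neg
    have h := integral_Ioi_of_hasDerivAt_of_tendsto' hd hint hlim
    rw [iterInt, horInt, re_add_mul_I, im_add_mul_I, h]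
    ring

/-! ### Bounds in log t near the critical line -/

/-- The disc touches the critical line and stays at height at least 1/2, hence away from the pole.
The polynomial bound for Z then gives |ζ| ≤ 2⁷ t² ≤ t⁹, as t ≥ 2. -/
lemma log_norm_zeta_le {t : ℝ} (ht : 2 ≤ t) {s : ℂ} (hs : s ∈ Metric.ball (2 + t * Complex.I) (3 / 2))
    (hζ : riemannZeta s ≠ 0) : Real.log ‖riemannZeta s‖ ≤ 9 * Real.log t := by
  rw [mem_ball_iff_norm] at hs
  have hre : 1 / 2 ≤ s.re := by
    have := (Complex.abs_re_le_norm (s - (2 + t * Complex.I))).trans hs.le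
    simp only [Complex.sub_re, Complex.add_re, Complex.re_ofNat, Complex.mul_re, Complex.ofReal_re,
      Complex.I_re, Complex.ofReal_im, Complex.I_im] at this
    linarith [(abs_le.mp this).1]
  have him : 1 / 2 ≤ s.im := by
    have := (Complex.abs_im_le_norm (s - (2 + t * Complex.I))).trans hs.le
    simp only [Complex.sub_im, Complex.add_im, Complex.im_ofNat, Complex.mul_im, Complex.ofReal_re,
      Complex.I_re, Complex.ofReal_im, Complex.I_im] at this
    linarith [(abs_le.mp this).1]
  have hs1 : 1 / 2 ≤ ‖s - 1‖ := by
    have := Complex.abs_im_le_norm (s - 1)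
    rw [Complex.sub_im, Complex.one_im, sub_zero] at this
    linarith [le_abs_self s.im]
  have hne : s ≠ 1 := fun h => by rw [h, Complex.one_im] at him; norm_num at him
  have hnorm : ‖s‖ ≤ t + 4 := by
    have h1 : ‖(2 + t * Complex.I : ℂ)‖ ≤ 2 + t := by
      refine (norm_add_le _ _).trans ?_
      rw [norm_mul, Complex.norm_I, mul_one, Complex.norm_real, Real.norm_of_nonneg (by linarith)]
      simp
    have h2 := norm_le_norm_sub_add s (2 + t * Complex.I)
    linarith
  have hZ := norm_Z_le hre
  rw [Z_apply hne, norm_mul] at hZ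
  have hpos : 0 < ‖riemannZeta s‖ := norm_pos_iff.mpr hζ
  have hb : ‖riemannZeta s‖ ≤ t ^ 9 := by
    have h1 : 1 / 2 * ‖riemannZeta s‖ ≤ 3 * (4 * t) ^ 2 := by
      calc _ ≤ ‖s - 1‖ * ‖riemannZeta s‖ := by gcongr
        _ ≤ 3 * (1 + ‖s‖) ^ 2 := hZ
        _ ≤ _ := by gcongr; linarith
    have h2 : (2 : ℝ) ^ 7 ≤ t ^ 7 := by gcongr
    have h3 : 0 ≤ t ^ 2 := by positivity
    calc ‖riemannZeta s‖ ≤ 2 ^ 7 * t ^ 2 := by nlinarith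
      _ ≤ t ^ 7 * t ^ 2 := by gcongr
      _ = t ^ 9 := by ring
  have := Real.log_le_log hpos hb
  rwa [Real.log_pow] at this

lemma half_le_log {t : ℝ} (ht : 2 ≤ t) : 1 / 2 ≤ Real.log t := by
  have := Real.log_le_log (by norm_num) ht
  linarith [Real.log_two_gt_d9]

/-- The bound of Borel and Carathéodory for `log ζ` to the right of the critical line. -/
lemma exists_norm_logZeta_le_log (hM : IsLogZ M) :
    ∃ K : ℝ, 0 ≤ K ∧ ∀ t : ℝ, 2 ≤ t → ∀ σ : ℝ, 1 / 2 < σ →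
      ‖logZeta M (σ + t * Complex.I)‖ ≤
        K * Real.log t * ((σ - 1 / 2)⁻¹ * Real.exp (-((σ - 1 / 2) / 4))) := by
  obtain ⟨K, hK0, hK⟩ := exists_norm_logZeta_le hM
  -- For σ ≤ 2 the numerator in Borel–Carathéodory is at most (27 + 6K) log t and e^{-y/4} ≥ 1/2.
  -- The summand 8K covers σ > 2, where exponential decay suffices.
  refine ⟨2 * (27 + 6 * K) + 8 * K, by positivity, fun t ht σ hσ => ?_⟩
  have hl := half_le_log ht
  set y := σ - 1 / 2 with hy
  have hy0 : 0 < y := by linarith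
  have hquad : ∀ z ∈ Metric.ball (0 : ℂ) (3 / 2),
      1 / 2 < (2 + t * Complex.I + z).re ∧ 0 < (2 + t * Complex.I + z).im := by
    intro z hz
    rw [mem_ball_zero_iff] at hz
    have h1 := (abs_le.mp ((Complex.abs_re_le_norm z))).1
    have h2 := (abs_le.mp ((Complex.abs_im_le_norm z))).1
    simp only [Complex.add_re, Complex.re_ofNat, Complex.mul_re, Complex.ofReal_re, Complex.I_re,
      Complex.ofReal_im, Complex.I_im, Complex.add_im, Complex.im_ofNat, Complex.mul_im]
    constructor <;> linarith
  rcases le_or_gt σ 2 with hσ2 | hσ2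
  · have hz : ‖((σ - 2 : ℝ) : ℂ)‖ = 2 - σ := by
      rw [Complex.norm_real, Real.norm_of_nonpos (by linarith)]
      ring
    -- Centre 2 + it and radius 3/2: the distance from σ + it to the circle is σ - 1/2, hence the
    -- factor (σ - 1/2)⁻¹.
    have hbc := Complex.borelCaratheodory (f := fun z => logZeta M (2 + t * Complex.I + z))
      (M := 9 * Real.log t) (R := 3 / 2) (z := ((σ - 2 : ℝ) : ℂ)) (by linarith)
      (fun z hz => by
        obtain ⟨h1, h2⟩ := hquad z hz
        have hd := differentiableAt_logZeta hM h1 (by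
          rw [Complex.mem_slitPlane_iff]
          right
          rw [Complex.sub_im, Complex.one_im, sub_zero]
          exact h2.ne')
        exact (hd.comp z (by fun_prop)).differentiableWithinAt)
      (fun z hz => by
        obtain ⟨h1, h2⟩ := hquad z hz
        have hne : 2 + t * Complex.I + z ≠ 1 := fun h => by
          rw [h, Complex.one_im] at h2
          exact lt_irrefl _ h2
        refine (logZeta_re hM h1 hne).trans_le (log_norm_zeta_le ht ?_ ?_)
        · rw [mem_ball_iff_norm, add_sub_cancel_left]
          exact mem_ball_zero_iff.mp hz
        · rw [← exp_logZeta hM h1 hne]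
          exact Complex.exp_ne_zero _)
      (by norm_num) (by rw [mem_ball_zero_iff, hz]; linarith)
    have h0 : ‖logZeta M (2 + t * Complex.I)‖ ≤ K := by
      have := hK (2 + t * Complex.I) (by simp)
      refine this.trans (mul_le_of_le_one_right hK0 (Real.exp_le_one_iff.mpr ?_))
      simp
    have hpt : (2 : ℂ) + t * Complex.I + ((σ - 2 : ℝ) : ℂ) = σ + t * Complex.I := by
      push_cast
      ring
    rw [hz, add_zero, hpt, show (3 / 2 : ℝ) - (2 - σ) = y by rw [hy]; ring, ← add_div] at hbc
    have hE : 1 / 2 ≤ Real.exp (-(y / 4)) := by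
      have := Real.add_one_le_exp (-(y / 4))
      have : y ≤ 3 / 2 := by linarith
      linarith
    refine hbc.trans ?_
    rw [div_eq_mul_inv]
    have h1 : 2 * (9 * Real.log t) * (2 - σ) + ‖logZeta M (2 + t * Complex.I)‖ * (3 / 2 + (2 - σ)) ≤
        (27 + 6 * K) * Real.log t := by
      have h2 : 2 * (9 * Real.log t) * (2 - σ) ≤ 2 * (9 * Real.log t) * (3 / 2) := by
        gcongr
        linarith
      have h3 : ‖logZeta M (2 + t * Complex.I)‖ * (3 / 2 + (2 - σ)) ≤ K * 3 := by
        gcongr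
        · linarith
      nlinarith
    have hinv : 0 < y⁻¹ := by positivity
    calc _ ≤ (27 + 6 * K) * Real.log t * y⁻¹ := by gcongr
      _ = 2 * (27 + 6 * K) * Real.log t * (y⁻¹ * (1 / 2)) := by ring
      _ ≤ 2 * (27 + 6 * K) * Real.log t * (y⁻¹ * Real.exp (-(y / 4))) := by gcongr
      _ ≤ _ := by
        gcongr
        linarith
  · have h1 := hK (σ + t * Complex.I) (by rw [re_add_mul_I]; exact hσ2.le)
    rw [re_add_mul_I] at h1
    have h2 : Real.exp (-(σ / 2)) ≤ 4 * (y⁻¹ * Real.exp (-(y / 4))) := by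
      have h3 : Real.exp (-(σ / 2)) ≤ Real.exp (-(y / 4)) * Real.exp (-(y / 4)) := by
        rw [← Real.exp_add]
        exact Real.exp_le_exp.mpr (by linarith)
      have h4 : Real.exp (-(y / 4)) ≤ 4 * y⁻¹ := by
        rw [Real.exp_neg, show 4 * y⁻¹ = (y / 4)⁻¹ by field_simp]
        exact inv_anti₀ (by positivity) (by linarith [Real.add_one_le_exp (y / 4)])
      calc _ ≤ _ := h3
        _ ≤ 4 * y⁻¹ * Real.exp (-(y / 4)) := by gcongr
        _ = _ := by ring
    set W := y⁻¹ * Real.exp (-(y / 4)) with hW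
    have hW0 : 0 ≤ W := by positivity
    calc _ ≤ K * (4 * W) := h1.trans (by gcongr)
      _ ≤ (8 * K) * Real.log t * W := by nlinarith [mul_nonneg hK0 hW0]
      _ ≤ _ := by
        gcongr
        linarith

/-- The weight `y^{-1/2} e^{-y/8}`. -/
def halfWeight (y : ℝ) : ℝ := y ^ (-(1 / 2) : ℝ) * Real.exp (-(1 / 8) * y)

lemma halfWeight_nonneg {y : ℝ} (hy : 0 ≤ y) : 0 ≤ halfWeight y :=
  mul_nonneg (Real.rpow_nonneg hy _) (Real.exp_pos _).le

lemma integrableOn_halfWeight : IntegrableOn halfWeight (Set.Ioi 0) := by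
  have := integrableOn_rpow_mul_exp_neg_mul_rpow (s := -(1 / 2)) (p := 1) (b := 1 / 8)
    (by norm_num) one_pos (by norm_num)
  refine this.congr_fun (fun y _ => ?_) measurableSet_Ioi
  simp [halfWeight]

lemma integrableOn_halfWeight_sub :
    IntegrableOn (fun v => halfWeight (v - 1 / 2)) (Set.Ioi (1 / 2)) := by
  have h := ((measurePreserving_sub_right volume (1 / 2 : ℝ)).integrableOn_comp_preimage
    (measurableEmbedding_subRight (1 / 2 : ℝ))).mpr integrableOn_halfWeight
  rwa [Set.preimage_sub_const_Ioi, zero_add] at h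

/-- The power factor decreases and is pulled out; the exponential integrates to a factor 8. Hence
the bound survives each further integration. -/
lemma integral_halfWeight_sub_le {σ : ℝ} (hσ : 1 / 2 < σ) :
    ∫ v in Set.Ioi σ, halfWeight (v - 1 / 2) ≤ 8 * halfWeight (σ - 1 / 2) := by
  have hexp : IntegrableOn (fun v : ℝ => Real.exp (-(1 / 8) * v)) (Set.Ioi σ) :=
    integrableOn_exp_mul_Ioi (by norm_num) σ
  have hshift : ∀ v : ℝ, Real.exp (-(1 / 8) * (v - 1 / 2)) =
      Real.exp (1 / 16) * Real.exp (-(1 / 8) * v) := fun v => by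
    rw [← Real.exp_add]
    congr 1
    ring
  calc ∫ v in Set.Ioi σ, halfWeight (v - 1 / 2)
      ≤ ∫ v in Set.Ioi σ, (σ - 1 / 2) ^ (-(1 / 2) : ℝ) * Real.exp (1 / 16) *
          Real.exp (-(1 / 8) * v) := by
        refine setIntegral_mono_on
          (integrableOn_halfWeight_sub.mono_set (Set.Ioi_subset_Ioi hσ.le)) (hexp.const_mul _)
          measurableSet_Ioi fun v hv => ?_
        have hv' : σ < v := hv
        rw [halfWeight, mul_assoc, ← hshift]
        gcongr ?_ * _
        exact Real.rpow_le_rpow_of_nonpos (by linarith) (by linarith) (by norm_num)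
    _ = 8 * halfWeight (σ - 1 / 2) := by
        rw [integral_const_mul, integral_exp_mul_Ioi (by norm_num), halfWeight, hshift]
        ring

/-- The left side is the square of `halfWeight u`. Since u⁻¹ is not integrable at 0, one factor is
kept for the integral and the other is frozen at the lower end point. -/
lemma inv_mul_exp_le {y u : ℝ} (hy : 0 < y) (hyu : y < u) :
    u⁻¹ * Real.exp (-(u / 4)) ≤ halfWeight y * halfWeight u := by
  have hu : 0 < u := hy.trans hyu
  have h1 : u⁻¹ = u ^ (-(1 / 2) : ℝ) * u ^ (-(1 / 2) : ℝ) := by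
    rw [← Real.rpow_add hu, ← Real.rpow_neg_one]
    norm_num
  have h2 : Real.exp (-(u / 4)) = Real.exp (-(1 / 8) * u) * Real.exp (-(1 / 8) * u) := by
    rw [← Real.exp_add]
    congr 1
    ring
  have h3 : halfWeight u ≤ halfWeight y := by
    unfold halfWeight
    refine mul_le_mul (Real.rpow_le_rpow_of_nonpos hy hyu.le (by norm_num))
      (Real.exp_le_exp.mpr (by linarith)) (Real.exp_pos _).le (Real.rpow_nonneg hy.le _)
  calc u⁻¹ * Real.exp (-(u / 4)) = halfWeight u * halfWeight u := by
        rw [h1, h2, halfWeight]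
        ring
    _ ≤ _ := by
        gcongr
        exact halfWeight_nonneg hu.le

lemma exists_norm_iterInt_le (hM : IsLogZ M) (n : ℕ) :
    ∃ K : ℝ, 0 ≤ K ∧ ∀ t : ℝ, 2 ≤ t → ∀ σ : ℝ, 1 / 2 < σ →
      ‖iterInt M (n + 1) (σ + t * Complex.I)‖ ≤ K * Real.log t * halfWeight (σ - 1 / 2) := by
  induction n with
  | zero =>
    obtain ⟨K, hK0, hK⟩ := exists_norm_logZeta_le_log hM
    set G := ∫ v in Set.Ioi (1 / 2 : ℝ), halfWeight (v - 1 / 2) with hG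
    have hG0 : 0 ≤ G := setIntegral_nonneg measurableSet_Ioi fun v hv =>
      halfWeight_nonneg (sub_nonneg.mpr (le_of_lt hv))
    refine ⟨K * G, by positivity, fun t ht σ hσ => ?_⟩
    have hl := half_le_log ht
    have hw := halfWeight_nonneg (sub_nonneg.mpr hσ.le)
    have hI := integrableOn_halfWeight_sub.mono_set (Set.Ioi_subset_Ioi hσ.le)
    rw [zero_add, iterInt, horInt, re_add_mul_I, im_add_mul_I]
    calc _ ≤ ∫ v in Set.Ioi σ, K * Real.log t * halfWeight (σ - 1 / 2) * halfWeight (v - 1 / 2) := by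
          refine norm_integral_le_of_norm_le (hI.const_mul _) ?_
          filter_upwards [ae_restrict_mem measurableSet_Ioi] with v hv
          have hv' : σ < v := hv
          refine (hK t ht v (hσ.trans hv')).trans ?_
          rw [mul_assoc (K * Real.log t)]
          exact mul_le_mul_of_nonneg_left (inv_mul_exp_le (sub_pos.mpr hσ) (sub_lt_sub_right hv' _))
            (by positivity)
      _ = K * Real.log t * halfWeight (σ - 1 / 2) * ∫ v in Set.Ioi σ, halfWeight (v - 1 / 2) :=
          integral_const_mul _ _
      _ ≤ K * Real.log t * halfWeight (σ - 1 / 2) * G := by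
          refine mul_le_mul_of_nonneg_left (setIntegral_mono_set integrableOn_halfWeight_sub ?_
            (Set.Ioi_subset_Ioi hσ.le).eventuallyLE) (by positivity)
          filter_upwards [ae_restrict_mem measurableSet_Ioi] with v hv
          exact halfWeight_nonneg (sub_nonneg.mpr (le_of_lt hv))
      _ = _ := by ring
  | succ n ih =>
    obtain ⟨K, hK0, hK⟩ := ih
    refine ⟨8 * K, by positivity, fun t ht σ hσ => ?_⟩
    have hl := half_le_log ht
    have hI := integrableOn_halfWeight_sub.mono_set (Set.Ioi_subset_Ioi hσ.le)
    rw [iterInt, horInt, re_add_mul_I, im_add_mul_I]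
    calc _ ≤ ∫ v in Set.Ioi σ, K * Real.log t * halfWeight (v - 1 / 2) := by
          refine norm_integral_le_of_norm_le (hI.const_mul _) ?_
          filter_upwards [ae_restrict_mem measurableSet_Ioi] with v hv
          exact hK t ht v (hσ.trans hv)
      _ = K * Real.log t * ∫ v in Set.Ioi σ, halfWeight (v - 1 / 2) := integral_const_mul _ _
      _ ≤ K * Real.log t * (8 * halfWeight (σ - 1 / 2)) := by
          gcongr
          exact integral_halfWeight_sub_le hσ
      _ = _ := by ring

lemma exists_integral_norm_iterInt_le (hM : IsLogZ M) {n : ℕ} (hn : 1 ≤ n) {c : ℝ}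
    (hc : 1 / 2 ≤ c) : ∃ K : ℝ, 0 ≤ K ∧ ∀ t : ℝ, 2 ≤ t →
      ∫ σ in (1 / 2)..c, ‖iterInt M n (σ + t * Complex.I)‖ ≤ K * Real.log t := by
  obtain ⟨k, rfl⟩ : ∃ k, n = k + 1 := ⟨n - 1, by omega⟩
  obtain ⟨K, hK0, hK⟩ := exists_norm_iterInt_le hM k
  have hI : IntegrableOn (fun v => halfWeight (v - 1 / 2)) (Set.Ioc (1 / 2) c) :=
    integrableOn_halfWeight_sub.mono_set Set.Ioc_subset_Ioi_self
  refine ⟨K * ∫ v in Set.Ioc (1 / 2) c, halfWeight (v - 1 / 2),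
    mul_nonneg hK0 (setIntegral_nonneg measurableSet_Ioc fun v hv =>
      halfWeight_nonneg (sub_nonneg.mpr hv.1.le)), fun t ht => ?_⟩
  rw [intervalIntegral.integral_of_le hc]
  calc _ ≤ ∫ v in Set.Ioc (1 / 2) c, K * Real.log t * halfWeight (v - 1 / 2) := by
        refine setIntegral_mono_on ?_ (hI.const_mul _) measurableSet_Ioc fun v hv => hK t ht v hv.1
        exact (((horAdmissible_iterInt hM (k + 1)).integrableOn (by linarith)).mono_set
          Set.Ioc_subset_Ioi_self).norm
    _ = _ := by
        rw [integral_const_mul]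
        ring

/-! ### Moving the contour and correlating S_n with an oscillation -/

lemma continuousOn_iterInt (hM : IsLogZ M) {n : ℕ} (hn : 1 ≤ n) :
    ContinuousOn (iterInt M n) {s | 1 / 2 ≤ s.re ∧ 0 ≤ s.im} := by
  obtain ⟨k, rfl⟩ : ∃ k, n = k + 1 := ⟨n - 1, by omega⟩
  exact (horAdmissible_iterInt hM k).continuousOn_horInt

lemma norm_exp_mul_sub_half (q σ t : ℝ) :
    ‖Complex.exp (q * ((σ : ℂ) + t * Complex.I - 1 / 2))‖ = Real.exp (q * (σ - 1 / 2)) := by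
  rw [Complex.norm_exp]
  congr 1
  rw [Complex.re_ofReal_mul, Complex.sub_re, re_add_mul_I]
  norm_num

/-- Moving the line of integration from the critical line to the right. -/
lemma norm_integral_sub_integral_le (hM : IsLogZ M) {n : ℕ} (hn : 1 ≤ n) {c T : ℝ} (hc : 1 / 2 ≤ c)
    (hT : 1 ≤ T) (q : ℝ) :
    ‖(∫ t in (1 : ℝ)..T, iterInt M n ((1 / 2 : ℝ) + t * Complex.I) * Complex.exp (q * t * Complex.I)) -
      Real.exp (q * (c - 1 / 2)) *
        ∫ t in (1 : ℝ)..T, iterInt M n (c + t * Complex.I) * Complex.exp (q * t * Complex.I)‖ ≤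
      Real.exp (|q| * (c - 1 / 2)) *
        ((∫ σ in (1 / 2)..c, ‖iterInt M n (σ + (1 : ℝ) * Complex.I)‖) +
          ∫ σ in (1 / 2)..c, ‖iterInt M n (σ + T * Complex.I)‖) := by
  -- Q restricts to the integrand on the critical line and gains the factor e^{q(c - 1/2)} on Re s =
  -- c.
  set Q : ℂ → ℂ := fun s => iterInt M n s * Complex.exp (q * (s - 1 / 2)) with hQ
  have hQc : ContinuousOn Q {s | 1 / 2 ≤ s.re ∧ 0 ≤ s.im} :=
    (continuousOn_iterInt hM hn).mul (by fun_prop)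
  have hQd : DifferentiableOn ℂ Q {s | 1 / 2 < s.re ∧ 0 < s.im} :=
    (horAdmissible_iterInt hM n).differentiableOn.mul (by fun_prop)
  -- Holomorphy inside and continuity up to the boundary suffice, so zeros on the critical side do
  -- no harm.
  have hrect := Complex.integral_boundary_rect_eq_zero_of_continuousOn_of_differentiableOn Q
    ((1 / 2 : ℝ) + (1 : ℝ) * Complex.I) (c + T * Complex.I)
  simp only [re_add_mul_I, im_add_mul_I, min_eq_left hc, max_eq_right hc, min_eq_left hT,
    max_eq_right hT, Set.uIcc_of_le hc, Set.uIcc_of_le hT, smul_eq_mul] at hrect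
  have hrect := hrect (hQc.mono fun s hs => ⟨hs.1.1, by linarith [hs.2.1]⟩)
    (hQd.mono fun s hs => ⟨hs.1.1, by linarith [hs.2.1]⟩)
  have hleft : ∫ t in (1 : ℝ)..T, Q ((1 / 2 : ℝ) + t * Complex.I) = ∫ t in (1 : ℝ)..T,
      iterInt M n ((1 / 2 : ℝ) + t * Complex.I) * Complex.exp (q * t * Complex.I) := by
    refine intervalIntegral.integral_congr fun t _ => ?_
    simp only [hQ]
    congr 2
    push_cast
    ring
  have hright : ∫ t in (1 : ℝ)..T, Q (c + t * Complex.I) = Real.exp (q * (c - 1 / 2)) *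
      ∫ t in (1 : ℝ)..T, iterInt M n (c + t * Complex.I) * Complex.exp (q * t * Complex.I) := by
    rw [← intervalIntegral.integral_const_mul]
    refine intervalIntegral.integral_congr fun t _ => ?_
    simp only [hQ]
    rw [show (q : ℂ) * (c + t * Complex.I - 1 / 2) = ((q * (c - 1 / 2) : ℝ) : ℂ) + q * t * Complex.I by
      push_cast
      ring, Complex.exp_add, Complex.ofReal_exp]
    ring
  have hhor : ∀ t : ℝ, 1 ≤ t → ‖∫ σ in (1 / 2)..c, Q (σ + t * Complex.I)‖ ≤
      Real.exp (|q| * (c - 1 / 2)) * ∫ σ in (1 / 2)..c, ‖iterInt M n (σ + t * Complex.I)‖ := by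
    intro t ht
    rw [← intervalIntegral.integral_const_mul]
    refine intervalIntegral.norm_integral_le_of_norm_le hc (ae_of_all _ fun σ hσ => ?_) ?_
    · simp only [hQ]
      rw [norm_mul, norm_exp_mul_sub_half, mul_comm]
      gcongr ?_ * _
      refine Real.exp_le_exp.mpr ?_
      calc q * (σ - 1 / 2) ≤ |q| * (σ - 1 / 2) := by
            gcongr
            · linarith [hσ.1]
            · exact le_abs_self q
        _ ≤ _ := by
            gcongr
            exact hσ.2
    · refine (ContinuousOn.intervalIntegrable ?_).const_mul _
      rw [Set.uIcc_of_le hc]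
      refine ((continuousOn_iterInt hM hn).comp (by fun_prop) fun σ hσ => ⟨?_, ?_⟩).norm
      · rw [re_add_mul_I]; exact hσ.1
      · rw [im_add_mul_I]; linarith
  rw [← hleft, ← hright]
  set a := ∫ σ in (1 / 2)..c, Q (σ + (1 : ℝ) * Complex.I)
  set b := ∫ σ in (1 / 2)..c, Q (σ + T * Complex.I)
  have hab : ‖a - b‖ ≤ _ := (norm_sub_le a b).trans (add_le_add (hhor 1 le_rfl) (hhor T hT))
  rw [← mul_add] at hab
  refine le_trans (le_of_eq ?_) hab
  rw [show a - b = Complex.I * ((∫ t in (1 : ℝ)..T, Q ((1 / 2 : ℝ) + t * Complex.I)) -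
    ∫ t in (1 : ℝ)..T, Q (c + t * Complex.I)) by linear_combination hrect, norm_mul,
    Complex.norm_I, one_mul]

/-- The absolute values of the terms of `mangoldtSeries (n + 1)` on the line `Re s = c`. -/
def termNorm (n : ℕ) (c : ℝ) (k : ℕ) : ℝ :=
  vonMangoldt k / Real.log k ^ (n + 1) * (k : ℝ) ^ (-c)

lemma termNorm_nonneg (n : ℕ) (c : ℝ) (k : ℕ) : 0 ≤ termNorm n c k :=
  mul_nonneg (div_nonneg ArithmeticFunction.vonMangoldt_nonneg
    (pow_nonneg (Real.log_natCast_nonneg k) _)) (Real.rpow_nonneg (Nat.cast_nonneg k) _)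

lemma termNorm_eq_zero (n : ℕ) (c : ℝ) {k : ℕ} (hk : k < 2) : termNorm n c k = 0 := by
  have : vonMangoldt k = 0 := by
    interval_cases k <;> simp
  rw [termNorm, this, zero_div, zero_mul]

lemma summable_termNorm (n : ℕ) {c : ℝ} (hc : 1 < c) : Summable (termNorm n c) := by
  have h := (lseriesSummable_mangoldt n (s := (c : ℂ)) (by simpa using hc)).norm
  refine h.congr fun k => ?_
  rw [norm_term_mangoldt, Complex.ofReal_re, termNorm]

lemma term_mangoldt_eq (n : ℕ) (c t : ℝ) (k : ℕ) :
    LSeries.term (fun k => ((vonMangoldt k / Real.log k ^ (n + 1) : ℝ) : ℂ)) (c + t * Complex.I) k =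
      termNorm n c k * Complex.exp ((-Real.log k : ℝ) * t * Complex.I) := by
  rcases Nat.eq_zero_or_pos k with rfl | hk
  · simp [termNorm]
  · have hk0 : (k : ℂ) ≠ 0 := by exact_mod_cast hk.ne'
    rw [LSeries.term_of_ne_zero hk.ne', termNorm, Complex.ofReal_mul,
      Complex.ofReal_cpow (Nat.cast_nonneg k), div_eq_mul_inv, ← Complex.cpow_neg, neg_add,
      Complex.cpow_add _ _ hk0, mul_assoc]
    congr 2
    · push_cast
      rfl
    · rw [← natCast_cpow_neg_I_mul hk]
      congr 1
      ring

/-- On the line `Re s = c` all terms but one oscillate. -/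
lemma norm_integral_mangoldtSeries_sub_le (n : ℕ) {c T : ℝ} (hc : 1 < c)
    (q : ℝ) (k₀ : ℕ) {B : ℝ} (hB0 : 0 ≤ B)
    (hB : ∀ k : ℕ, 2 ≤ k → k ≠ k₀ → q - Real.log k ≠ 0 ∧ 2 / |q - Real.log k| ≤ B) :
    ‖(∫ t in (1 : ℝ)..T, mangoldtSeries (n + 1) (c + t * Complex.I) *
        Complex.exp (q * t * Complex.I)) -
      termNorm n c k₀ * ∫ t in (1 : ℝ)..T, Complex.exp ((q - Real.log k₀ : ℝ) * t * Complex.I)‖ ≤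
      B * ∑' k, termNorm n c k := by
  have hsum := summable_termNorm n hc
  have hS : HasSum (fun k : ℕ => ∫ t in (1 : ℝ)..T,
      termNorm n c k * Complex.exp ((q - Real.log k : ℝ) * t * Complex.I))
      (∫ t in (1 : ℝ)..T, mangoldtSeries (n + 1) (c + t * Complex.I) *
        Complex.exp (q * t * Complex.I)) := by
    refine intervalIntegral.hasSum_integral_of_dominated_convergence
      (fun k _ => termNorm n c k) (fun k => ?_) (fun k => ae_of_all _ fun t _ => ?_)
      (ae_of_all _ fun t _ => hsum) intervalIntegrable_const (ae_of_all _ fun t _ => ?_)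
    · exact (by fun_prop : Continuous fun t : ℝ => (termNorm n c k : ℂ) *
        Complex.exp ((q - Real.log k : ℝ) * t * Complex.I)).aestronglyMeasurable
    · rw [norm_mul, ← Complex.ofReal_mul, Complex.norm_exp_ofReal_mul_I, mul_one, Complex.norm_real,
        Real.norm_of_nonneg (termNorm_nonneg n c k)]
    · have h := (lseriesSummable_mangoldt n (s := c + t * Complex.I)
        (by rwa [re_add_mul_I])).hasSum.mul_right (Complex.exp (q * t * Complex.I))
      refine h.congr_fun fun k => ?_
      rw [term_mangoldt_eq, mul_assoc (termNorm n c k : ℂ), ← Complex.exp_add]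
      congr 2
      push_cast
      ring
  simp only [intervalIntegral.integral_const_mul] at hS
  have hd := hS.sub (hasSum_ite_eq k₀ ((termNorm n c k₀ : ℂ) * ∫ t in (1 : ℝ)..T,
    Complex.exp ((q - Real.log k₀ : ℝ) * t * Complex.I)))
  refine hd.norm_le_of_bounded (hsum.hasSum.mul_left B) fun k => ?_
  split_ifs with hk
  · subst hk
    rw [sub_self, norm_zero]
    exact mul_nonneg hB0 (termNorm_nonneg n c k)
  · rw [sub_zero, norm_mul, Complex.norm_real, Real.norm_of_nonneg (termNorm_nonneg n c k), mul_comm]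
    rcases lt_or_ge k 2 with hk2 | hk2
    · rw [termNorm_eq_zero n c hk2, mul_zero, mul_zero]
    · obtain ⟨h1, h2⟩ := hB k hk2 hk
      exact mul_le_mul_of_nonneg_right ((norm_integral_exp_mul_I_le h1 1 T).trans h2)
        (termNorm_nonneg n c k)

/-- The nearest integers to m are the worst case, with gap at least 1/(m+1); then 2(m+1) ≤ 4m. -/
lemma two_div_abs_log_sub_log_le {m k : ℕ} (hm : 2 ≤ m) (hk : 2 ≤ k) (hkm : k ≠ m) :
    Real.log m - Real.log k ≠ 0 ∧ 2 / |Real.log m - Real.log k| ≤ 4 * m := by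
  have hm0 : (2 : ℝ) ≤ m := by exact_mod_cast hm
  have key : 1 / ((m + 1 : ℕ) : ℝ) ≤ |Real.log m - Real.log k| := by
    rcases le_or_gt k (m + 1) with h | h
    · exact one_div_le_abs_log_sub_log (by omega) (by omega) h (by omega) hkm
    · have h1 := one_div_le_abs_log_sub_log (N := m + 1) (m := m + 1) (k := m) (by omega) (by omega)
        le_rfl (by omega) (by omega)
      have h2 : Real.log m ≤ Real.log ((m + 1 : ℕ) : ℝ) :=
        Real.log_le_log (by linarith) (by exact_mod_cast m.le_succ)
      have h3 : Real.log ((m + 1 : ℕ) : ℝ) ≤ Real.log k :=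
        Real.log_le_log (by positivity) (by exact_mod_cast h.le)
      rw [abs_of_nonpos (by linarith)] at h1 ⊢
      linarith
  have hpos : 0 < 1 / ((m + 1 : ℕ) : ℝ) := by positivity
  have habs := hpos.trans_le key
  refine ⟨abs_pos.mp habs, ?_⟩
  rw [div_le_iff₀ habs]
  have h4 : 1 / ((m + 1 : ℕ) : ℝ) * (4 * m) ≥ 2 := by
    push_cast
    rw [ge_iff_le, div_mul_eq_mul_div, le_div_iff₀ (by positivity)]
    linarith
  nlinarith

/-- The shift factor m^{c-1/2} turns m^{-c} back into m^{-1/2}: the main term does not depend on c.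
-/
lemma coeff_eq (n : ℕ) (c : ℝ) {m : ℕ} (hm : 1 ≤ m) :
    Real.exp (Real.log m * (c - 1 / 2)) * termNorm n c m = coeff n m := by
  have hm0 : (0 : ℝ) < m := by exact_mod_cast hm
  rw [← Real.rpow_def_of_pos hm0, termNorm, coeff, mul_left_comm, ← Real.rpow_add hm0,
    show c - 1 / 2 + -c = -(1 / 2) by ring, Real.rpow_neg hm0.le, ← Real.sqrt_eq_rpow]
  field_simp

lemma coeff_nonneg (n m : ℕ) : 0 ≤ coeff n m :=
  div_nonneg ArithmeticFunction.vonMangoldt_nonneg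
    (mul_nonneg (Real.sqrt_nonneg _) (pow_nonneg (Real.log_natCast_nonneg m) _))

lemma coeff_le (n : ℕ) {m : ℕ} (hm : 1 ≤ m) : coeff n m ≤ (Real.log 2 ^ n)⁻¹ := by
  have h := norm_mangoldt_div_le n m
  rw [Complex.norm_real] at h
  refine le_trans ?_ ((le_abs_self _).trans h)
  have h1 : 1 ≤ Real.sqrt m := Real.one_le_sqrt.mpr (by exact_mod_cast hm)
  rw [coeff, ← div_div, div_right_comm]
  exact div_le_self (div_nonneg ArithmeticFunction.vonMangoldt_nonneg
    (pow_nonneg (Real.log_natCast_nonneg m) _)) h1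

lemma intervalIntegrable_Sn (hM : IsLogZ M) {n : ℕ} (hn : 1 ≤ n) {T : ℝ} (hT : 1 ≤ T) :
    IntervalIntegrable (Sn n) volume 1 T := by
  refine ContinuousOn.intervalIntegrable ?_
  rw [Set.uIcc_of_le hT]
  have h : ContinuousOn (fun t => 1 / Real.pi * phase M n (1 / 2) t) (Set.Icc 1 T) := by
    refine continuousOn_const.mul (Complex.continuous_im.comp_continuousOn
      (continuousOn_const.mul ((continuousOn_iterInt hM hn).comp (by fun_prop) fun t ht => ⟨?_, ?_⟩)))
    · rw [re_add_mul_I]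
    · rw [im_add_mul_I]; linarith [ht.1]
  exact h.congr fun t ht => Sn_eq hM hn (by linarith [ht.1])

lemma integral_Sn_mul_osc (hM : IsLogZ M) {n : ℕ} (hn : 1 ≤ n) {m : ℕ} (hm : 1 ≤ m) {T : ℝ}
    (hT : 1 ≤ T) :
    ∫ t in (1 : ℝ)..T, Sn n t * osc n m t = 1 / Real.pi * (1 / 2 *
      ((∫ t in (1 : ℝ)..T, iterInt M n ((1 / 2 : ℝ) + t * Complex.I) *
          Complex.exp ((Real.log m : ℝ) * t * Complex.I)) -
        (-1) ^ n * ∫ t in (1 : ℝ)..T, iterInt M n ((1 / 2 : ℝ) + t * Complex.I) *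
          Complex.exp ((-Real.log m : ℝ) * t * Complex.I)).re) := by
  have hint : ∀ q : ℝ, IntervalIntegrable (fun t : ℝ => iterInt M n ((1 / 2 : ℝ) + t * Complex.I) *
      Complex.exp (q * t * Complex.I)) volume 1 T := by
    intro q
    refine ContinuousOn.intervalIntegrable ?_
    rw [Set.uIcc_of_le hT]
    refine ((continuousOn_iterInt hM hn).comp (by fun_prop) fun t ht => ⟨?_, ?_⟩).mul (by fun_prop)
    · rw [re_add_mul_I]
    · rw [im_add_mul_I]; linarith [ht.1]
  have h1 : ∀ t ∈ Set.uIcc 1 T, Sn n t * osc n m t = 1 / Real.pi * (1 / 2 *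
      (iterInt M n ((1 / 2 : ℝ) + t * Complex.I) * Complex.exp ((Real.log m : ℝ) * t * Complex.I) -
        (-1) ^ n * (iterInt M n ((1 / 2 : ℝ) + t * Complex.I) *
          Complex.exp ((-Real.log m : ℝ) * t * Complex.I))).re) := by
    intro t ht
    rw [Set.uIcc_of_le hT] at ht
    rw [Sn_eq hM hn (by linarith [ht.1]), osc_eq n hm, mul_assoc, phase, im_I_pow_mul_mul_im,
      conj_exp_ofReal_mul_I, neg_neg]
  rw [intervalIntegral.integral_congr h1, intervalIntegral.integral_const_mul,
    intervalIntegral.integral_const_mul]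
  congr 2
  rw [← intervalIntegral.integral_const_mul,
    ← intervalIntegral.integral_sub (hint _) ((hint _).const_mul _)]
  exact Complex.reCLM.intervalIntegral_comp_comm ((hint _).sub ((hint _).const_mul _))

/-- The integral of an oscillation against the boundary values of `iterInt M n`: only the diagonal
term of the Dirichlet series contributes. -/
lemma norm_integral_iterInt_sub_le (hM : IsLogZ M) {n : ℕ} (hn : 1 ≤ n) {c T : ℝ} (hc : 1 < c)
    (hT : 1 ≤ T) {q ℓ : ℝ} (hq : |q| = ℓ) (k₀ : ℕ) {B : ℝ} (hB0 : 0 ≤ B)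
    (hB : ∀ k : ℕ, 2 ≤ k → k ≠ k₀ → q - Real.log k ≠ 0 ∧ 2 / |q - Real.log k| ≤ B) :
    ‖(∫ t in (1 : ℝ)..T, iterInt M n ((1 / 2 : ℝ) + t * Complex.I) *
        Complex.exp (q * t * Complex.I)) - Real.exp (q * (c - 1 / 2)) * (termNorm n c k₀ *
          ∫ t in (1 : ℝ)..T, Complex.exp ((q - Real.log k₀ : ℝ) * t * Complex.I))‖ ≤
      Real.exp (ℓ * (c - 1 / 2)) * ((∫ σ in (1 / 2)..c, ‖iterInt M n (σ + (1 : ℝ) * Complex.I)‖) +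
        (∫ σ in (1 / 2)..c, ‖iterInt M n (σ + T * Complex.I)‖) + B * ∑' k, termNorm n c k) := by
  have e1 := norm_integral_sub_integral_le hM hn (by linarith : 1 / 2 ≤ c) hT q
  have e2 := norm_integral_mangoldtSeries_sub_le n (T := T) hc q k₀ hB0 hB
  have e3 : ∫ t in (1 : ℝ)..T, iterInt M n (c + t * Complex.I) * Complex.exp (q * t * Complex.I) =
      ∫ t in (1 : ℝ)..T, mangoldtSeries (n + 1) (c + t * Complex.I) *
        Complex.exp (q * t * Complex.I) := by
    refine intervalIntegral.integral_congr fun t ht => ?_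
    rw [Set.uIcc_of_le hT] at ht
    exact congrArg (· * _) (iterInt_eq_mangoldtSeries hM n c t hc (by linarith [ht.1]))
  rw [e3, hq] at e1
  rw [mul_add]
  refine (norm_sub_le_norm_sub_add_norm_sub _ _ _).trans (add_le_add e1 ?_)
  rw [← mul_sub, norm_mul, Complex.norm_real, Real.norm_of_nonneg (Real.exp_pos _).le]
  refine mul_le_mul (Real.exp_le_exp.mpr ?_) e2 (norm_nonneg _) (Real.exp_pos _).le
  rw [← hq]
  exact mul_le_mul_of_nonneg_right (le_abs_self q) (by linarith)

lemma norm_integral_iterInt_mul_exp_log_sub_le (hM : IsLogZ M) {n : ℕ} (hn : 1 ≤ n) {c T : ℝ}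
    (hc : 1 < c) (hT : 1 ≤ T) {m : ℕ} (hm : 2 ≤ m) :
    ‖(∫ t in (1 : ℝ)..T, iterInt M n ((1 / 2 : ℝ) + t * Complex.I) *
        Complex.exp ((Real.log m : ℝ) * t * Complex.I)) - ((T - 1) * coeff n m : ℝ)‖ ≤
      Real.exp (Real.log m * (c - 1 / 2)) *
        ((∫ σ in (1 / 2)..c, ‖iterInt M n (σ + (1 : ℝ) * Complex.I)‖) +
        (∫ σ in (1 / 2)..c, ‖iterInt M n (σ + T * Complex.I)‖) + 4 * m * ∑' k, termNorm n c k) := by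
  have e := norm_integral_iterInt_sub_le hM hn hc hT (abs_of_nonneg (Real.log_natCast_nonneg m)) m
    (by positivity : (0 : ℝ) ≤ 4 * m) fun k hk hkm => two_div_abs_log_sub_log_le hm hk hkm
  have e3 : ∫ t in (1 : ℝ)..T, Complex.exp ((Real.log m - Real.log m : ℝ) * t * Complex.I) =
      ((T - 1 : ℝ) : ℂ) := by
    simp
  rw [e3, ← mul_assoc, ← Complex.ofReal_mul, coeff_eq n c (by omega : 1 ≤ m),
    ← Complex.ofReal_mul, mul_comm (coeff n m)] at e
  exact e

lemma norm_integral_iterInt_mul_exp_neg_log_le (hM : IsLogZ M) {n : ℕ} (hn : 1 ≤ n) {c T : ℝ}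
    (hc : 1 < c) (hT : 1 ≤ T) {m : ℕ} (hm : 2 ≤ m) :
    ‖∫ t in (1 : ℝ)..T, iterInt M n ((1 / 2 : ℝ) + t * Complex.I) *
        Complex.exp ((-Real.log m : ℝ) * t * Complex.I)‖ ≤
      Real.exp (Real.log m * (c - 1 / 2)) *
        ((∫ σ in (1 / 2)..c, ‖iterInt M n (σ + (1 : ℝ) * Complex.I)‖) +
        (∫ σ in (1 / 2)..c, ‖iterInt M n (σ + T * Complex.I)‖) + 4 * m * ∑' k, termNorm n c k) := by
  have hm2 : (2 : ℝ) ≤ m := by exact_mod_cast hm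
  -- Frequency -log m resonates with no term; the exceptional index 0 is a dummy with zero
  -- coefficient.
  have e := norm_integral_iterInt_sub_le hM hn hc hT
    ((abs_neg _).trans (abs_of_nonneg (Real.log_natCast_nonneg m))) 0
    (by positivity : (0 : ℝ) ≤ 4 * m) fun k hk _ => by
      have h3 := two_div_abs_log_add_log_le hm hk
      have hlk : 0 < Real.log k := Real.log_pos (by exact_mod_cast hk)
      have hlm : 0 < Real.log m := Real.log_pos (by linarith)
      rw [show -Real.log m - Real.log k = -(Real.log k + Real.log m) by ring]
      exact ⟨by linarith, by linarith⟩
  rw [termNorm_eq_zero n c (by norm_num), Complex.ofReal_zero, zero_mul, mul_zero, sub_zero] at e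
  exact e

/-- The correlation of `S_n` with a single oscillation. -/
theorem exists_abs_integral_Sn_mul_osc_sub_le (hM : IsLogZ M) {n : ℕ} (hn : 1 ≤ n) {c : ℝ}
    (hc : 1 < c) : ∃ K : ℝ, 0 ≤ K ∧ ∀ T : ℝ, 2 ≤ T → ∀ m : ℕ, 2 ≤ m →
      |(∫ t in (1 : ℝ)..T, Sn n t * osc n m t) - T / (2 * Real.pi) * coeff n m| ≤
        K * (m : ℝ) ^ (c + 1 / 2) * Real.log T := by
  have hc2 : 1 / 2 ≤ c := by linarith
  obtain ⟨K, hK0, hK⟩ := exists_integral_norm_iterInt_le hM hn hc2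
  set b := ∫ σ in (1 / 2)..c, ‖iterInt M n (σ + (1 : ℝ) * Complex.I)‖ with hb
  have hb0 : 0 ≤ b := intervalIntegral.integral_nonneg hc2 fun σ _ => norm_nonneg _
  set D := ∑' k, termNorm n c k with hD
  have hD0 : 0 ≤ D := tsum_nonneg (termNorm_nonneg n c)
  have hκ : 0 ≤ (Real.log 2 ^ n)⁻¹ := by
    have := Real.log_nonneg (by norm_num : (1 : ℝ) ≤ 2)
    positivity
  -- b and K belong to the horizontal sides at heights 1 and T, 8D to the nonresonant terms, and the
  -- last summand to replacing T - 1 by T. The doubling uses 1 ≤ 2 log T.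
  refine ⟨2 * b + K + 8 * D + 2 * (Real.log 2 ^ n)⁻¹, by positivity, fun T hT m hm => ?_⟩
  have hT1 : 1 ≤ T := by linarith
  have hlT := half_le_log hT
  have hm1 : (1 : ℝ) ≤ m := by exact_mod_cast (by omega : 1 ≤ m)
  have hm0 : (0 : ℝ) < m := by linarith
  have h1 := norm_integral_iterInt_mul_exp_log_sub_le hM hn hc hT1 hm
  have h2 := norm_integral_iterInt_mul_exp_neg_log_le hM hn hc hT1 hm
  rw [integral_Sn_mul_osc hM hn (by omega) hT1]
  rw [← hb, ← hD] at h1 h2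
  have hBT := hK T hT
  have hcoeff := coeff_le n (by omega : 1 ≤ m)
  have hcoeff0 := coeff_nonneg n m
  generalize coeff n m = κ at *
  generalize (∫ t in (1 : ℝ)..T, iterInt M n ((1 / 2 : ℝ) + t * Complex.I) *
    Complex.exp ((Real.log m : ℝ) * t * Complex.I)) = Jp at *
  generalize (∫ t in (1 : ℝ)..T, iterInt M n ((1 / 2 : ℝ) + t * Complex.I) *
    Complex.exp ((-Real.log m : ℝ) * t * Complex.I)) = Jm at *
  generalize (∫ σ in (1 / 2)..c, ‖iterInt M n (σ + T * Complex.I)‖) = BT at *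
  have hpP : Real.exp (Real.log m * (c - 1 / 2)) * m = (m : ℝ) ^ (c + 1 / 2) := by
    rw [← Real.rpow_def_of_pos hm0, ← Real.rpow_add_one hm0.ne']
    congr 1
    ring
  have hp1 : 1 ≤ Real.exp (Real.log m * (c - 1 / 2)) :=
    Real.one_le_exp (mul_nonneg (Real.log_natCast_nonneg m) (by linarith))
  generalize (m : ℝ) ^ (c + 1 / 2) = P at *
  generalize Real.exp (Real.log m * (c - 1 / 2)) = p at *
  clear_value b D
  have hpleP : p ≤ P := by
    rw [← hpP]
    exact le_mul_of_one_le_right (by linarith) hm1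
  have h3 : ‖Jp - (T * κ : ℝ)‖ ≤ p * (b + BT + 4 * m * D) + κ := by
    have e : Jp - ((T * κ : ℝ) : ℂ) = (Jp - ((T - 1) * κ : ℝ)) - (κ : ℂ) := by
      push_cast
      ring
    rw [e]
    refine (norm_sub_le _ _).trans (add_le_add h1 ?_)
    rw [Complex.norm_real, Real.norm_of_nonneg hcoeff0]
  have h4 := abs_half_re_sub_le n (Jp - (T * κ : ℝ)) Jm
  have h5 : 1 / Real.pi * (1 / 2 * (Jp - (-1) ^ n * Jm).re) - T / (2 * Real.pi) * κ =
      1 / Real.pi * (1 / 2 * (Jp - (T * κ : ℝ) - (-1) ^ n * Jm).re) := by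
    rw [sub_right_comm Jp, Complex.sub_re (Jp - _), Complex.ofReal_re]
    field_simp
  have hpi : 1 / Real.pi ≤ 1 := by
    rw [div_le_one Real.pi_pos]
    linarith [Real.pi_gt_three]
  rw [h5, abs_mul, abs_of_pos (one_div_pos.mpr Real.pi_pos)]
  have hP1 : 1 ≤ P := hp1.trans hpleP
  have hPl : P ≤ 2 * (P * Real.log T) := by nlinarith
  have h6 : p * (b + BT + 4 * m * D) ≤ P * b + K * (P * Real.log T) + 4 * D * P := by
    calc p * (b + BT + 4 * m * D) = p * b + p * BT + 4 * D * (p * m) := by ring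
      _ ≤ P * b + P * (K * Real.log T) + 4 * D * P := by
          rw [hpP]
          have e1 : p * b ≤ P * b := by gcongr
          have e2 : p * BT ≤ P * (K * Real.log T) :=
            (mul_le_mul_of_nonneg_left hBT (by linarith)).trans
              (mul_le_mul_of_nonneg_right hpleP (by positivity))
          linarith
      _ = _ := by ring
  have h7 : κ ≤ (Real.log 2 ^ n)⁻¹ * (2 * (P * Real.log T)) :=
    hcoeff.trans (le_mul_of_one_le_right hκ (hP1.trans hPl))
  have h8 : P * b ≤ 2 * (P * Real.log T) * b := by gcongr
  have h9 : 4 * D * P ≤ 4 * D * (2 * (P * Real.log T)) := by gcongr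
  calc _ ≤ 1 * |1 / 2 * (Jp - (T * κ : ℝ) - (-1) ^ n * Jm).re| := by gcongr
    _ ≤ 1 / 2 * (‖Jp - (T * κ : ℝ)‖ + ‖Jm‖) := by rw [one_mul]; exact h4
    _ ≤ p * (b + BT + 4 * m * D) + κ := by linarith
    _ ≤ 2 * (P * Real.log T) * b + K * (P * Real.log T) + 4 * D * (2 * (P * Real.log T)) +
        (Real.log 2 ^ n)⁻¹ * (2 * (P * Real.log T)) := by linarith
    _ = _ := by ring

/-! ### Conclusion -/

lemma eventually_rpow_mul_log_le {a : ℝ} (ha : a < 1) (k : ℕ) :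
    ∀ᶠ T : ℝ in atTop, T ^ a * Real.log T ≤ T / Real.log T ^ k := by
  have h := (isLittleO_log_rpow_rpow_atTop ((k + 1 : ℕ) : ℝ) (sub_pos.mpr ha)).bound one_pos
  filter_upwards [h, eventually_ge_atTop 2] with T hT hT2
  have hl := half_le_log hT2
  have hT0 : 0 < T := by linarith
  rw [Real.rpow_natCast, one_mul, Real.norm_of_nonneg (by positivity),
    Real.norm_of_nonneg (by positivity)] at hT
  rw [le_div_iff₀ (by positivity), mul_assoc, ← pow_succ']
  calc T ^ a * Real.log T ^ (k + 1) ≤ T ^ a * T ^ (1 - a) := by gcongr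
    _ = T := by
      rw [← Real.rpow_add hT0, add_sub_cancel, Real.rpow_one]

/-- The difference of the two moments, with a power saving, as a sum over prime powers. -/
theorem exists_abs_H_sub_G_sub_le (hM : IsLogZ M) {n : ℕ} (hn : 1 ≤ n) {c : ℝ} (hc : 1 < c) :
    ∃ K : ℝ, 0 ≤ K ∧ ∀ T : ℝ, 2 ≤ T → ∀ x : ℝ, 4 ≤ x →
      |H n x T - G n x T - T / (2 * Real.pi ^ 2) * ∑ m ∈ Finset.Icc 2 ⌊x⌋₊, coeffSq n m *
        (2 * f n (Real.log m / Real.log x) - f n (Real.log m / Real.log x) ^ 2)| ≤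
        K * (x ^ (c + 1) * Real.log T + x ^ (2 : ℝ)) := by
  obtain ⟨K, hK0, hK⟩ := exists_abs_integral_Sn_mul_osc_sub_le hM hn hc
  have hC := C_nonneg hn
  refine ⟨K * Real.sqrt (C n) + 2 * C n, by positivity, fun T hT x hx => ?_⟩
  have hl := half_le_log hT
  have hx0 : 0 < x := by linarith
  have hH := abs_H_sub_le hn hx (T := T) (E := K * x ^ (c + 1 / 2) * Real.log T)
    (intervalIntegrable_Sn hM hn (by linarith)) fun m hm => by
      rw [Finset.mem_Icc] at hm
      refine (hK T hT m hm.1).trans ?_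
      gcongr
      exact (Nat.cast_le.mpr hm.2).trans (Nat.floor_le hx0.le)
  have hG := abs_G_sub_le hn hx T
  have hsplit : ∑ m ∈ Finset.Icc 2 ⌊x⌋₊, coeffSq n m *
      (2 * f n (Real.log m / Real.log x) - f n (Real.log m / Real.log x) ^ 2) =
      (∑ m ∈ Finset.Icc 2 ⌊x⌋₊, 2 * (coeffSq n m * f n (Real.log m / Real.log x))) -
        ∑ m ∈ Finset.Icc 2 ⌊x⌋₊, smoothCoeff n x m ^ 2 := by
    rw [← Finset.sum_sub_distrib]
    refine Finset.sum_congr rfl fun m _ => ?_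
    rw [smoothCoeff, mul_pow, coeff_sq]
    ring
  -- The ℓ¹ norm of the coefficients contributes x^{1/2} and raises the exponent from c + 1/2 to c +
  -- 1.
  have hpow : K * x ^ (c + 1 / 2) * Real.log T * Real.sqrt (x * C n) =
      K * Real.sqrt (C n) * (x ^ (c + 1) * Real.log T) := by
    rw [Real.sqrt_mul hx0.le, Real.sqrt_eq_rpow x,
      show c + 1 = (c + 1 / 2) + 1 / 2 by ring, Real.rpow_add hx0 (c + 1 / 2)]
    ring
  rw [hpow] at hH
  rw [← Real.rpow_ofNat x] at hG
  rw [hsplit, mul_sub, sub_sub_sub_comm]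
  refine (abs_sub _ _).trans ((add_le_add hH hG).trans ?_)
  have e1 : 0 ≤ x ^ (c + 1) * Real.log T := by positivity
  have e2 : 0 ≤ x ^ (2 : ℝ) := by positivity
  have e3 : 0 ≤ K * Real.sqrt (C n) := by positivity
  nlinarith [mul_nonneg e3 e2, mul_nonneg hC e1]

end ZetaSn

end

theorem mainTheorem5 (n : ℕ) (hn : 1 ≤ n) (β : ℝ) (hβ₀ : 0 < β) (hβ₁ : β < 1 / 2)
    (hRH : RiemannHypothesis) :
    (fun T : ℝ =>
        (ZetaSn.H n (T ^ β) T - ZetaSn.G n (T ^ β) T) -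
          (T / (2 * Real.pi ^ 2) * ZetaSn.C n -
            T / (2 * Real.pi ^ 2 * β ^ (2 * n) * Real.log T ^ (2 * n)) *
              (ZetaSn.A n + 1 / (2 * (n : ℝ)))))
      =O[Filter.atTop] (fun T : ℝ => T / Real.log T ^ (2 * n + 1)) := by
  obtain ⟨M, hM⟩ := ZetaSn.exists_isLogZ hRH
  -- The choice c = 1/(2β) exceeds 1 exactly because β < 1/2, and it gives T^{β(c+1)} = T^{1/2+β}
  -- with exponent below 1.
  have hc : 1 < 1 / (2 * β) := by
    rw [lt_div_iff₀ (by positivity)]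
    linarith
  obtain ⟨K, hK0, hK⟩ := ZetaSn.exists_abs_H_sub_G_sub_le hM hn hc
  obtain ⟨K', hK'0, hK'⟩ := ZetaSn.exists_abs_sum_weighted_sub_le hn
  refine Asymptotics.IsBigO.of_bound (K * (1 + 2) + K' / (2 * Real.pi ^ 2 * β ^ (2 * n + 1))) ?_
  filter_upwards [Filter.eventually_ge_atTop 2,
    (tendsto_rpow_atTop hβ₀).eventually_ge_atTop 4,
    ZetaSn.eventually_rpow_mul_log_le (a := 1 / 2 + β) (by linarith) (2 * n + 1),
    ZetaSn.eventually_rpow_mul_log_le (a := β * 2) (by linarith) (2 * n + 1)] with T hT hx hT1 hT2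
  have hl := ZetaSn.half_le_log hT
  have hT0 : 0 < T := by linarith
  have h1 := hK T hT _ hx
  have h2 := hK' _ hx
  rw [Real.log_rpow hT0] at h1 h2
  rw [← Real.rpow_mul hT0.le, ← Real.rpow_mul hT0.le,
    show β * (1 / (2 * β) + 1) = 1 / 2 + β by field_simp] at h1
  have hR0 : 0 ≤ T / Real.log T ^ (2 * n + 1) := by positivity
  rw [Real.norm_of_nonneg hR0, Real.norm_eq_abs]
  generalize (∑ m ∈ Finset.Icc 2 ⌊T ^ β⌋₊, ZetaSn.coeffSq n m *
    (2 * ZetaSn.f n (Real.log m / (β * Real.log T)) -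
      ZetaSn.f n (Real.log m / (β * Real.log T)) ^ 2)) = W at h1 h2
  -- The factor 2 compensates for log T ≥ 1/2.
  have h3 : T ^ (β * 2) ≤ 2 * (T / Real.log T ^ (2 * n + 1)) := by
    have : 0 < T ^ (β * 2) := by positivity
    nlinarith
  have hmain : T / (2 * Real.pi ^ 2) * ZetaSn.C n -
      T / (2 * Real.pi ^ 2 * β ^ (2 * n) * Real.log T ^ (2 * n)) * (ZetaSn.A n + 1 / (2 * (n : ℝ))) =
      T / (2 * Real.pi ^ 2) * (ZetaSn.C n -
        (ZetaSn.A n + 1 / (2 * (n : ℝ))) / (β * Real.log T) ^ (2 * n)) := by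
    rw [mul_pow]
    have := Real.pi_ne_zero
    field_simp
  rw [hmain]
  have h4 : |T / (2 * Real.pi ^ 2) * W - T / (2 * Real.pi ^ 2) * (ZetaSn.C n -
      (ZetaSn.A n + 1 / (2 * (n : ℝ))) / (β * Real.log T) ^ (2 * n))| ≤
      K' / (2 * Real.pi ^ 2 * β ^ (2 * n + 1)) * (T / Real.log T ^ (2 * n + 1)) := by
    rw [← mul_sub, abs_mul, abs_of_nonneg (by positivity)]
    calc _ ≤ T / (2 * Real.pi ^ 2) * (K' / (β * Real.log T) ^ (2 * n + 1)) := by gcongr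
      _ = _ := by
        rw [mul_pow]
        have := Real.pi_ne_zero
        field_simp
  refine (abs_sub_le _ (T / (2 * Real.pi ^ 2) * W) _).trans ?_
  rw [add_mul]
  refine add_le_add (h1.trans ?_) h4
  rw [mul_assoc]
  gcongr
  linarith
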